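/- **Lemma (asymptotic missing information principle).** Let $\mathcal X$ be a compact Polish space with its Borel $\sigma$-field, $\mu$ a finite measure on $\mathcal X$, $\mathcal Y\subset\mathbb R^m$ ($m\ge 1$) measurable, $\nu$ a finite measure carried by $\mathcal Y$, and $\Theta\subset\mathbb R^d$ compact. For $\theta\in\Theta$ let $q_\theta(x,x')$ be a transition density on $\mathcal X$ with respect to $\mu$ and $g_\theta(y|x)$ a conditional density of an observation given the hidden state with respect to $\nu$ (both jointly measurable), and let $\bar{\mathbb P}_\theta$ be the law of the two-sided stationary hidden Markov model $(X_k,Y_k)_{k\in\mathbb Z}$ with these densities. Let $\varepsilon>0$ and $Y^\varepsilon_k=Y_k+\varepsilon Z_k$, where the $Z_k$ are i.i.d. uniform on the closed unit ball of $\mathbb R^m$ and independent of $(X_k,Y_k)_{k}$ (the same letters $\bar{\mathbb P}_\theta,\bar{\mathbb E}_\theta$ are used for the extended process). With $B^\varepsilon_y$ the closed ball of radius $\varepsilon$ about $y$, put $$g^\varepsilon_\theta(y|x)=\frac1{\nu(B^\varepsilon_y)}\int_{B^\varepsilon_y}g_\theta(y'|x)\,\nu(dy') ,$$ which is the conditional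 density of $Y^\varepsilon_k$ given $X_k=x$ with respect to $\nu_\varepsilon=\nu*\mathrm{Unif}(B^\varepsilon_0)$. Let $\theta^*\in\Theta$ and assume: * (A1) $\theta^*$ is in the interior of $\Theta$, and for $\theta\in\Theta$ the law of $(Y_k)_{k\in\mathbb Z}$ under $\bar{\mathbb P}_\theta$ equals that under $\bar{\mathbb P}_{\theta^*}$ if and only if $\theta=\theta^*$; * (A2) for all $x,x'\in\mathcal X$, $y\in\mathcal Y$, the maps $\theta\mapsto q_\theta(x,x')$ and $\theta\mapsto g_\theta(y|x)$ are continuous on $\Theta$; * (A3) there are constants $0<\underline c_1\le\overline c_1<\infty$ with $\underline c_1\le q_\theta(x,x'),\,g_\theta(y|x)\le\overline c_1$ for all $x,x'\in\mathcal X$, $y\in\mathcal Y$, $\theta\in\Theta$; and, for some open ball $G\subset\Theta$ centred at $\theta^*$, * (A4) for all $x,x'\in\mathcal X$, $y\in\mathcal Y$, the maps $\theta\mapsto q_\theta(x,x')$ and $\theta\mapsto g_\theta(y|x)$ are twice continuously differentiable on $G$; * (A5) there is $\overline c_2<\infty$ bounding $|\nabla_\theta\log q_\theta(x,x')|$, $|\nabla_\theta\log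 g_\theta(y|x)|$, $|\nabla^2_\theta\log q_\theta(x,x')|$ and $|\nabla^2_\theta\log g_\theta(y|x)|$ for all $x,x'\in\mathcal X$, $y\in\mathcal Y$, $\theta\in G$. Then the following hold. 1. For every $\theta\in\Theta$ the conditional densities $$p_\theta(y_1|y_{-\infty:0}),\quad p^\varepsilon_\theta(y^\varepsilon_1|y^\varepsilon_{-\infty:0}),\quad p_\theta(y_0|y_{-\infty:-1};y^\varepsilon_{1:\infty}),\quad p_\theta(y^\varepsilon_0|y_{-\infty:-1};y^\varepsilon_{1:\infty})$$ are well defined for all sequences with $y_k\in\mathcal Y$ and $\nu(B^\varepsilon_{y^\varepsilon_k})>0$, as positive limits, uniform in the initial state $x$, of the finite-window conditional densities given $X_{-n}=x$ and the observations from time $-n$ on (the first two, as $n\to\infty$), respectively given $X_{-n}=x$, $y_{-n:-1}$ and $y^\varepsilon_{1:k}$ (the last two, as $n,k\to\infty$). The observed sequences are $\bar{\mathbb P}_\theta$-almost surely of this kind, and under $\bar{\mathbb P}_\theta$ these limits are densities, with respect to $\nu$, $\nu_\varepsilon$, $\nu$, $\nu_\varepsilon$ respectively, of the conditional laws of $Y_1$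 given $Y_{-\infty:0}$, of $Y^\varepsilon_1$ given $Y^\varepsilon_{-\infty:0}$, and of $Y_0$ and of $Y^\varepsilon_0$ given $Y_{-\infty:-1};Y^\varepsilon_{1:\infty}$. Their logarithms are differentiable in $\theta$ at $\theta^*$, with gradients there that, evaluated along the observed sequences, are square integrable under $\bar{\mathbb P}_{\theta^*}$. 2. With $$I(\theta^*)=\bar{\mathbb E}_{\theta^*}\big[\nabla_\theta\log p_{\theta^*}(Y_1|Y_{-\infty:0})\,\nabla_\theta\log p_{\theta^*}(Y_1|Y_{-\infty:0})^T\big],$$ $$I^\varepsilon(\theta^*)=\bar{\mathbb E}_{\theta^*}\big[\nabla_\theta\log p^\varepsilon_{\theta^*}(Y^\varepsilon_1|Y^\varepsilon_{-\infty:0})\,\nabla_\theta\log p^\varepsilon_{\theta^*}(Y^\varepsilon_1|Y^\varepsilon_{-\infty:0})^T\big],$$ and, writing $\mathcal G=\sigma(Y_{-\infty:-1};Y^\varepsilon_{1:\infty})$, $S=\nabla_\theta\log p_{\theta^*}(Y_0|Y_{-\infty:-1};Y^\varepsilon_{1:\infty})$ and $S^\varepsilon=\nabla_\theta\log p_{\theta^*}(Y^\varepsilon_0|Y_{-\infty:-1};Y^\varepsilon_{1:\infty})$,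 $$I^{Y_0:Y^\varepsilon_0}_{Y_{-\infty:-1};Y^\varepsilon_{1:\infty}}(\theta^*)=\bar{\mathbb E}_{\theta^*}[SS^T\,|\,\mathcal G]-\bar{\mathbb E}_{\theta^*}[S^\varepsilon (S^\varepsilon)^T\,|\,\mathcal G],$$ one has $$I(\theta^*)=I^\varepsilon(\theta^*)+\bar{\mathbb E}_{\theta^*}\Big[I^{Y_0:Y^\varepsilon_0}_{Y_{-\infty:-1};Y^\varepsilon_{1:\infty}}(\theta^*)\Big].$$ -/

import Mathlib

open MeasureTheory ProbabilityTheory Filter Topology Set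

noncomputable section

namespace ABCHMM

/-! ### Hidden Markov models: transition kernel and stationary two-sided law -/

/-- Transition kernel of the joint chain `(X, Y)` on `𝓧 × ℝᵐ`: from `(x, y)` the chain moves to
`(x', y')` with density `q x x' * g y' x'` with respect to `μ ⊗ ν`. -/
def jointKernel {𝓧 : Type*} [MeasurableSpace 𝓧] {m : ℕ}
    (μ : Measure 𝓧) [IsFiniteMeasure μ]
    (ν : Measure (EuclideanSpace ℝ (Fin m))) [IsFiniteMeasure ν]
    (q : 𝓧 → 𝓧 → ℝ) (g : EuclideanSpace ℝ (Fin m) → 𝓧 → ℝ) :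
    Kernel (𝓧 × EuclideanSpace ℝ (Fin m)) (𝓧 × EuclideanSpace ℝ (Fin m)) :=
  Kernel.withDensity (Kernel.const _ (μ.prod ν))
    (fun s z => ENNReal.ofReal (q s.1 z.1 * g z.2 z.1))

/-- `P` is the law of a two-sided stationary Markov chain with transition kernel `κ`:
`P` is a shift-invariant probability measure on paths, and the joint law of the past up to time
`k` and the state at time `k + 1` is (law of the past) ⊗ (`κ` started from the state at time `k`). -/
structure IsStationaryMarkovLaw {S : Type*} [MeasurableSpace S] (κ : Kernel S S)
    (P : Measure (ℤ → S)) : Prop where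
  isProbabilityMeasure : IsProbabilityMeasure P
  stationary : P.map (fun ω (k : ℤ) => ω (k + 1)) = P
  markov : ∀ k : ℤ,
    P.map (fun ω => ((fun j : Set.Iic k => ω j), ω (k + 1))) =
      (P.map (fun ω (j : Set.Iic k) => ω j)) ⊗ₘ
        (κ.comap (fun past : Set.Iic k → S => past ⟨k, le_refl k⟩) (measurable_pi_apply _))

/-- A family of hidden Markov models with hidden states in `𝓧` and observations in `𝒴 ⊆ ℝᵐ`,
parametrised by `θ` in a compact set `Θ ⊆ ℝᵈ`; `q θ x x'` is the transition density with respect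
to the finite measure `μ`, `g θ y x` is the conditional density `g_θ(y | x)` with respect to the
finite measure `ν` carried by `𝒴`, and `law θ` is the law of the two-sided stationary process
`(X_k, Y_k)`. Values at parameters outside `Θ` play no role. -/
structure HMMFamily (𝓧 : Type*) [MeasurableSpace 𝓧] (d m : ℕ) where
  Θ : Set (EuclideanSpace ℝ (Fin d))
  isCompact_Θ : IsCompact Θ
  μ : Measure 𝓧
  [finite_μ : IsFiniteMeasure μ]
  𝒴 : Set (EuclideanSpace ℝ (Fin m))
  measurableSet_𝒴 : MeasurableSet 𝒴
  ν : Measure (EuclideanSpace ℝ (Fin m))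
  [finite_ν : IsFiniteMeasure ν]
  ν_compl : ν 𝒴ᶜ = 0
  q : EuclideanSpace ℝ (Fin d) → 𝓧 → 𝓧 → ℝ
  measurable_q : ∀ θ ∈ Θ, Measurable (Function.uncurry (q θ))
  q_nonneg : ∀ θ ∈ Θ, ∀ x x', 0 ≤ q θ x x'
  integral_q : ∀ θ ∈ Θ, ∀ x, ∫ x', q θ x x' ∂μ = 1
  g : EuclideanSpace ℝ (Fin d) → EuclideanSpace ℝ (Fin m) → 𝓧 → ℝ
  measurable_g : ∀ θ ∈ Θ, Measurable (Function.uncurry (g θ))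
  g_nonneg : ∀ θ ∈ Θ, ∀ y ∈ 𝒴, ∀ x, 0 ≤ g θ y x
  integral_g : ∀ θ ∈ Θ, ∀ x, ∫ y, g θ y x ∂ν = 1
  law : EuclideanSpace ℝ (Fin d) → Measure (ℤ → 𝓧 × EuclideanSpace ℝ (Fin m))
  law_stationary : ∀ θ ∈ Θ, IsStationaryMarkovLaw (jointKernel μ ν (q θ) (g θ)) (law θ)

attribute [instance] HMMFamily.finite_μ HMMFamily.finite_ν

/-! ### Finite-window likelihoods -/

/-- With `h k` the likelihood function `x ↦ p(observation at time k | X_k = x)`, this is the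
likelihood, given `X_a = x`, of the observations at the times `a + 1, …, a + n`, that is
`∫ ∏_{k = a + 1}^{a + n} q(x_{k-1}, x_k) h_k(x_k) μ(dx_{a+1}) ⋯ μ(dx_{a+n})` with `x_a = x`. -/
def lik {𝓧 : Type*} [MeasurableSpace 𝓧] (q : 𝓧 → 𝓧 → ℝ) (μ : Measure 𝓧) (h : ℤ → 𝓧 → ℝ) :
    ℕ → ℤ → 𝓧 → ℝ
  | 0, _, _ => 1
  | n + 1, a, x => ∫ x', q x x' * h (a + 1) x' * lik q μ h n (a + 1) x' ∂μ

/-- Conditional density, given `X_a = x`, of the observation at time `t` given all the other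
observations at the times `a + 1, …, a + n`. (An observation at time `a` would only contribute a
factor that cancels.) -/
def condLik {𝓧 : Type*} [MeasurableSpace 𝓧] (q : 𝓧 → 𝓧 → ℝ) (μ : Measure 𝓧) (h : ℤ → 𝓧 → ℝ)
    (t : ℤ) (n : ℕ) (a : ℤ) (x : 𝓧) : ℝ :=
  lik q μ h n a x / lik q μ (Function.update h t (fun _ => 1)) n a x

/-- `p(y_1 | y_{-n:0}; X_{-n} = x)` as a function of `(n, x)`. -/
def predWindow {𝓧 : Type*} [MeasurableSpace 𝓧] (q : 𝓧 → 𝓧 → ℝ) (μ : Measure 𝓧)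
    (h : ℤ → 𝓧 → ℝ) (w : ℕ × 𝓧) : ℝ :=
  condLik q μ h 1 (w.1 + 1) (-(w.1 : ℤ)) w.2

/-- `p(y_0 | y_{-n:-1}; y_{1:k}; X_{-n} = x)` as a function of `((n, k), x)`. -/
def smoothWindow {𝓧 : Type*} [MeasurableSpace 𝓧] (q : 𝓧 → 𝓧 → ℝ) (μ : Measure 𝓧)
    (h : ℤ → 𝓧 → ℝ) (w : (ℕ × ℕ) × 𝓧) : ℝ :=
  condLik q μ h 0 (w.1.1 + w.1.2) (-(w.1.1 : ℤ)) w.2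

/-- `n → ∞`, uniformly in the initial state `x`. -/
def predFilter (𝓧 : Type*) : Filter (ℕ × 𝓧) := atTop ×ˢ ⊤

/-- `n, k → ∞`, uniformly in the initial state `x`. -/
def smoothFilter (𝓧 : Type*) : Filter ((ℕ × ℕ) × 𝓧) := (atTop ×ˢ atTop) ×ˢ ⊤

/-! ### The extended process: hidden states, observations, noise -/

/-- The uniform distribution on the closed unit ball of `ℝᵐ`. -/
def unifBall (m : ℕ) : Measure (EuclideanSpace ℝ (Fin m)) :=
  ProbabilityTheory.cond volume (Metric.closedBall 0 1)

/-- Sample space of the extended process: a path of `(X_k, Y_k)` and a path of the noise `Z_k`. -/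
abbrev Sample (𝓧 : Type*) (m : ℕ) : Type _ :=
  (ℤ → 𝓧 × EuclideanSpace ℝ (Fin m)) × (ℤ → EuclideanSpace ℝ (Fin m))

/-- The clean observations `(Y_k)`. -/
def Y {𝓧 : Type*} {m : ℕ} (ω : Sample 𝓧 m) (k : ℤ) : EuclideanSpace ℝ (Fin m) := (ω.1 k).2

/-- The noisy observations `Y^ε_k = Y_k + ε Z_k`. -/
def Yn {𝓧 : Type*} {m : ℕ} (ε : ℝ) (ω : Sample 𝓧 m) (k : ℤ) : EuclideanSpace ℝ (Fin m) :=
  (ω.1 k).2 + ε • ω.2 k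

/-- The observations that are clean before time `s` and noisy from time `s` on. -/
def Ymix {𝓧 : Type*} {m : ℕ} (ε : ℝ) (s : ℤ) (ω : Sample 𝓧 m) (k : ℤ) :
    EuclideanSpace ℝ (Fin m) :=
  if k < s then Y ω k else Yn ε ω k

/-- `σ(Y_{-∞:0})`. -/
@[reducible]
def sigmaPast (𝓧 : Type*) [MeasurableSpace 𝓧] (m : ℕ) : MeasurableSpace (Sample 𝓧 m) :=
  MeasurableSpace.comap (fun ω (k : Set.Iic (0 : ℤ)) => Y ω k) inferInstance

/-- `σ(Y^ε_{-∞:0})`. -/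
@[reducible]
def sigmaPastNoisy (𝓧 : Type*) [MeasurableSpace 𝓧] (m : ℕ) (ε : ℝ) :
    MeasurableSpace (Sample 𝓧 m) :=
  MeasurableSpace.comap (fun ω (k : Set.Iic (0 : ℤ)) => Yn ε ω k) inferInstance

/-- `σ(Y_{-∞:-1}; Y^ε_{1:∞})`. -/
@[reducible]
def sigmaMix (𝓧 : Type*) [MeasurableSpace 𝓧] (m : ℕ) (ε : ℝ) : MeasurableSpace (Sample 𝓧 m) :=
  MeasurableSpace.comap
    (fun ω => ((fun k : Set.Iio (0 : ℤ) => Y ω k), (fun k : Set.Ioi (0 : ℤ) => Yn ε ω k)))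
    inferInstance

/-! ### Scores and information matrices -/

/-- The score `∇_θ log p_θ(u)` at `θ₀`. -/
def score {d m : ℕ}
    (p : EuclideanSpace ℝ (Fin d) → (ℤ → EuclideanSpace ℝ (Fin m)) → ℝ)
    (θ₀ : EuclideanSpace ℝ (Fin d)) (u : ℤ → EuclideanSpace ℝ (Fin m)) :
    EuclideanSpace ℝ (Fin d) :=
  gradient (fun θ => Real.log (p θ u)) θ₀

/-- `E[S Sᵀ]`, entry by entry. -/
def outerMean {Ω : Type*} [MeasurableSpace Ω] {d : ℕ} (P : Measure Ω)
    (S : Ω → EuclideanSpace ℝ (Fin d)) : Matrix (Fin d) (Fin d) ℝ :=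
  Matrix.of fun i j => ∫ ω, S ω i * S ω j ∂P

/-- `E[S Sᵀ | 𝒢]`, entry by entry. -/
def condOuterMean {Ω : Type*} [MeasurableSpace Ω] {d : ℕ} (P : Measure Ω)
    (𝒢 : MeasurableSpace Ω) (S : Ω → EuclideanSpace ℝ (Fin d)) (ω : Ω) :
    Matrix (Fin d) (Fin d) ℝ :=
  Matrix.of fun i j => (P[fun ω' => S ω' i * S ω' j | 𝒢]) ω

namespace HMMFamily

variable {𝓧 : Type*} [MeasurableSpace 𝓧] {d m : ℕ}

/-- Stationary law of the extended process `(X_k, Y_k, Z_k)`; the `Z_k` are i.i.d. uniform on the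
closed unit ball and independent of `(X_k, Y_k)`. -/
def P (M : HMMFamily 𝓧 d m) (θ : EuclideanSpace ℝ (Fin d)) : Measure (Sample 𝓧 m) :=
  (M.law θ).prod (Measure.infinitePi (fun _ : ℤ => unifBall m))

/-- The perturbed conditional density `g^ε_θ(y | x) = ν(B^ε_y)⁻¹ ∫_{B^ε_y} g_θ(y' | x) ν(dy')`. -/
def gNoisy (M : HMMFamily 𝓧 d m) (ε : ℝ) (θ : EuclideanSpace ℝ (Fin d))
    (y : EuclideanSpace ℝ (Fin m)) (x : 𝓧) : ℝ :=
  (M.ν.real (Metric.closedBall y ε))⁻¹ * ∫ y' in Metric.closedBall y ε, M.g θ y' x ∂M.ν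

/-- The convolution of `ν` with the uniform distribution on the closed ball of radius `ε`; it is
the dominating measure of the perturbed densities `g^ε`. -/
def νNoisy (M : HMMFamily 𝓧 d m) (ε : ℝ) : Measure (EuclideanSpace ℝ (Fin m)) :=
  (M.ν.prod (unifBall m)).map (fun z => z.1 + ε • z.2)

/-- Likelihood functions of a sequence `u` of clean observations. -/
def emission (M : HMMFamily 𝓧 d m) (θ : EuclideanSpace ℝ (Fin d))
    (u : ℤ → EuclideanSpace ℝ (Fin m)) (k : ℤ) (x : 𝓧) : ℝ :=
  M.g θ (u k) x

/-- Likelihood functions of a sequence `u` of noisy observations. -/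
def emissionNoisy (M : HMMFamily 𝓧 d m) (ε : ℝ) (θ : EuclideanSpace ℝ (Fin d))
    (u : ℤ → EuclideanSpace ℝ (Fin m)) (k : ℤ) (x : 𝓧) : ℝ :=
  M.gNoisy ε θ (u k) x

/-- Likelihood functions of a sequence `u` of observations that are clean before time `s` and
noisy from time `s` on. -/
def emissionMix (M : HMMFamily 𝓧 d m) (ε : ℝ) (s : ℤ) (θ : EuclideanSpace ℝ (Fin d))
    (u : ℤ → EuclideanSpace ℝ (Fin m)) (k : ℤ) (x : 𝓧) : ℝ :=
  if k < s then M.g θ (u k) x else M.gNoisy ε θ (u k) x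

/-- `p_θ(u_1 | u_{-∞:0})` for clean observations. -/
def pPred (M : HMMFamily 𝓧 d m) (θ : EuclideanSpace ℝ (Fin d))
    (u : ℤ → EuclideanSpace ℝ (Fin m)) : ℝ :=
  limUnder (predFilter 𝓧) (predWindow (M.q θ) M.μ (M.emission θ u))

/-- `p^ε_θ(u_1 | u_{-∞:0})` for noisy observations. -/
def pPredNoisy (M : HMMFamily 𝓧 d m) (ε : ℝ) (θ : EuclideanSpace ℝ (Fin d))
    (u : ℤ → EuclideanSpace ℝ (Fin m)) : ℝ :=
  limUnder (predFilter 𝓧) (predWindow (M.q θ) M.μ (M.emissionNoisy ε θ u))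

/-- `p_θ(u_0 | u_{-∞:-1}; u_{1:∞})` for observations that are clean before time `s` and noisy from
time `s` on. For `s = 1` it is the density of `Y_0`, for `s = 0` that of `Y^ε_0`, both given
`Y_{-∞:-1}; Y^ε_{1:∞}`. -/
def pMix (M : HMMFamily 𝓧 d m) (ε : ℝ) (s : ℤ) (θ : EuclideanSpace ℝ (Fin d))
    (u : ℤ → EuclideanSpace ℝ (Fin m)) : ℝ :=
  limUnder (smoothFilter 𝓧) (smoothWindow (M.q θ) M.μ (M.emissionMix ε s θ u))

/-- The asymptotic Fisher information `I(θ)`. -/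
def fisher (M : HMMFamily 𝓧 d m) (θ : EuclideanSpace ℝ (Fin d)) : Matrix (Fin d) (Fin d) ℝ :=
  outerMean (M.P θ) (fun ω => score M.pPred θ (Y ω))

/-- The asymptotic Fisher information `I^ε(θ)` of the perturbed model. -/
def fisherNoisy (M : HMMFamily 𝓧 d m) (ε : ℝ) (θ : EuclideanSpace ℝ (Fin d)) :
    Matrix (Fin d) (Fin d) ℝ :=
  outerMean (M.P θ) (fun ω => score (M.pPredNoisy ε) θ (Yn ε ω))

/-- The random matrix `I^{Y_0 : Y^ε_0}_{Y_{-∞:-1}; Y^ε_{1:∞}}(θ)`: the difference of the Fisher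
informations of the conditional laws of `Y_0` and `Y^ε_0` given `Y_{-∞:-1}; Y^ε_{1:∞}`. -/
def missingInfo (M : HMMFamily 𝓧 d m) (ε : ℝ) (θ : EuclideanSpace ℝ (Fin d))
    (ω : Sample 𝓧 m) : Matrix (Fin d) (Fin d) ℝ :=
  condOuterMean (M.P θ) (sigmaMix 𝓧 m ε) (fun ω' => score (M.pMix ε 1) θ (Ymix ε 1 ω')) ω -
  condOuterMean (M.P θ) (sigmaMix 𝓧 m ε) (fun ω' => score (M.pMix ε 0) θ (Ymix ε 0 ω')) ω

/-- The expectation of the random matrix `missingInfo`, entry by entry. -/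
def meanMissingInfo (M : HMMFamily 𝓧 d m) (ε : ℝ) (θ : EuclideanSpace ℝ (Fin d)) :
    Matrix (Fin d) (Fin d) ℝ :=
  Matrix.of fun i j => ∫ ω, M.missingInfo ε θ ω i j ∂(M.P θ)

/-! ### The assumptions -/

/-- (A1): `θ₀` is interior and identifiable from the stationary law of the observations. -/
def A1 (M : HMMFamily 𝓧 d m) (θ₀ : EuclideanSpace ℝ (Fin d)) : Prop :=
  θ₀ ∈ interior M.Θ ∧ ∀ θ ∈ M.Θ,
    (θ = θ₀ ↔ (M.law θ).map (fun ω (k : ℤ) => (ω k).2) =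
      (M.law θ₀).map (fun ω (k : ℤ) => (ω k).2))

/-- (A2): continuity of the densities in `θ`. -/
def A2 (M : HMMFamily 𝓧 d m) : Prop :=
  (∀ x x', ContinuousOn (fun θ => M.q θ x x') M.Θ) ∧
  (∀ y ∈ M.𝒴, ∀ x, ContinuousOn (fun θ => M.g θ y x) M.Θ)

/-- (A3): the densities are bounded above and away from zero. -/
def A3 (M : HMMFamily 𝓧 d m) : Prop :=
  ∃ c C : ℝ, 0 < c ∧ 0 < C ∧ ∀ θ ∈ M.Θ,
    (∀ x x', c ≤ M.q θ x x' ∧ M.q θ x x' ≤ C) ∧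
    (∀ y ∈ M.𝒴, ∀ x, c ≤ M.g θ y x ∧ M.g θ y x ≤ C)

/-- (A4): the densities are twice continuously differentiable in `θ ∈ G`. -/
def A4 (M : HMMFamily 𝓧 d m) (G : Set (EuclideanSpace ℝ (Fin d))) : Prop :=
  (∀ x x', ContDiffOn ℝ 2 (fun θ => M.q θ x x') G) ∧
  (∀ y ∈ M.𝒴, ∀ x, ContDiffOn ℝ 2 (fun θ => M.g θ y x) G)

/-- (A5): gradients and Hessians of the log-densities are uniformly bounded on `G`. -/
def A5 (M : HMMFamily 𝓧 d m) (G : Set (EuclideanSpace ℝ (Fin d))) : Prop :=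
  ∃ c : ℝ, 0 < c ∧ ∀ θ ∈ G,
    (∀ x x', ‖gradient (fun ϑ => Real.log (M.q ϑ x x')) θ‖ ≤ c ∧
      ‖fderiv ℝ (gradient (fun ϑ => Real.log (M.q ϑ x x'))) θ‖ ≤ c) ∧
    (∀ y ∈ M.𝒴, ∀ x, ‖gradient (fun ϑ => Real.log (M.g ϑ y x)) θ‖ ≤ c ∧
      ‖fderiv ℝ (gradient (fun ϑ => Real.log (M.g ϑ y x))) θ‖ ≤ c)

/-- Observation sequences that are in `𝒴` before time `s` and, from time `s` on, at points `y`
with `ν(B^ε_y) ≠ 0`, where `g^ε(y | x)` is defined. -/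
def admissibleMix (M : HMMFamily 𝓧 d m) (ε : ℝ) (s : ℤ) : Set (ℤ → EuclideanSpace ℝ (Fin m)) :=
  {u | (∀ k < s, u k ∈ M.𝒴) ∧ ∀ k ≥ s, M.ν (Metric.closedBall (u k) ε) ≠ 0}

/-- The conditional density `p θ u` of the observation at time `t` of the process `U`, given the
`σ`-algebra `𝒢` of other observations, is well defined, and so is its Fisher information at `θ₀`:
it is the limit along `l` of the finite-window conditional densities `w θ u`, for every `θ ∈ Θ`
and every sequence `u ∈ adm`, and it is positive; under the stationary law of each `θ ∈ Θ`, almost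
all sequences are in `adm`, and `p θ` is a version of the density with respect to `ρ` of the
conditional law of `U_t` given `𝒢`; `log p` is differentiable in `θ` at `θ₀`, and the score is
square integrable. -/
structure IsCondDensity (M : HMMFamily 𝓧 d m) (θ₀ : EuclideanSpace ℝ (Fin d))
    (p : EuclideanSpace ℝ (Fin d) → (ℤ → EuclideanSpace ℝ (Fin m)) → ℝ)
    {ι : Type*} (l : Filter ι)
    (w : EuclideanSpace ℝ (Fin d) → (ℤ → EuclideanSpace ℝ (Fin m)) → ι → ℝ)
    (adm : Set (ℤ → EuclideanSpace ℝ (Fin m))) (U : Sample 𝓧 m → ℤ → EuclideanSpace ℝ (Fin m))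
    (t : ℤ) (𝒢 : MeasurableSpace (Sample 𝓧 m)) (ρ : Measure (EuclideanSpace ℝ (Fin m))) :
    Prop where
  tendsto : ∀ θ ∈ M.Θ, ∀ u ∈ adm, Tendsto (w θ u) l (𝓝 (p θ u))
  pos : ∀ θ ∈ M.Θ, ∀ u ∈ adm, 0 < p θ u
  ae_mem : ∀ θ ∈ M.Θ, ∀ᵐ ω ∂(M.P θ), U ω ∈ adm
  condLaw : ∀ θ ∈ M.Θ, ∀ A : Set (EuclideanSpace ℝ (Fin m)), MeasurableSet A →
    (M.P θ)[fun ω => A.indicator (fun _ => (1 : ℝ)) (U ω t) | 𝒢] =ᵐ[M.P θ]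
      fun ω => ∫ v in A, p θ (Function.update (U ω) t v) ∂ρ
  differentiableAt : ∀ u ∈ adm, DifferentiableAt ℝ (fun θ => Real.log (p θ u)) θ₀
  memLp_score : MemLp (fun ω => score p θ₀ (U ω)) 2 (M.P θ₀)

end HMMFamily

end ABCHMM

end

open MeasureTheory ProbabilityTheory Filter Topology Set

set_option linter.unusedSectionVars false

noncomputable section

namespace ABCHMM

/-! ### Weighted averages and the Doeblin contraction -/

section Averages

variable {𝓧 : Type*} [MeasurableSpace 𝓧]

/-! Let F(n, k) be the Fisher information, given the hidden state at the start, of n clean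
observations followed by k noisy ones. Conditioning on the initial hidden state keeps the stationary
law, whose dependence on θ is not controlled, out of every score. The score of a window is the score
of all its observations but one plus the conditional score of that one; the latter is centred given
the rest, so the two are orthogonal and the informations add
(`RegularModel.integral_fullScore_mul_fullScore`). Hence F(n+1, 0) - F(n, 0) and F(0, k+1) - F(0, k)
are conditional informations of one more clean, respectively noisy, observation given the preceding
ones. By stationarity F(n+1, k) - F(n, k+1) is the difference of the conditional informations of Y_0
and Y^ε_0 given n clean observations before and k noisy ones after. These increments tend to I, I^ε
and the mean missing information D, with geometric errors. Going from F(T, 0) to F(0, T) through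
F(0, 0), or along the antidiagonal, gives T (I - I^ε) = T D + O(1), so I = I^ε + D
(`eq_add_of_telescoping`).

The geometric errors come from a Doeblin argument. Likelihoods solve a linear recursion backwards in
time. The ratio of two solutions is averaged at each step, and its oscillation contracts by 1 - c/C
(`exists_interval_wavg`). A conditional density is such a ratio, of the likelihoods with and without
one observation, so it forgets the initial state and, similarly, the remote future. Logarithmic
derivatives obey the same recursion with a source term. In the difference of two of them the source
cancels up to a change of weights by a nearly constant ratio, so conditional scores forget as well
(`TransferDeriv.abs_sub_le`). Uniform convergence of the scores lets limit and derivative be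
exchanged (`RegularFamily.exists_fderiv_log_condDensity_bound`).

Probability enters through resampling: redrawing one observation from its window conditional density
preserves the joint law of initial state and window (`IsObservedChain.lintegral_resample`). In the
limit this identifies the conditional laws (`IsObservedChain.condLaw`). A third kind of observation,
missing, with density 1, makes prediction a case of smoothing, so the four densities are treated
together. -/

/-- Measurable functions with values in a compact subinterval of `(0, ∞)`. -/
def PosBdd (f : 𝓧 → ℝ) : Prop :=
  Measurable f ∧ ∃ a b : ℝ, 0 < a ∧ ∀ x, a ≤ f x ∧ f x ≤ b

/-- Bounded measurable functions. -/
def BddMeas (f : 𝓧 → ℝ) : Prop :=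
  Measurable f ∧ ∃ b : ℝ, ∀ x, |f x| ≤ b

lemma PosBdd.pos {f : 𝓧 → ℝ} (hf : PosBdd f) (x : 𝓧) : 0 < f x := by
  obtain ⟨_, a, b, ha, h⟩ := hf
  exact ha.trans_le (h x).1

lemma PosBdd.bddMeas {f : 𝓧 → ℝ} (hf : PosBdd f) : BddMeas f := by
  have hp := hf.pos
  obtain ⟨h1, a, b, ha, h⟩ := hf
  exact ⟨h1, b, fun x => by rw [abs_of_pos (hp x)]; exact (h x).2⟩

lemma PosBdd.mul {f g : 𝓧 → ℝ} (hf : PosBdd f) (hg : PosBdd g) :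
    PosBdd (fun x => f x * g x) := by
  have hfp := hf.pos
  obtain ⟨hfm, a, b, ha, hf⟩ := hf
  obtain ⟨hgm, a', b', ha', hg⟩ := hg
  refine ⟨hfm.mul hgm, a * a', b * b', by positivity, fun x => ⟨?_, ?_⟩⟩
  · exact mul_le_mul (hf x).1 (hg x).1 ha'.le (ha.le.trans (hf x).1)
  · exact mul_le_mul (hf x).2 (hg x).2 (ha'.le.trans (hg x).1)
      ((hfp x).le.trans (hf x).2)

lemma PosBdd.inv {f : 𝓧 → ℝ} (hf : PosBdd f) : PosBdd (fun x => (f x)⁻¹) := by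
  have hfp := hf.pos
  obtain ⟨hfm, a, b, ha, hf⟩ := hf
  -- On an empty space `b` need not be positive, hence `max b 1`.
  refine ⟨hfm.inv, (max b 1)⁻¹, a⁻¹, by positivity, fun x => ⟨?_, ?_⟩⟩
  · exact inv_anti₀ (hfp x) ((hf x).2.trans (le_max_left _ _))
  · exact inv_anti₀ ha (hf x).1

lemma PosBdd.div {f g : 𝓧 → ℝ} (hf : PosBdd f) (hg : PosBdd g) :
    PosBdd (fun x => f x / g x) := by
  simpa only [div_eq_mul_inv] using hf.mul hg.inv

lemma BddMeas.mul {f g : 𝓧 → ℝ} (hf : BddMeas f) (hg : BddMeas g) :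
    BddMeas (fun x => f x * g x) := by
  obtain ⟨hfm, b, hf⟩ := hf
  obtain ⟨hgm, b', hg⟩ := hg
  refine ⟨hfm.mul hgm, b * b', fun x => ?_⟩
  rw [abs_mul]
  exact mul_le_mul (hf x) (hg x) (abs_nonneg _) ((abs_nonneg _).trans (hf x))

lemma BddMeas.add {f g : 𝓧 → ℝ} (hf : BddMeas f) (hg : BddMeas g) :
    BddMeas (fun x => f x + g x) := by
  obtain ⟨hfm, b, hf⟩ := hf
  obtain ⟨hgm, b', hg⟩ := hg
  exact ⟨hfm.add hgm, b + b', fun x => (abs_add_le _ _).trans (add_le_add (hf x) (hg x))⟩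

lemma BddMeas.sub {f g : 𝓧 → ℝ} (hf : BddMeas f) (hg : BddMeas g) :
    BddMeas (fun x => f x - g x) := by
  obtain ⟨hfm, b, hf⟩ := hf
  obtain ⟨hgm, b', hg⟩ := hg
  exact ⟨hfm.sub hgm, b + b', fun x => (abs_sub _ _).trans (add_le_add (hf x) (hg x))⟩

lemma BddMeas.const (a : ℝ) : BddMeas (fun _ : 𝓧 => a) :=
  ⟨measurable_const, |a|, fun _ => le_rfl⟩

lemma BddMeas.div {f g : 𝓧 → ℝ} (hf : BddMeas f) (hg : PosBdd g) :
    BddMeas (fun x => f x / g x) := by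
  simpa only [div_eq_mul_inv] using hf.mul hg.inv.bddMeas

variable (μ : Measure 𝓧) [IsFiniteMeasure μ]

lemma BddMeas.integrable {f : 𝓧 → ℝ} (hf : BddMeas f) : Integrable f μ := by
  obtain ⟨hfm, b, hf⟩ := hf
  exact Integrable.of_bound hfm.aestronglyMeasurable b (Eventually.of_forall hf)

lemma PosBdd.integrable {f : 𝓧 → ℝ} (hf : PosBdd f) : Integrable f μ :=
  hf.bddMeas.integrable μ

lemma PosBdd.integral_pos [NeZero μ] {f : 𝓧 → ℝ} (hf : PosBdd f) : 0 < ∫ x, f x ∂μ := by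
  rw [integral_pos_iff_support_of_nonneg (fun x => (hf.pos x).le) (hf.integrable μ)]
  have : Function.support f = univ := by
    ext x; simp [(hf.pos x).ne']
  rw [this]
  exact pos_iff_ne_zero.2 (by simpa using NeZero.ne μ)

/-- The average of `f` with respect to the weight `w`. -/
def wavg (w f : 𝓧 → ℝ) : ℝ := (∫ x, w x * f x ∂μ) / ∫ x, w x ∂μ

variable {μ}

lemma wavg_add [NeZero μ] {w f g : 𝓧 → ℝ} (hw : PosBdd w) (hf : BddMeas f) (hg : BddMeas g) :
    wavg μ w (fun x => f x + g x) = wavg μ w f + wavg μ w g := by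
  unfold wavg
  rw [← add_div, ← integral_add ((hw.bddMeas.mul hf).integrable μ)
    ((hw.bddMeas.mul hg).integrable μ)]
  simp only [mul_add]

lemma wavg_sub [NeZero μ] {w f g : 𝓧 → ℝ} (hw : PosBdd w) (hf : BddMeas f) (hg : BddMeas g) :
    wavg μ w (fun x => f x - g x) = wavg μ w f - wavg μ w g := by
  unfold wavg
  rw [← sub_div, ← integral_sub ((hw.bddMeas.mul hf).integrable μ)
    ((hw.bddMeas.mul hg).integrable μ)]
  simp only [mul_sub]

lemma wavg_const [NeZero μ] {w : 𝓧 → ℝ} (hw : PosBdd w) (a : ℝ) :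
    wavg μ w (fun _ => a) = a := by
  unfold wavg
  rw [integral_mul_const, mul_div_assoc, mul_comm, div_mul_cancel₀ _ (hw.integral_pos μ).ne']

lemma wavg_mono [NeZero μ] {w f g : 𝓧 → ℝ} (hw : PosBdd w) (hf : BddMeas f) (hg : BddMeas g)
    (h : ∀ x, f x ≤ g x) : wavg μ w f ≤ wavg μ w g := by
  unfold wavg
  apply div_le_div_of_nonneg_right _ (hw.integral_pos μ).le
  exact integral_mono ((hw.bddMeas.mul hf).integrable μ) ((hw.bddMeas.mul hg).integrable μ)
    fun x => mul_le_mul_of_nonneg_left (h x) (hw.pos x).le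

lemma abs_wavg_le [NeZero μ] {w f : 𝓧 → ℝ} (hw : PosBdd w) (hf : BddMeas f) {K : ℝ}
    (h : ∀ x, |f x| ≤ K) : |wavg μ w f| ≤ K := by
  rw [abs_le]
  constructor
  · rw [← wavg_const (μ := μ) hw (-K)]
    exact wavg_mono hw (.const _) hf fun x => (abs_le.1 (h x)).1
  · rw [← wavg_const (μ := μ) hw K]
    exact wavg_mono hw hf (.const _) fun x => (abs_le.1 (h x)).2

/-- Doeblin lower bound for a nonnegative function. -/
lemma wavg_doeblin [NeZero μ] {q k f : 𝓧 → ℝ} {c C : ℝ} (hc : 0 < c) (hq : Measurable q)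
    (hcq : ∀ x, c ≤ q x ∧ q x ≤ C) (hk : PosBdd k) (hf : BddMeas f) (hf0 : ∀ x, 0 ≤ f x) :
    c / C * wavg μ k f ≤ wavg μ (fun x => q x * k x) f := by
  have hqp : PosBdd q := ⟨hq, c, C, hc, hcq⟩
  have hqk := hqp.mul hk
  obtain ⟨x₀⟩ : Nonempty 𝓧 := by
    by_contra h
    rw [not_nonempty_iff] at h
    exact NeZero.ne μ (Measure.eq_zero_of_isEmpty μ)
  have hC : 0 < C := hc.trans_le ((hcq x₀).1.trans (hcq x₀).2)
  unfold wavg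
  have h1 := hk.integral_pos μ
  have h2 := hqk.integral_pos μ
  have h3 : c * ∫ x, k x * f x ∂μ ≤ ∫ x, q x * k x * f x ∂μ := by
    rw [← integral_const_mul]
    refine integral_mono (((hk.bddMeas.mul hf).integrable μ).const_mul _)
      ((hqk.bddMeas.mul hf).integrable μ) fun x => ?_
    have := mul_le_mul_of_nonneg_right (hcq x).1 (mul_nonneg (hk.pos x).le (hf0 x))
    dsimp only
    linarith
  have h4 : ∫ x, q x * k x ∂μ ≤ C * ∫ x, k x ∂μ := by
    rw [← integral_const_mul]
    exact integral_mono (hqk.integrable μ) ((hk.integrable μ).const_mul _) fun x =>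
      mul_le_mul_of_nonneg_right (hcq x).2 (hk.pos x).le
  have h5 : 0 ≤ ∫ x, k x * f x ∂μ :=
    integral_nonneg fun x => mul_nonneg (hk.pos x).le (hf0 x)
  rw [div_mul_div_comm]
  calc c * (∫ x, k x * f x ∂μ) / (C * ∫ x, k x ∂μ)
      ≤ c * (∫ x, k x * f x ∂μ) / ∫ x, q x * k x ∂μ :=
        div_le_div_of_nonneg_left (by positivity) h2 h4
    _ ≤ _ := div_le_div_of_nonneg_right h3 h2.le

/-- Averaging with weights `q x · * k`, where `c ≤ q ≤ C`, maps functions with values in an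
interval to functions with values in a subinterval that is shorter by the factor `1 - c / C`. -/
lemma exists_interval_wavg [NeZero μ] {q : 𝓧 → 𝓧 → ℝ} {k f : 𝓧 → ℝ} {c C : ℝ} (hc : 0 < c)
    (hq : ∀ x, Measurable (q x)) (hcq : ∀ x x', c ≤ q x x' ∧ q x x' ≤ C) (hk : PosBdd k)
    (hf : BddMeas f) {a K : ℝ} (hfa : ∀ x, a ≤ f x ∧ f x ≤ a + K) :
    ∃ a' : ℝ, a ≤ a' ∧ a' + (1 - c / C) * K ≤ a + K ∧
      ∀ x, a' ≤ wavg μ (fun x' => q x x' * k x') f ∧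
        wavg μ (fun x' => q x x' * k x') f ≤ a' + (1 - c / C) * K := by
  have hηa : a ≤ wavg μ k f := by
    rw [← wavg_const (μ := μ) hk a]
    exact wavg_mono hk (.const _) hf fun x => (hfa x).1
  have hηb : wavg μ k f ≤ a + K := by
    rw [← wavg_const (μ := μ) hk (a + K)]
    exact wavg_mono hk hf (.const _) fun x => (hfa x).2
  obtain ⟨x₀⟩ : Nonempty 𝓧 := by
    by_contra h
    rw [not_nonempty_iff] at h
    exact NeZero.ne μ (Measure.eq_zero_of_isEmpty μ)
  have hC : 0 < C := hc.trans_le ((hcq x₀ x₀).1.trans (hcq x₀ x₀).2)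
  have hδ : 0 < c / C := by positivity
  -- The average with weight `k` alone does not depend on `x`. Doeblin's bound for `f - a` and for
  -- `a + K - f` moves each end of the interval towards it by `c / C` times the distance; together
  -- the ends approach by `c / C * K`.
  refine ⟨a + c / C * (wavg μ k f - a), ?_, ?_, fun x => ⟨?_, ?_⟩⟩
  · nlinarith
  · nlinarith
  · have hw : PosBdd (fun x' => q x x' * k x') := PosBdd.mul ⟨hq x, c, C, hc, hcq x⟩ hk
    have := wavg_doeblin (μ := μ) hc (hq x) (hcq x) hk (hf.sub (.const a))
      fun x => sub_nonneg.2 (hfa x).1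
    rw [wavg_sub hk hf (.const _), wavg_sub hw hf (.const _), wavg_const hk, wavg_const hw] at this
    linarith
  · have hw : PosBdd (fun x' => q x x' * k x') := PosBdd.mul ⟨hq x, c, C, hc, hcq x⟩ hk
    have := wavg_doeblin (μ := μ) hc (hq x) (hcq x) hk ((BddMeas.const (a + K)).sub hf)
      fun x => sub_nonneg.2 (hfa x).2
    rw [wavg_sub hk (.const _) hf, wavg_sub hw (.const _) hf, wavg_const hk, wavg_const hw] at this
    linarith

/-- Iterated averaging, up to geometrically small errors, forgets the starting point. -/
lemma abs_sub_le_of_iterated_wavg [NeZero μ] {c C r e K₀ b : ℝ} (hc : 0 < c) (hr1 : r < 1)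
    (hr0 : 0 < r) (he : 0 ≤ e) (hb0 : 2 * K₀ ≤ b)
    (hb : 2 * e ≤ b * (r - (1 - c / C))) {q : 𝓧 → 𝓧 → ℝ}
    (hq : ∀ x, Measurable (q x)) (hcq : ∀ x x', c ≤ q x x' ∧ q x x' ≤ C) {f k : ℕ → 𝓧 → ℝ}
    (hk : ∀ n, PosBdd (k n)) (hf : ∀ n, BddMeas (f n)) (hf0 : ∀ x, |f 0 x| ≤ K₀)
    (hstep : ∀ n x, |f (n + 1) x - wavg μ (fun x' => q x x' * k n x') (f n)| ≤ e * r ^ n)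
    {i j : ℕ} (hij : i ≤ j) (x x' : 𝓧) :
    |f j x - f i x'| ≤ (b + e) * (1 + (1 - r)⁻¹) * r ^ i := by
  have hb00 : 0 ≤ b := (by have := (abs_nonneg _).trans (hf0 x); linarith)
  -- Averaging multiplies the oscillation by `1 - c / C` and the error adds at most `2 * e * r ^ n`;
  -- `hb` ensures that the result is at most `b * r ^ (n + 1)`.
  have hosc : ∀ n, ∃ a, ∀ x, a ≤ f n x ∧ f n x ≤ a + b * r ^ n := by
    intro n
    induction n with
    | zero => exact ⟨-K₀, fun x => by
        have := abs_le.1 (hf0 x)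
        rw [pow_zero]
        constructor <;> linarith⟩
    | succ n ih =>
      obtain ⟨a, ha⟩ := ih
      obtain ⟨a', h1, h2, h3⟩ := exists_interval_wavg (μ := μ) hc hq hcq (hk n) (hf n) ha
      refine ⟨a' - e * r ^ n, fun x => ?_⟩
      have h4 := abs_le.1 (hstep n x)
      have h5 := h3 x
      have h6 : (1 - c / C) * (b * r ^ n) + 2 * e * r ^ n ≤ b * r ^ (n + 1) := by
        have := mul_le_mul_of_nonneg_right hb (pow_nonneg hr0.le n)
        rw [pow_succ]; nlinarith
      constructor <;> linarith
  -- An average of `f n` lies in the interval containing the values of `f n`, so the new function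
  -- differs from the old one by at most an oscillation and an error, at any pair of points.
  have hnext : ∀ n x x', |f (n + 1) x - f n x'| ≤ (b + e) * r ^ n := by
    intro n x x'
    obtain ⟨a, ha⟩ := hosc n
    obtain ⟨a', h1, h2, h3⟩ := exists_interval_wavg (μ := μ) hc hq hcq (hk n) (hf n) ha
    have h4 := abs_le.1 (hstep n x)
    have h5 := h3 x
    have h6 := ha x'
    rw [abs_le]
    constructor <;> nlinarith
  have hsame : ∀ n x x', |f n x - f n x'| ≤ (b + e) * r ^ n := by
    intro n x x'
    obtain ⟨a, ha⟩ := hosc n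
    have h5 := ha x
    have h6 := ha x'
    have : 0 ≤ e * r ^ n := by positivity
    rw [abs_le]
    constructor <;> nlinarith
  obtain ⟨l, rfl⟩ := Nat.exists_eq_add_of_le hij
  have h1r : 0 < 1 - r := by linarith
  -- Telescoping over consecutive indices; the partial geometric sum is kept exact so that the
  -- induction closes.
  have key : ∀ l : ℕ, ∀ x, |f (i + l) x - f i x'| ≤
      (b + e) * (r ^ i + (r ^ i - r ^ (i + l)) * (1 - r)⁻¹) := by
    intro l
    induction l with
    | zero => intro x; simpa using hsame i x x'
    | succ l ih =>
      intro x
      have h1 := hnext (i + l) x x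
      have h2 := ih x
      have h3 : |f (i + (l + 1)) x - f i x'| ≤ |f (i + l + 1) x - f (i + l) x| +
          |f (i + l) x - f i x'| := by
        rw [← add_assoc]
        exact abs_sub_le _ _ _
      refine h3.trans ((add_le_add h1 h2).trans (le_of_eq ?_))
      have : r ^ (i + (l + 1)) = r ^ (i + l) * r := by rw [← add_assoc, pow_succ]
      rw [this]
      field_simp
      ring
  refine (key l x).trans ?_
  have h7 : (r ^ i - r ^ (i + l)) * (1 - r)⁻¹ ≤ r ^ i * (1 - r)⁻¹ := by
    apply mul_le_mul_of_nonneg_right _ (by positivity)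
    have : 0 ≤ r ^ (i + l) := by positivity
    linarith
  have : 0 ≤ b + e := by linarith
  nlinarith

/-- Two sequences of positive functions obtained by iterating the same transfer operators
`f ↦ ∫ q · y * h n y * f y ∂μ`. -/
structure TransferPair (μ : Measure 𝓧) (q : 𝓧 → 𝓧 → ℝ) (h u v : ℕ → 𝓧 → ℝ) : Prop where
  posBdd_h : ∀ n, PosBdd (h n)
  posBdd_u : ∀ n, PosBdd (u n)
  posBdd_v : ∀ n, PosBdd (v n)
  u_succ : ∀ n x, u (n + 1) x = ∫ y, q x y * h n y * u n y ∂μ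
  v_succ : ∀ n x, v (n + 1) x = ∫ y, q x y * h n y * v n y ∂μ

/-- Iterates of the formal derivatives of the transfer operators in a `TransferPair`; `s` is the
logarithmic derivative of the kernel. -/
structure TransferDeriv (μ : Measure 𝓧) (q : 𝓧 → 𝓧 → ℝ) (h u v : ℕ → 𝓧 → ℝ)
    (s : ℕ → 𝓧 → 𝓧 → ℝ) (S : ℝ) (u' v' : ℕ → 𝓧 → ℝ) : Prop where
  measurable_s : ∀ n x, Measurable (s n x)
  abs_s_le : ∀ n x x', |s n x x'| ≤ S
  bddMeas_u' : ∀ n, BddMeas (u' n)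
  bddMeas_v' : ∀ n, BddMeas (v' n)
  u'_succ : ∀ n x, u' (n + 1) x =
    ∫ x', q x x' * h n x' * (u' n x' + s n x x' * u n x') ∂μ
  v'_succ : ∀ n x, v' (n + 1) x =
    ∫ x', q x x' * h n x' * (v' n x' + s n x x' * v n x') ∂μ

/-- The factor `g` in the weight cancels the denominator. This turns two linear recursions with the
same kernel into an averaging recursion for their quotient. -/
lemma wavg_mul_weight {w f g : 𝓧 → ℝ} (hg : ∀ x, g x ≠ 0) :
    wavg μ (fun x => w x * g x) (fun x => f x / g x) =
      (∫ x, w x * f x ∂μ) / ∫ x, w x * g x ∂μ := by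
  unfold wavg
  congr 1
  refine integral_congr_ae (Eventually.of_forall fun x => ?_)
  have := hg x
  dsimp only
  field_simp

section Pair

variable [NeZero μ] {q : 𝓧 → 𝓧 → ℝ} {c C : ℝ} {h u v : ℕ → 𝓧 → ℝ}

lemma TransferPair.ratio_succ (H : TransferPair μ q h u v) (n : ℕ) (x : 𝓧) :
    u (n + 1) x / v (n + 1) x =
      wavg μ (fun x' => q x x' * (h n x' * v n x')) (fun x' => u n x' / v n x') := by
  simp only [← mul_assoc]
  rw [wavg_mul_weight (fun x => ((H.posBdd_v n).pos x).ne'), H.u_succ, H.v_succ]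

/-- Averages stay between the bounds of the averaged function. The lower bound `α` later permits
logarithms of the ratio and division by it. -/
lemma TransferPair.ratio_mem (H : TransferPair μ q h u v) (hc : 0 < c)
    (hq : ∀ x, Measurable (q x)) (hcq : ∀ x x', c ≤ q x x' ∧ q x x' ≤ C) {α β : ℝ}
    (h0 : ∀ x, α ≤ u 0 x / v 0 x ∧ u 0 x / v 0 x ≤ β) (n : ℕ) (x : 𝓧) :
    α ≤ u n x / v n x ∧ u n x / v n x ≤ β := by
  induction n generalizing x with
  | zero => exact h0 x
  | succ n ih =>
    have hw : PosBdd (fun x' => q x x' * (h n x' * v n x')) :=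
      PosBdd.mul ⟨hq x, c, C, hc, hcq x⟩ ((H.posBdd_h n).mul (H.posBdd_v n))
    have hr := ((H.posBdd_u n).div (H.posBdd_v n)).bddMeas
    rw [H.ratio_succ]
    constructor
    · rw [← wavg_const (μ := μ) hw α]
      exact wavg_mono hw (.const _) hr fun x => (ih x).1
    · rw [← wavg_const (μ := μ) hw β]
      exact wavg_mono hw hr (.const _) fun x => (ih x).2

/-- The ratio obeys the averaging recursion without error, so the general estimate applies with `e =
0` and `b = 2 * β`. -/
lemma TransferPair.abs_ratio_sub_le (H : TransferPair μ q h u v) (hc : 0 < c)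
    (hq : ∀ x, Measurable (q x)) (hcq : ∀ x x', c ≤ q x x' ∧ q x x' ≤ C) {α β r : ℝ}
    (hα : 0 < α) (hr1 : r < 1) (hρr : 1 - c / C < r) (hr0 : 0 < r)
    (h0 : ∀ x, α ≤ u 0 x / v 0 x ∧ u 0 x / v 0 x ≤ β) {i j : ℕ} (hij : i ≤ j) (x x' : 𝓧) :
    |u j x / v j x - u i x' / v i x'| ≤ 2 * β * (1 + (1 - r)⁻¹) * r ^ i := by
  have hβ : 0 < β := hα.trans_le ((h0 x).1.trans (h0 x).2)
  have := abs_sub_le_of_iterated_wavg (μ := μ) (e := 0) (K₀ := β) (b := 2 * β)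
    (f := fun n x => u n x / v n x) (k := fun n x => h n x * v n x) hc hr1 hr0 le_rfl le_rfl
    (by nlinarith) hq hcq (fun n => (H.posBdd_h n).mul (H.posBdd_v n))
    (fun n => ((H.posBdd_u n).div (H.posBdd_v n)).bddMeas)
    (fun x => by rw [abs_of_pos (hα.trans_le (h0 x).1)]; exact (h0 x).2)
    (fun n x => by rw [H.ratio_succ]; simp) hij x x'
  simpa using this

variable {s : ℕ → 𝓧 → 𝓧 → ℝ} {S : ℝ} {u' v' : ℕ → 𝓧 → ℝ}

/-- Dividing the differentiated recursion by the original one averages the old logarithmic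
derivative plus that of the kernel, `s`, with the weights of the undifferentiated recursion. -/
lemma TransferDeriv.logDeriv_succ {h : 𝓧 → ℝ} {w w' : 𝓧 → ℝ} {s : 𝓧 → ℝ} {q : 𝓧 → ℝ}
    (hw : PosBdd w) :
    (∫ x', q x' * h x' * (w' x' + s x' * w x') ∂μ) / (∫ x', q x' * h x' * w x' ∂μ) =
      wavg μ (fun x' => q x' * (h x' * w x')) (fun x' => w' x' / w x' + s x') := by
  have : (fun x' => w' x' / w x' + s x') = fun x' => (w' x' + s x' * w x') / w x' := by
    ext x'
    have := (hw.pos x').ne'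
    field_simp
  rw [this]
  simp only [← mul_assoc]
  rw [wavg_mul_weight (fun x => (hw.pos x).ne')]

/-- The logarithmic derivative has bounded oscillation along the iteration. -/
lemma TransferDeriv.exists_interval (H : TransferPair μ q h u v)
    (H' : TransferDeriv μ q h u v s S u' v') (hc : 0 < c)
    (hq : ∀ x, Measurable (q x)) (hcq : ∀ x x', c ≤ q x x' ∧ q x x' ≤ C) {K : ℝ}
    (hK : 2 * S ≤ c / C * K)
    (h0 : ∃ a, ∀ x, a ≤ v' 0 x / v 0 x ∧ v' 0 x / v 0 x ≤ a + K) (n : ℕ) :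
    ∃ a, ∀ x, a ≤ v' n x / v n x ∧ v' n x / v n x ≤ a + K := by
  induction n with
  | zero => exact h0
  | succ n ih =>
    obtain ⟨a, ha⟩ := ih
    have hb := (H'.bddMeas_v' n).div (H.posBdd_v n)
    have hk := (H.posBdd_h n).mul (H.posBdd_v n)
    obtain ⟨a', h1, h2, h3⟩ := exists_interval_wavg (μ := μ) hc hq hcq hk hb ha
    -- The contraction shortens the interval by `c / C * K` and the term `s` lengthens it by `2 *
    -- S`; `hK` balances the two.
    refine ⟨a' - S, fun x => ?_⟩
    have hw : PosBdd (fun x' => q x x' * (h n x' * v n x')) :=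
      PosBdd.mul ⟨hq x, c, C, hc, hcq x⟩ hk
    have hs : BddMeas (s n x) := ⟨H'.measurable_s n x, S, H'.abs_s_le n x⟩
    rw [H'.v'_succ, H.v_succ, TransferDeriv.logDeriv_succ (H.posBdd_v n), wavg_add hw hb hs]
    have h4 := h3 x
    have h5 := abs_le.1 (abs_wavg_le (μ := μ) hw hs (H'.abs_s_le n x))
    constructor <;> linarith

/-- Changing the weight `w` of an average to `w * r` with `r` nearly constant. -/
lemma abs_wavg_sub_wavg_le {w ρ f : 𝓧 → ℝ} (hw : PosBdd w) (hρ : PosBdd ρ) (hf : BddMeas f)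
    {α κ K a : ℝ} (hα : 0 < α) (hρα : ∀ x, α ≤ ρ x) (hκ : ∀ x x', |ρ x - ρ x'| ≤ κ)
    (hK : ∀ x, |f x - a| ≤ K) :
    |wavg μ (fun x => w x * ρ x) f - wavg μ w f| ≤ κ * K / α := by
  have hwρ := hw.mul hρ
  have hfa : BddMeas fun x => f x - a := hf.sub (.const a)
  set R := wavg μ w ρ with hR
  have hRα : α ≤ R := by
    rw [← wavg_const (μ := μ) hw α]
    exact wavg_mono hw (.const _) hρ.bddMeas hρα
  have hR0 : 0 < R := hα.trans_le hRα
  have e1 : wavg μ (fun x => w x * ρ x) f = a + wavg μ (fun x => w x * ρ x) (fun x => f x - a) := by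
    rw [wavg_sub hwρ hf (.const _), wavg_const hwρ]; ring
  have e2 : wavg μ w f = a + wavg μ w (fun x => f x - a) := by
    rw [wavg_sub hw hf (.const _), wavg_const hw]; ring
  have e3 : wavg μ (fun x => w x * ρ x) (fun x => f x - a) =
      wavg μ w (fun x => ρ x * (f x - a)) / R := by
    rw [hR]
    unfold wavg
    have := (hw.integral_pos μ).ne'
    have := (hwρ.integral_pos μ).ne'
    simp only [mul_assoc]
    field_simp
  -- The change of the average is the covariance of `ρ` and `f` under the weight `w`, divided by the
  -- mean `R` of `ρ`. So only the oscillation and a lower bound of `ρ` enter.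
  have e4 : wavg μ (fun x => w x * ρ x) f - wavg μ w f =
      wavg μ w (fun x => (ρ x - R) * (f x - a)) / R := by
    have : (fun x => (ρ x - R) * (f x - a)) =
        fun x => ρ x * (f x - a) - R * (f x - a) := by ext; ring
    rw [e1, e2, e3, this, wavg_sub hw (hρ.bddMeas.mul hfa) ((BddMeas.const R).mul hfa)]
    have : wavg μ w (fun x => R * (f x - a)) = R * wavg μ w (fun x => f x - a) := by
      unfold wavg
      rw [← mul_div_assoc, ← integral_const_mul]
      congr 2; ext x; ring
    rw [this]
    field_simp
    ring
  have hκR : ∀ x, |ρ x - R| ≤ κ := by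
    intro x
    have : ρ x - R = wavg μ w (fun x' => ρ x - ρ x') := by
      rw [wavg_sub hw (.const _) hρ.bddMeas, wavg_const hw]
    rw [this]
    exact abs_wavg_le hw ((BddMeas.const _).sub hρ.bddMeas) (hκ x)
  obtain ⟨x₀⟩ : Nonempty 𝓧 := by
    by_contra h
    rw [not_nonempty_iff] at h
    exact NeZero.ne μ (Measure.eq_zero_of_isEmpty μ)
  have hκ0 : 0 ≤ κ := (abs_nonneg _).trans (hκ x₀ x₀)
  have hK0 : 0 ≤ K := (abs_nonneg _).trans (hK x₀)
  rw [e4, abs_div, abs_of_pos hR0]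
  have h5 : |wavg μ w (fun x => (ρ x - R) * (f x - a))| ≤ κ * K :=
    abs_wavg_le hw ((hρ.bddMeas.sub (.const R)).mul hfa) fun x => by
      rw [abs_mul]; exact mul_le_mul (hκR x) (hK x) (abs_nonneg _) hκ0
  exact div_le_div₀ (by positivity) h5 hα hRα

/-- The difference of the logarithmic derivatives forgets the starting point. -/
lemma TransferDeriv.abs_sub_le (H : TransferPair μ q h u v)
    (H' : TransferDeriv μ q h u v s S u' v') (hc : 0 < c)
    (hq : ∀ x, Measurable (q x)) (hcq : ∀ x x', c ≤ q x x' ∧ q x x' ≤ C) {α β r K e b : ℝ}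
    (hα : 0 < α) (hr1 : r < 1) (hρr : 1 - c / C < r) (hr0 : 0 < r)
    (h0 : ∀ x, α ≤ u 0 x / v 0 x ∧ u 0 x / v 0 x ≤ β)
    (hK : 2 * S ≤ c / C * K)
    (hv0 : ∃ a, ∀ x, a ≤ v' 0 x / v 0 x ∧ v' 0 x / v 0 x ≤ a + K)
    (hD0 : ∀ x, |u' 0 x / u 0 x - v' 0 x / v 0 x| ≤ K)
    (he : 2 * β * (1 + (1 - r)⁻¹) * (K + S) / α = e)
    (hb : 2 * K + 2 * e / (r - (1 - c / C)) = b)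
    {i j : ℕ} (hij : i ≤ j) (x x' : 𝓧) :
    |(u' j x / u j x - v' j x / v j x) - (u' i x' / u i x' - v' i x' / v i x')| ≤
      (b + e) * (1 + (1 - r)⁻¹) * r ^ i := by
  have hβ : 0 < β := hα.trans_le ((h0 x).1.trans (h0 x).2)
  have hK0 : 0 ≤ K := (abs_nonneg _).trans (hD0 x)
  have hS0 : 0 ≤ S := (abs_nonneg _).trans (H'.abs_s_le 0 x x)
  have h1r : 0 < 1 - r := by linarith
  have he0 : 0 ≤ e := by rw [← he]; positivity
  have hrρ : 0 < r - (1 - c / C) := by linarith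
  have hbu : ∀ n, BddMeas fun x => u' n x / u n x :=
    fun n => (H'.bddMeas_u' n).div (H.posBdd_u n)
  have hbv : ∀ n, BddMeas fun x => v' n x / v n x :=
    fun n => (H'.bddMeas_v' n).div (H.posBdd_v n)
  refine abs_sub_le_of_iterated_wavg (μ := μ) (e := e) (K₀ := K) (b := b) (C := C)
    (f := fun n x => u' n x / u n x - v' n x / v n x) (k := fun n x => h n x * u n x)
    hc hr1 hr0 he0 ?_ ?_ hq hcq (fun n => (H.posBdd_h n).mul (H.posBdd_u n))
    (fun n => (hbu n).sub (hbv n)) hD0 ?_ hij x x'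
  · rw [← hb]
    have : 0 ≤ 2 * e / (r - (1 - c / C)) := by positivity
    linarith
  · rw [← hb, add_mul, div_mul_cancel₀ _ hrρ.ne']
    have : 0 ≤ 2 * K * (r - (1 - c / C)) := by positivity
    linarith
  · intro n x
    have hqx : PosBdd (q x) := ⟨hq x, c, C, hc, hcq x⟩
    have hwu : PosBdd (fun x' => q x x' * (h n x' * u n x')) :=
      hqx.mul ((H.posBdd_h n).mul (H.posBdd_u n))
    have hwv : PosBdd (fun x' => q x x' * (h n x' * v n x')) :=
      hqx.mul ((H.posBdd_h n).mul (H.posBdd_v n))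
    have hs : BddMeas (s n x) := ⟨H'.measurable_s n x, S, H'.abs_s_le n x⟩
    obtain ⟨a, ha⟩ := TransferDeriv.exists_interval H H' hc hq hcq hK hv0 n
    have hρ := (H.posBdd_u n).div (H.posBdd_v n)
    -- The two logarithmic derivatives are averaged with different weights, containing `u` and `v`.
    -- Since `u / v` is within `O(r ^ n)` of a constant, the recursion for `v` can be rewritten with
    -- the weights of `u` at a cost `e * r ^ n`, and then the term `s` cancels.
    have key := abs_wavg_sub_wavg_le (μ := μ) hwv hρ ((hbv n).add hs) (a := a) (K := K + S)
      hα (fun x => (H.ratio_mem hc hq hcq h0 n x).1)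
      (fun y y' => H.abs_ratio_sub_le hc hq hcq hα hr1 hρr hr0 h0 le_rfl y y')
      (fun y => by
        have h1 := ha y
        have h2 := abs_le.1 (H'.abs_s_le n x y)
        rw [abs_le]; constructor <;> linarith)
    have hweq : (fun x' => q x x' * (h n x' * v n x') * (u n x' / v n x')) =
        fun x' => q x x' * (h n x' * u n x') := by
      ext x'
      have := ((H.posBdd_v n).pos x').ne'
      field_simp
    rw [hweq] at key
    rw [H'.u'_succ, H'.v'_succ, H.u_succ, H.v_succ,
      TransferDeriv.logDeriv_succ (H.posBdd_u n), TransferDeriv.logDeriv_succ (H.posBdd_v n),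
      wavg_sub hwu (hbu n) (hbv n)]
    rw [wavg_add hwu (hbu n) hs]
    rw [wavg_add hwu (hbv n) hs] at key
    refine le_trans (le_of_eq ?_) (key.trans (le_of_eq ?_))
    · congr 1; ring
    · rw [← he]; ring

end Pair

end Averages

/-! ### Finite-window likelihoods: elementary properties -/

section Likelihood

variable {𝓧 : Type*} [MeasurableSpace 𝓧] {μ : Measure 𝓧} [IsFiniteMeasure μ]

lemma lik_succ_of_eq {q : 𝓧 → 𝓧 → ℝ} {h : ℤ → 𝓧 → ℝ} {n : ℕ} {a b : ℤ} (hb : b = a + 1) (x : 𝓧) :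
    lik q μ h (n + 1) a x = ∫ x', q x x' * h b x' * lik q μ h n b x' ∂μ := by
  subst hb; rfl

lemma lik_congr {q : 𝓧 → 𝓧 → ℝ} {h h' : ℤ → 𝓧 → ℝ} {n : ℕ} {a : ℤ}
    (hh : ∀ k, a < k → k ≤ a + n → h k = h' k) (x : 𝓧) :
    lik q μ h n a x = lik q μ h' n a x := by
  induction n generalizing a x with
  | zero => rfl
  | succ n ih =>
    have h1 : h (a + 1) = h' (a + 1) := hh _ (by lia) (by push_cast; lia)
    have h2 : ∀ x', lik q μ h n (a + 1) x' = lik q μ h' n (a + 1) x' :=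
      fun x' => ih (fun k hk hk' => hh k (by lia) (by push_cast; lia)) x'
    simp only [lik, h1, h2]

lemma lik_shift {q : 𝓧 → 𝓧 → ℝ} {h : ℤ → 𝓧 → ℝ} (n : ℕ) (a j : ℤ) (x : 𝓧) :
    lik q μ (fun k => h (k + j)) n a x = lik q μ h n (a + j) x := by
  induction n generalizing a x with
  | zero => rfl
  | succ n ih =>
    simp only [lik, ih]
    have : a + 1 + j = a + j + 1 := by ring
    simp only [this]

/-- Joint measurability of the likelihood in the observations and the initial state. -/
lemma measurable_lik {β : Type*} [MeasurableSpace β] {q : 𝓧 → 𝓧 → ℝ}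
    (hq : Measurable (Function.uncurry q)) {h : β → ℤ → 𝓧 → ℝ}
    (hh : ∀ k, Measurable fun p : β × 𝓧 => h p.1 k p.2) (n : ℕ) (a : ℤ) :
    Measurable fun p : β × 𝓧 => lik q μ (h p.1) n a p.2 := by
  induction n generalizing a with
  | zero => exact measurable_const
  | succ n ih =>
    simp only [lik]
    have : Measurable fun p : (β × 𝓧) × 𝓧 =>
        q p.1.2 p.2 * h p.1.1 (a + 1) p.2 * lik q μ (h p.1.1) n (a + 1) p.2 :=
      ((hq.comp (measurable_fst.snd.prodMk measurable_snd)).mul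
        ((hh (a + 1)).comp (measurable_fst.fst.prodMk measurable_snd))).mul
        ((ih (a + 1)).comp (measurable_fst.fst.prodMk measurable_snd))
    exact (this.stronglyMeasurable.integral_prod_right).measurable

/-- Standing regularity assumptions on a transition density and a sequence of likelihood
functions. -/
structure RegularHMM (μ : Measure 𝓧) (q : 𝓧 → 𝓧 → ℝ) (h : ℤ → 𝓧 → ℝ) (c C : ℝ) : Prop where
  c_pos : 0 < c
  c_le_one : c ≤ 1
  one_le_C : 1 ≤ C
  measurable_q : Measurable (Function.uncurry q)
  q_mem : ∀ x x', c ≤ q x x' ∧ q x x' ≤ C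
  integral_q : ∀ x, ∫ x', q x x' ∂μ = 1
  measurable_h : ∀ k, Measurable (h k)
  h_mem : ∀ k x, c ≤ h k x ∧ h k x ≤ C

namespace RegularHMM

variable {q : 𝓧 → 𝓧 → ℝ} {h : ℤ → 𝓧 → ℝ} {c C : ℝ}

lemma measurable_q_right (H : RegularHMM μ q h c C) (x : 𝓧) : Measurable (q x) :=
  H.measurable_q.comp measurable_prodMk_left

lemma posBdd_q (H : RegularHMM μ q h c C) (x : 𝓧) : PosBdd (q x) :=
  ⟨H.measurable_q_right x, c, C, H.c_pos, H.q_mem x⟩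

lemma posBdd_h (H : RegularHMM μ q h c C) (k : ℤ) : PosBdd (h k) :=
  ⟨H.measurable_h k, c, C, H.c_pos, H.h_mem k⟩

lemma C_pos (H : RegularHMM μ q h c C) : 0 < C := zero_lt_one.trans_le H.one_le_C

/-- An erased observation has likelihood `1`; the normalisation `c ≤ 1 ≤ C` keeps the constants
unchanged. -/
lemma update_one (H : RegularHMM μ q h c C) (t : ℤ) :
    RegularHMM μ q (Function.update h t fun _ => 1) c C where
  __ := H
  measurable_h k := by
    rcases eq_or_ne k t with rfl | hk
    · rw [Function.update_self]; exact measurable_const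
    · rw [Function.update_of_ne hk]; exact H.measurable_h k
  h_mem k x := by
    rcases eq_or_ne k t with rfl | hk
    · rw [Function.update_self]; exact ⟨H.c_le_one, H.one_le_C⟩
    · rw [Function.update_of_ne hk]; exact H.h_mem k x

lemma integral_mem (H : RegularHMM μ q h c C) {f : 𝓧 → ℝ} (hf : BddMeas f) {A B : ℝ}
    (hfAB : ∀ x, A ≤ f x ∧ f x ≤ B) (x : 𝓧) :
    A ≤ ∫ x', q x x' * f x' ∂μ ∧ ∫ x', q x x' * f x' ∂μ ≤ B := by
  have hi := ((H.posBdd_q x).bddMeas.mul hf).integrable μ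
  have hq := (H.posBdd_q x).integrable μ
  constructor
  · calc A = ∫ x', q x x' * A ∂μ := by rw [integral_mul_const, H.integral_q, one_mul]
      _ ≤ _ := integral_mono (hq.mul_const A) hi fun x' =>
          mul_le_mul_of_nonneg_left (hfAB x').1 ((H.posBdd_q x).pos x').le
  · calc _ ≤ ∫ x', q x x' * B ∂μ := integral_mono hi (hq.mul_const B) fun x' =>
          mul_le_mul_of_nonneg_left (hfAB x').2 ((H.posBdd_q x).pos x').le
      _ = B := by rw [integral_mul_const, H.integral_q, one_mul]

lemma measurable_lik_right (H : RegularHMM μ q h c C) (n : ℕ) (a : ℤ) :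
    Measurable (lik q μ h n a) :=
  (measurable_lik (β := Unit) (μ := μ) H.measurable_q (h := fun _ => h)
    (fun k => (H.measurable_h k).comp measurable_snd) n a).comp
    (measurable_prodMk_left (x := ()))

lemma lik_mem (H : RegularHMM μ q h c C) (n : ℕ) (a : ℤ) (x : 𝓧) :
    c ^ n ≤ lik q μ h n a x ∧ lik q μ h n a x ≤ C ^ n := by
  induction n generalizing a x with
  | zero => simp [lik]
  | succ n ih =>
    have hc := H.c_pos
    have hC := H.C_pos
    have hl : PosBdd (lik q μ h n (a + 1)) :=
      ⟨H.measurable_lik_right n (a + 1), c ^ n, C ^ n, by positivity, ih (a + 1)⟩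
    simp only [lik, mul_assoc]
    refine H.integral_mem ((H.posBdd_h _).mul hl).bddMeas (fun x' => ⟨?_, ?_⟩) x
    · rw [pow_succ']
      exact mul_le_mul (H.h_mem _ _).1 (ih _ _).1 (by positivity) (hc.le.trans (H.h_mem _ _).1)
    · rw [pow_succ']
      exact mul_le_mul (H.h_mem _ _).2 (ih _ _).2 (hl.pos _).le hC.le

lemma posBdd_lik (H : RegularHMM μ q h c C) (n : ℕ) (a : ℤ) : PosBdd (lik q μ h n a) :=
  ⟨H.measurable_lik_right n a, c ^ n, C ^ n, pow_pos H.c_pos n, H.lik_mem n a⟩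

lemma lik_pos (H : RegularHMM μ q h c C) (n : ℕ) (a : ℤ) (x : 𝓧) : 0 < lik q μ h n a x :=
  (H.posBdd_lik n a).pos x

/-- Missing observations at the end of the window do not contribute. -/
lemma lik_add_of_one (H : RegularHMM μ q h c C) {n l : ℕ} {a : ℤ}
    (hh : ∀ k, a + n < k → k ≤ a + n + l → h k = fun _ => 1) (x : 𝓧) :
    lik q μ h (n + l) a x = lik q μ h n a x := by
  induction n generalizing a x with
  | zero =>
    rw [zero_add]
    simp only [Nat.cast_zero, add_zero] at hh
    induction l generalizing a x with
    | zero => rfl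
    | succ l ih =>
      have h2 : ∀ x', lik q μ h l (a + 1) x' = 1 :=
        fun x' => ih x' fun k hk hk' => hh k (by lia) (by push_cast; lia)
      simp only [lik, hh (a + 1) (by lia) (by push_cast; lia), h2, mul_one, H.integral_q]
  | succ n ih =>
    have h2 : ∀ x', lik q μ h (n + l) (a + 1) x' = lik q μ h n (a + 1) x' :=
      fun x' => ih (fun k hk hk' => hh k (by push_cast; lia) (by push_cast; lia)) x'
    rw [Nat.succ_add]
    simp only [lik, h2]

/-- Two likelihoods over windows with the same left part form a transfer pair. -/
lemma transferPair {h' : ℤ → 𝓧 → ℝ} (H : RegularHMM μ q h c C) (H' : RegularHMM μ q h' c C)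
    (b : ℤ) (N N' : ℕ) (hh : ∀ k ≤ b, h k = h' k) :
    TransferPair μ q (fun j => h (b - j)) (fun j => lik q μ h (N + j) (b - j))
      (fun j => lik q μ h' (N' + j) (b - j)) where
  -- Time runs backwards: the `j`-th window starts at `b - j`, and a step crosses a time at most
  -- `b`, where `h` and `h'` agree.
  posBdd_h _ := H.posBdd_h _
  posBdd_u _ := H.posBdd_lik _ _
  posBdd_v _ := H'.posBdd_lik _ _
  u_succ n x := lik_succ_of_eq (by push_cast; ring) x
  v_succ n x := by
    simp only [hh (b - n) (by lia)]
    exact lik_succ_of_eq (by push_cast; ring) x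

end RegularHMM

end Likelihood

/-! ### Forgetting of the initial state and of the remote future -/

section Windows

variable {𝓧 : Type*} [MeasurableSpace 𝓧] {μ : Measure 𝓧} [IsFiniteMeasure μ]

lemma abs_log_sub_log_le {α a b : ℝ} (hα : 0 < α) (ha : α ≤ a) (hb : α ≤ b) :
    |Real.log a - Real.log b| ≤ |a - b| / α := by
  have key : ∀ a b : ℝ, α ≤ a → α ≤ b → Real.log a - Real.log b ≤ |a - b| / α := by
    intro a b ha hb
    have ha0 := hα.trans_le ha
    have hb0 := hα.trans_le hb
    rw [← Real.log_div ha0.ne' hb0.ne']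
    calc Real.log (a / b) ≤ a / b - 1 := Real.log_le_sub_one_of_pos (by positivity)
      _ = (a - b) / b := by field_simp
      _ ≤ |a - b| / b := div_le_div_of_nonneg_right (le_abs_self _) hb0.le
      _ ≤ |a - b| / α := div_le_div_of_nonneg_left (abs_nonneg _) hα hb
  rw [abs_le]
  constructor
  · have := key b a hb ha
    rw [abs_sub_comm] at this
    linarith
  · exact key a b ha hb

/-- A family of windows that forgets its starting point and its end point has a limit. -/
lemma exists_limit_of_windows [Nonempty 𝓧] {V : Type*} [NormedAddCommGroup V] [CompleteSpace V]
    {B r : ℝ} (hB : 0 ≤ B) (hr0 : 0 < r) (hr1 : r < 1) {G : ℕ → ℕ → 𝓧 → V}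
    (hleft : ∀ i j k x x', 1 ≤ i → i ≤ j → ‖G j k x - G i k x'‖ ≤ B * r ^ i)
    (hright : ∀ n k x, ‖G n (k + 1) x - G n k x‖ ≤ B * r ^ k) :
    ∃ l : V, ∀ n k x, 1 ≤ n → ‖G n k x - l‖ ≤ B * (1 - r)⁻¹ * (r ^ n + r ^ k) := by
  have h1r : 0 < 1 - r := by linarith
  have hinv : 1 ≤ (1 - r)⁻¹ := (one_le_inv₀ h1r).2 (by linarith)
  have hR : ∀ n k l x, ‖G n (k + l) x - G n k x‖ ≤ B * ((r ^ k - r ^ (k + l)) * (1 - r)⁻¹) := by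
    intro n k l x
    induction l with
    | zero => simp
    | succ l ih =>
      calc ‖G n (k + (l + 1)) x - G n k x‖
          ≤ ‖G n (k + l + 1) x - G n (k + l) x‖ + ‖G n (k + l) x - G n k x‖ := by
            rw [← add_assoc]; exact norm_sub_le_norm_sub_add_norm_sub _ _ _
        _ ≤ B * r ^ (k + l) + B * ((r ^ k - r ^ (k + l)) * (1 - r)⁻¹) :=
            add_le_add (hright _ _ _) ih
        _ = _ := by
            have : r ^ (k + (l + 1)) = r ^ (k + l) * r := by rw [← add_assoc, pow_succ]
            rw [this]; field_simp; ring
  -- The window is lengthened first on the left, then on the right; the initial states need not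
  -- match because `hleft` compares arbitrary ones.
  have hall : ∀ n k n' k' x x', 1 ≤ n → n ≤ n' → k ≤ k' →
      ‖G n k x - G n' k' x'‖ ≤ B * (1 - r)⁻¹ * (r ^ n + r ^ k) := by
    intro n k n' k' x x' hn hnn hkk
    obtain ⟨l, rfl⟩ := Nat.exists_eq_add_of_le hkk
    have h1 := hleft n n' k x' x hn hnn
    have h2 := hR n' k l x'
    have h3 : ‖G n k x - G n' (k + l) x'‖ ≤ ‖G n' k x' - G n k x‖ +
        ‖G n' (k + l) x' - G n' k x'‖ := by
      rw [norm_sub_rev (G n' k x'), norm_sub_rev (G n' (k + l) x')]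
      exact norm_sub_le_norm_sub_add_norm_sub _ _ _
    have h4 : B * r ^ n ≤ B * (1 - r)⁻¹ * r ^ n :=
      mul_le_mul_of_nonneg_right (le_mul_of_one_le_right hB hinv) (by positivity)
    have h5 : B * ((r ^ k - r ^ (k + l)) * (1 - r)⁻¹) ≤ B * (1 - r)⁻¹ * r ^ k := by
      have : (r ^ k - r ^ (k + l)) * (1 - r)⁻¹ ≤ r ^ k * (1 - r)⁻¹ :=
        mul_le_mul_of_nonneg_right (by have : 0 ≤ r ^ (k + l) := by positivity
                                       linarith) (by positivity)
      calc _ ≤ B * (r ^ k * (1 - r)⁻¹) := mul_le_mul_of_nonneg_left this hB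
        _ = _ := by ring
    linarith
  obtain ⟨x₀⟩ := ‹Nonempty 𝓧›
  have hpow : Tendsto (fun m : ℕ => B * (1 - r)⁻¹ * (r ^ (m + 1) + r ^ (m + 1))) atTop (𝓝 0) := by
    have h := (tendsto_pow_atTop_nhds_zero_of_lt_one hr0.le hr1).comp (tendsto_add_atTop_nat 1)
    have := (h.add h).const_mul (B * (1 - r)⁻¹)
    simpa using this
  have hcau : CauchySeq fun m : ℕ => G (m + 1) (m + 1) x₀ := by
    refine cauchySeq_of_le_tendsto_0' _ (fun m m' hm => ?_) hpow
    rw [dist_eq_norm]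
    exact hall _ _ _ _ _ _ (by lia) (by lia) (by lia)
  obtain ⟨l, hl⟩ := cauchySeq_tendsto_of_complete hcau
  refine ⟨l, fun n k x hn => ?_⟩
  refine le_of_tendsto ((tendsto_const_nhds.sub hl).norm) ?_
  filter_upwards [eventually_ge_atTop (max n k)] with m hm
  exact hall _ _ _ _ _ _ hn (by have := le_max_left n k; lia) (by have := le_max_right n k; lia)

/-- The rate of forgetting. -/
def rate (c C : ℝ) : ℝ := 1 - c / (2 * C)

lemma rate_lt_one {c C : ℝ} (hc : 0 < c) (hC : 0 < C) : rate c C < 1 := by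
  unfold rate
  have : 0 < c / (2 * C) := by positivity
  linarith

/-- The rate exceeds the Doeblin factor strictly: the recursion for scores carries errors of order
`rate c C ^ n`, and absorbing them costs the inverse of this gap. -/
lemma lt_rate {c C : ℝ} (hc : 0 < c) (hC : 0 < C) : 1 - c / C < rate c C := by
  unfold rate
  have : c / (2 * C) = c / C / 2 := by field_simp
  have : 0 < c / C := by positivity
  linarith

lemma rate_pos {c C : ℝ} (hc : 0 < c) (hcC : c ≤ C) : 0 < rate c C := by
  unfold rate
  have hC : 0 < C := hc.trans_le hcC
  have : c / (2 * C) ≤ 1 / 2 := by rw [div_le_div_iff₀ (by positivity) (by norm_num)]; linarith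
  linarith

namespace RegularHMM

variable {q : 𝓧 → 𝓧 → ℝ} {h : ℤ → 𝓧 → ℝ} {c C : ℝ}

lemma log_condLik (H : RegularHMM μ q h c C) (t : ℤ) (n : ℕ) (a : ℤ) (x : 𝓧) :
    Real.log (condLik q μ h t n a x) = Real.log (lik q μ h n a x) -
      Real.log (lik q μ (Function.update h t fun _ => 1) n a x) := by
  unfold condLik
  rw [Real.log_div (H.lik_pos _ _ _).ne' ((H.update_one t).lik_pos _ _ _).ne']

lemma condLik_pos (H : RegularHMM μ q h c C) (t : ℤ) (n : ℕ) (a : ℤ) (x : 𝓧) :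
    0 < condLik q μ h t n a x :=
  div_pos (H.lik_pos _ _ _) ((H.update_one t).lik_pos _ _ _)

/-- The likelihood of a window of length one. -/
lemma lik_one_mem (H : RegularHMM μ q h c C) (a : ℤ) (x : 𝓧) :
    c ≤ lik q μ h 1 a x ∧ lik q μ h 1 a x ≤ C := by
  simpa using H.lik_mem 1 a x

/-- For a window starting just before `t` the ratio is an average of `h t`, which makes the bounds
independent of its length. This is the starting value of the iteration towards the past. -/
lemma lik_ratio_update_mem [NeZero μ] (H : RegularHMM μ q h c C) {t b : ℤ} (hb : t = b + 1) (k : ℕ)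
    (x : 𝓧) :
    c ≤ lik q μ h (k + 1) b x / lik q μ (Function.update h t fun _ => 1) (k + 1) b x ∧
    lik q μ h (k + 1) b x / lik q μ (Function.update h t fun _ => 1) (k + 1) b x ≤ C := by
  have h1 : lik q μ h (k + 1) b x = ∫ x', (q x x' * lik q μ h k t x') * h t x' ∂μ := by
    rw [lik_succ_of_eq hb]; congr 1; ext; ring
  have h2 : lik q μ (Function.update h t fun _ => 1) (k + 1) b x =
      ∫ x', q x x' * lik q μ h k t x' ∂μ := by
    rw [lik_succ_of_eq hb]
    congr 1; ext x'
    rw [Function.update_self, mul_one]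
    congr 1
    exact lik_congr (fun j hj _ => Function.update_of_ne (by lia) _ _) x'
  have hw := (H.posBdd_q x).mul (H.posBdd_lik k t)
  have hh := (H.posBdd_h t).bddMeas
  rw [h1, h2]
  change c ≤ wavg μ _ _ ∧ wavg μ _ _ ≤ C
  constructor
  · rw [← wavg_const (μ := μ) hw c]
    exact wavg_mono hw (.const _) hh fun x => (H.h_mem t x).1
  · rw [← wavg_const (μ := μ) hw C]
    exact wavg_mono hw hh (.const _) fun x => (H.h_mem t x).2

/-- Forgetting of the initial state. -/
lemma abs_log_condLik_sub_le [NeZero μ] (H : RegularHMM μ q h c C) (t : ℤ) {i j : ℕ} (k : ℕ)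
    (x x' : 𝓧) (hi : 1 ≤ i) (hij : i ≤ j) :
    |Real.log (condLik q μ h t (j + k) (t - j) x) -
      Real.log (condLik q μ h t (i + k) (t - i) x')| ≤
      2 * C * (1 + (1 - rate c C)⁻¹) / c / rate c C * rate c C ^ i := by
  -- A window starting at `t` itself does not contain time `t`. The iteration therefore starts at `t
  -- - 1` with its index one less than the distance to `t`, whence the division by `rate c C` in the
  -- constant.
  obtain ⟨i, rfl⟩ := Nat.exists_eq_add_of_le' hi
  obtain ⟨j, rfl⟩ := Nat.exists_eq_add_of_le' (hi.trans hij)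
  have hcC := H.c_le_one.trans H.one_le_C
  have hr0 := rate_pos H.c_pos hcC
  have hp := H.transferPair (H.update_one t) (t - 1) (k + 1) (k + 1)
    (fun l hl => (Function.update_of_ne (by lia) _ _).symm)
  have h0 : ∀ x, c ≤ lik q μ h (k + 1 + 0) (t - 1 - (0 : ℕ)) x /
      lik q μ (Function.update h t fun _ => 1) (k + 1 + 0) (t - 1 - (0 : ℕ)) x ∧
      lik q μ h (k + 1 + 0) (t - 1 - (0 : ℕ)) x /
      lik q μ (Function.update h t fun _ => 1) (k + 1 + 0) (t - 1 - (0 : ℕ)) x ≤ C :=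
    fun x => H.lik_ratio_update_mem (by simp) k x
  have e : ∀ (n : ℕ) (x : 𝓧), condLik q μ h t (n + 1 + k) (t - ((n + 1 : ℕ) : ℤ)) x =
      lik q μ h (k + 1 + n) (t - 1 - n) x /
      lik q μ (Function.update h t fun _ => 1) (k + 1 + n) (t - 1 - n) x := by
    intro n x
    unfold condLik
    have e1 : n + 1 + k = k + 1 + n := by ring
    have e2 : t - ((n + 1 : ℕ) : ℤ) = t - 1 - n := by push_cast; ring
    rw [e1, e2]
  rw [e, e]
  have hm := hp.ratio_mem H.c_pos H.measurable_q_right H.q_mem h0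
  refine (abs_log_sub_log_le H.c_pos (hm j x).1 (hm i x').1).trans ?_
  have := hp.abs_ratio_sub_le H.c_pos H.measurable_q_right H.q_mem H.c_pos
    (rate_lt_one H.c_pos H.C_pos) (lt_rate H.c_pos H.C_pos) hr0 h0
    (show i ≤ j by lia) x x'
  refine (div_le_div_of_nonneg_right this H.c_pos.le).trans (le_of_eq ?_)
  rw [pow_succ]
  field_simp

/-- Forgetting of the remote future. -/
lemma abs_log_condLik_succ_sub_le [NeZero μ] (H : RegularHMM μ q h c C) (t : ℤ) (n k : ℕ) (x : 𝓧) :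
    |Real.log (condLik q μ h t (n + (k + 1)) (t - n) x) -
      Real.log (condLik q μ h t (n + k) (t - n) x)| ≤
      2 * (2 * C * (1 + (1 - rate c C)⁻¹) / c) * rate c C ^ k := by
  have hcC := H.c_le_one.trans H.one_le_C
  have hr0 := rate_pos H.c_pos hcC
  -- The last observation of the window multiplies the likelihood by a ratio of two solutions
  -- started at `t + k`. Once the start of the window has moved back to `t`, this ratio is within
  -- `O(rate c C ^ k)` of a constant, so moving on to `t - n` hardly changes it.
  have key : ∀ {h' : ℤ → 𝓧 → ℝ}, RegularHMM μ q h' c C →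
      |(Real.log (lik q μ h' (n + (k + 1)) (t - n) x) - Real.log (lik q μ h' (n + k) (t - n) x)) -
       (Real.log (lik q μ h' (k + 1) t x) - Real.log (lik q μ h' k t x))| ≤
       2 * C * (1 + (1 - rate c C)⁻¹) / c * rate c C ^ k := by
    intro h' H'
    have hp := H'.transferPair H' (t + k) 1 0 (fun _ _ => rfl)
    have h0 : ∀ x, c ≤ lik q μ h' (1 + 0) (t + k - (0 : ℕ)) x /
        lik q μ h' (0 + 0) (t + k - (0 : ℕ)) x ∧
        lik q μ h' (1 + 0) (t + k - (0 : ℕ)) x /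
        lik q μ h' (0 + 0) (t + k - (0 : ℕ)) x ≤ C := by
      intro x
      have : lik q μ h' (0 + 0) (t + k - (0 : ℕ)) x = 1 := rfl
      rw [this, div_one]
      exact H'.lik_one_mem _ _
    have hm := hp.ratio_mem H.c_pos H.measurable_q_right H.q_mem h0
    have hd := hp.abs_ratio_sub_le H.c_pos H.measurable_q_right H.q_mem H.c_pos
      (rate_lt_one H.c_pos H.C_pos) (lt_rate H.c_pos H.C_pos) hr0 h0
      (show k ≤ k + n by lia) x x
    have hlog := (abs_log_sub_log_le H.c_pos (hm (k + n) x).1 (hm k x).1).trans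
      (div_le_div_of_nonneg_right hd H.c_pos.le)
    have e1 : (1 + (k + n)) = n + (k + 1) := by ring
    have e2 : t + (k : ℤ) - ((k + n : ℕ) : ℤ) = t - n := by push_cast; ring
    have e3 : 0 + (k + n) = n + k := by ring
    have e4 : 1 + k = k + 1 := by ring
    have e5 : t + (k : ℤ) - (k : ℤ) = t := by ring
    rw [e1, e2, e3, e4, e5, zero_add,
      Real.log_div (H'.lik_pos _ _ _).ne' (H'.lik_pos _ _ _).ne',
      Real.log_div (H'.lik_pos _ _ _).ne' (H'.lik_pos _ _ _).ne'] at hlog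
    refine hlog.trans (le_of_eq ?_)
    ring
  have h1 := key H
  have h2 := key (H.update_one t)
  -- A window starting at `t` does not see time `t`: the reference increments with and without that
  -- observation coincide and cancel, leaving twice the error.
  have e1 : ∀ k, lik q μ (Function.update h t fun _ => 1) k t x = lik q μ h k t x :=
    fun k => lik_congr (fun j hj _ => Function.update_of_ne (by lia) _ _) x
  rw [e1, e1] at h2
  rw [H.log_condLik, H.log_condLik]
  rw [abs_le] at h1 h2 ⊢
  constructor <;> linarith

/-- The conditional densities of finite windows converge, uniformly in the initial state. -/
lemma exists_log_condLik_limit [NeZero μ] [Nonempty 𝓧] {c C : ℝ} (hc : 0 < c) (hc1 : c ≤ 1)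
    (hC1 : 1 ≤ C) :
    ∃ B : ℝ, 0 ≤ B ∧ ∀ (q : 𝓧 → 𝓧 → ℝ) (h : ℤ → 𝓧 → ℝ), RegularHMM μ q h c C → ∀ t : ℤ,
      ∃ l : ℝ, ∀ (n k : ℕ) (x : 𝓧), 1 ≤ n →
        |Real.log (condLik q μ h t (n + k) (t - n) x) - l| ≤ B * (rate c C ^ n + rate c C ^ k) := by
  have hC : 0 < C := by linarith
  have hr0 := rate_pos hc (hc1.trans hC1)
  have hr1 := rate_lt_one hc hC
  have h1r : 0 < 1 - rate c C := by linarith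
  set B₁ := 2 * C * (1 + (1 - rate c C)⁻¹) / c / rate c C
  set B₂ := 2 * (2 * C * (1 + (1 - rate c C)⁻¹) / c)
  have hB₁ : 0 ≤ B₁ := by positivity
  have hB₂ : 0 ≤ B₂ := by positivity
  refine ⟨max B₁ B₂ * (1 - rate c C)⁻¹, by positivity, fun q h H t => ?_⟩
  refine exists_limit_of_windows (V := ℝ) (B := max B₁ B₂) (r := rate c C) (by positivity) hr0 hr1
    (G := fun n k x => Real.log (condLik q μ h t (n + k) (t - n) x)) ?_ ?_
  · intro i j k x x' hi hij
    exact (H.abs_log_condLik_sub_le t k x x' hi hij).trans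
      (mul_le_mul_of_nonneg_right (le_max_left _ _) (by positivity))
  · intro n k x
    exact (H.abs_log_condLik_succ_sub_le t n k x).trans
      (mul_le_mul_of_nonneg_right (le_max_right _ _) (by positivity))

end RegularHMM

end Windows

/-! ### Differentiation with respect to the parameter -/

section Differentiation

variable {E : Type*} [NormedAddCommGroup E] [NormedSpace ℝ E]

/-- `F` is differentiable on `G`, with a logarithmic derivative bounded by `S`. -/
def LogDiffOn (S : ℝ) (G : Set E) (F : E → ℝ) : Prop :=
  ∀ θ ∈ G, DifferentiableAt ℝ F θ ∧ ‖fderiv ℝ F θ‖ ≤ S * F θ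

/-- Stated without division, bounds on logarithmic derivatives add under products and are inherited
by integrals. -/
lemma LogDiffOn.mul {S T : ℝ} {G : Set E} {F F' : E → ℝ} (hF : LogDiffOn S G F)
    (hF' : LogDiffOn T G F') (h0 : ∀ θ ∈ G, 0 ≤ F θ) (h0' : ∀ θ ∈ G, 0 ≤ F' θ) :
    LogDiffOn (S + T) G (fun θ => F θ * F' θ) := by
  intro θ hθ
  obtain ⟨d1, b1⟩ := hF θ hθ
  obtain ⟨d2, b2⟩ := hF' θ hθ
  refine ⟨d1.mul d2, ?_⟩
  rw [fderiv_fun_mul d1 d2]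
  have := h0 θ hθ
  have := h0' θ hθ
  calc ‖F θ • fderiv ℝ F' θ + F' θ • fderiv ℝ F θ‖
      ≤ ‖F θ • fderiv ℝ F' θ‖ + ‖F' θ • fderiv ℝ F θ‖ := norm_add_le _ _
    _ = F θ * ‖fderiv ℝ F' θ‖ + F' θ * ‖fderiv ℝ F θ‖ := by
        rw [norm_smul, norm_smul, Real.norm_of_nonneg (h0 θ hθ), Real.norm_of_nonneg (h0' θ hθ)]
    _ ≤ F θ * (T * F' θ) + F' θ * (S * F θ) := by gcongr
    _ = _ := by ring

lemma LogDiffOn.one {S : ℝ} (hS : 0 ≤ S) (G : Set E) : LogDiffOn S G (fun _ => 1) := by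
  intro θ _
  simpa using hS

variable [FiniteDimensional ℝ E]

/-- Measurability in `x` of directional derivatives in the parameter. -/
lemma measurable_fderiv_apply_of_eventually {α : Type*} [MeasurableSpace α] {F : E → α → ℝ} {θ : E}
    (hd : ∀ x, DifferentiableAt ℝ (fun ϑ => F ϑ x) θ) (hm : ∀ᶠ ϑ in 𝓝 θ, Measurable (F ϑ)) (e : E) :
    Measurable fun x => fderiv ℝ (fun ϑ => F ϑ x) θ e := by
  have h1 : Tendsto (fun n : ℕ => θ + ((n : ℝ))⁻¹ • e) atTop (𝓝 θ) := by
    have : Tendsto (fun n : ℕ => ((n : ℝ))⁻¹) atTop (𝓝 0) := tendsto_inv_atTop_nhds_zero_nat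
    simpa using tendsto_const_nhds.add (this.smul_const e)
  obtain ⟨N, hN⟩ := eventually_atTop.1 (h1.eventually hm)
  have hc : Tendsto (fun n : ℕ => ‖((n + N : ℕ) : ℝ)‖) atTop atTop :=
    tendsto_norm_atTop_atTop.comp
      (tendsto_natCast_atTop_atTop.comp (tendsto_add_atTop_nat N))
  have hlim : ∀ x, Tendsto (fun n : ℕ => ((n + N : ℕ) : ℝ) •
      (F (θ + (((n + N : ℕ) : ℝ))⁻¹ • e) x - F θ x)) atTop
      (𝓝 (fderiv ℝ (fun ϑ => F ϑ x) θ e)) :=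
    fun x => (hd x).hasFDerivAt.lim e hc
  refine measurable_of_tendsto_metrizable (fun n => ?_) (tendsto_pi_nhds.2 hlim)
  simp only [smul_eq_mul]
  exact ((hN (n + N) (by lia)).sub hm.self_of_nhds).const_mul _

lemma stronglyMeasurable_of_apply {α : Type*} [MeasurableSpace α] {L : α → E →L[ℝ] ℝ}
    (h : ∀ e, Measurable fun x => L x e) : StronglyMeasurable L := by
  let b := Module.finBasis ℝ E
  have : L = fun x => ∑ i, L x (b i) • (b.coord i).toContinuousLinearMap := by
    ext x e
    conv_lhs => rw [← b.sum_repr e]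
    simp only [map_sum, map_smul, smul_eq_mul, sum_apply,
      smul_apply, LinearMap.coe_toContinuousLinearMap', Module.Basis.coord_apply]
    exact Finset.sum_congr rfl fun i _ => mul_comm _ _
  rw [this]
  refine Finset.stronglyMeasurable_fun_sum _ fun i _ => ?_
  exact (h (b i)).stronglyMeasurable.smul_const _

variable {𝓧 : Type*} [MeasurableSpace 𝓧] {μ : Measure 𝓧} [IsFiniteMeasure μ]

lemma LogDiffOn.integrable_fderiv {S b : ℝ} {G : Set E} (hG : IsOpen G) {F : E → 𝓧 → ℝ}
    (hF : ∀ x, LogDiffOn S G (fun θ => F θ x)) (hm : ∀ θ ∈ G, Measurable (F θ))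
    (hb : ∀ θ ∈ G, ∀ x, |F θ x| ≤ b) {θ : E} (hθ : θ ∈ G) :
    Integrable (fun x => fderiv ℝ (fun ϑ => F ϑ x) θ) μ := by
  have hm' : ∀ᶠ ϑ in 𝓝 θ, Measurable (F ϑ) := by
    filter_upwards [hG.mem_nhds hθ] with ϑ hϑ using hm ϑ hϑ
  refine Integrable.of_bound (stronglyMeasurable_of_apply fun e =>
    measurable_fderiv_apply_of_eventually (fun x => (hF x θ hθ).1) hm' e).aestronglyMeasurable
    (|S| * b) (Eventually.of_forall fun x => ?_)
  refine (hF x θ hθ).2.trans ((le_abs_self _).trans ?_)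
  rw [abs_mul]
  exact mul_le_mul_of_nonneg_left (hb θ hθ x) (abs_nonneg _)

/-- Differentiation under the integral sign. -/
lemma LogDiffOn.hasFDerivAt_integral {S b : ℝ} {G : Set E} (hG : IsOpen G) {F : E → 𝓧 → ℝ}
    (hF : ∀ x, LogDiffOn S G (fun θ => F θ x)) (hm : ∀ θ ∈ G, Measurable (F θ))
    (hb : ∀ θ ∈ G, ∀ x, |F θ x| ≤ b) {θ : E} (hθ : θ ∈ G) :
    HasFDerivAt (fun ϑ => ∫ x, F ϑ x ∂μ) (∫ x, fderiv ℝ (fun ϑ => F ϑ x) θ ∂μ) θ := by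
  refine hasFDerivAt_integral_of_dominated_of_fderiv_le (𝕜 := ℝ)
    (F' := fun ϑ x => fderiv ℝ (fun ϑ => F ϑ x) ϑ) (bound := fun _ => |S| * b)
    (hG.mem_nhds hθ) ?_ ?_ ?_ ?_ ?_ ?_
  · filter_upwards [hG.mem_nhds hθ] with ϑ hϑ using (hm ϑ hϑ).aestronglyMeasurable
  · exact Integrable.of_bound (hm θ hθ).aestronglyMeasurable b (Eventually.of_forall (hb θ hθ))
  · exact (LogDiffOn.integrable_fderiv (μ := μ) hG hF hm hb hθ).aestronglyMeasurable
  · refine Eventually.of_forall fun x ϑ hϑ => (hF x ϑ hϑ).2.trans ((le_abs_self _).trans ?_)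
    rw [abs_mul]
    exact mul_le_mul_of_nonneg_left (hb ϑ hϑ x) (abs_nonneg _)
  · exact integrable_const _
  · exact Eventually.of_forall fun x ϑ hϑ => (hF x ϑ hϑ).1.hasFDerivAt

lemma LogDiffOn.integral {S b : ℝ} {G : Set E} (hG : IsOpen G) {F : E → 𝓧 → ℝ}
    (hF : ∀ x, LogDiffOn S G (fun θ => F θ x)) (hm : ∀ θ ∈ G, Measurable (F θ))
    (hb : ∀ θ ∈ G, ∀ x, |F θ x| ≤ b) : LogDiffOn S G (fun θ => ∫ x, F θ x ∂μ) := by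
  intro θ hθ
  have h := LogDiffOn.hasFDerivAt_integral (μ := μ) hG hF hm hb hθ
  refine ⟨h.differentiableAt, ?_⟩
  rw [h.fderiv, ← integral_const_mul]
  have hi := LogDiffOn.integrable_fderiv (μ := μ) hG hF hm hb hθ
  refine (norm_integral_le_integral_norm _).trans (integral_mono hi.norm ?_ fun x => (hF x θ hθ).2)
  exact (Integrable.of_bound (hm θ hθ).aestronglyMeasurable b
    (Eventually.of_forall (hb θ hθ))).const_mul _

lemma LogDiffOn.fderiv_integral_apply {S b : ℝ} {G : Set E} (hG : IsOpen G) {F : E → 𝓧 → ℝ}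
    (hF : ∀ x, LogDiffOn S G (fun θ => F θ x)) (hm : ∀ θ ∈ G, Measurable (F θ))
    (hb : ∀ θ ∈ G, ∀ x, |F θ x| ≤ b) {θ : E} (hθ : θ ∈ G) (e : E) :
    fderiv ℝ (fun ϑ => ∫ x, F ϑ x ∂μ) θ e = ∫ x, fderiv ℝ (fun ϑ => F ϑ x) θ e ∂μ := by
  rw [(LogDiffOn.hasFDerivAt_integral (μ := μ) hG hF hm hb hθ).fderiv,
    ContinuousLinearMap.integral_apply (LogDiffOn.integrable_fderiv (μ := μ) hG hF hm hb hθ)]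

end Differentiation

/-! ### Derivatives of likelihoods and forgetting of scores -/

section Families

variable {E : Type*} [NormedAddCommGroup E] [NormedSpace ℝ E] [FiniteDimensional ℝ E]
  {𝓧 : Type*} [MeasurableSpace 𝓧] {μ : Measure 𝓧} [IsFiniteMeasure μ]

/-- Standing regularity assumptions on a parametric family of transition densities and likelihood
functions. -/
structure RegularFamily (μ : Measure 𝓧) (q : E → 𝓧 → 𝓧 → ℝ) (h : E → ℤ → 𝓧 → ℝ) (c C S : ℝ)
    (G : Set E) : Prop where
  isOpen : IsOpen G
  S_nonneg : 0 ≤ S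
  regular : ∀ θ ∈ G, RegularHMM μ (q θ) (h θ) c C
  q_diff : ∀ x x', LogDiffOn S G (fun θ => q θ x x')
  h_diff : ∀ k x, LogDiffOn S G (fun θ => h θ k x)

namespace RegularFamily

variable {q : E → 𝓧 → 𝓧 → ℝ} {h : E → ℤ → 𝓧 → ℝ} {c C S : ℝ} {G : Set E}

lemma update_one (H : RegularFamily μ q h c C S G) (t : ℤ) :
    RegularFamily μ q (fun θ => Function.update (h θ) t fun _ => 1) c C S G where
  __ := H
  regular θ hθ := (H.regular θ hθ).update_one t
  h_diff k x := by
    rcases eq_or_ne k t with rfl | hk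
    · simpa only [Function.update_self] using LogDiffOn.one H.S_nonneg G
    · simpa only [Function.update_of_ne hk] using H.h_diff k x

/-- Each transition contributes `S` from `q` and `S` from `h`. The bound grows with the window;
uniform bounds on conditional scores come from forgetting instead. -/
lemma lik_logDiffOn (H : RegularFamily μ q h c C S G) (n : ℕ) (a : ℤ) (x : 𝓧) :
    LogDiffOn (n * (2 * S)) G (fun θ => lik (q θ) μ (h θ) n a x) := by
  induction n generalizing a x with
  | zero => simpa [lik] using LogDiffOn.one le_rfl G
  | succ n ih =>
    simp only [lik]
    have e : ((n + 1 : ℕ) : ℝ) * (2 * S) = S + S + n * (2 * S) := by push_cast; ring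
    rw [e]
    refine LogDiffOn.integral (b := C * C * C ^ n) H.isOpen (fun x' => ?_) (fun θ hθ => ?_)
      (fun θ hθ x' => ?_)
    · refine ((H.q_diff x x').mul (H.h_diff _ _) (fun θ hθ => ?_) (fun θ hθ => ?_)).mul (ih _ _)
        (fun θ hθ => ?_) (fun θ hθ => ?_)
      · exact (((H.regular θ hθ).posBdd_q x).pos x').le
      · exact (((H.regular θ hθ).posBdd_h _).pos x').le
      · exact mul_nonneg (((H.regular θ hθ).posBdd_q x).pos x').le
          (((H.regular θ hθ).posBdd_h _).pos x').le
      · exact ((H.regular θ hθ).lik_pos _ _ _).le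
    · exact (((H.regular θ hθ).measurable_q_right x).mul ((H.regular θ hθ).measurable_h _)).mul
        ((H.regular θ hθ).measurable_lik_right _ _)
    · have R := H.regular θ hθ
      have hC := R.C_pos
      rw [abs_of_pos (mul_pos (mul_pos ((R.posBdd_q x).pos x') ((R.posBdd_h _).pos x'))
        (R.lik_pos _ _ _))]
      exact mul_le_mul (mul_le_mul (R.q_mem _ _).2 (R.h_mem _ _).2 ((R.posBdd_h _).pos x').le hC.le)
        (R.lik_mem _ _ _).2 (R.lik_pos _ _ _).le (by positivity)

/-- The logarithmic derivative, in the direction `e`, of the kernel `q θ x x' * h θ k x'`. -/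
def kernelScore (q : E → 𝓧 → 𝓧 → ℝ) (h : E → ℤ → 𝓧 → ℝ) (θ e : E) (k : ℤ) (x x' : 𝓧) : ℝ :=
  fderiv ℝ (fun ϑ => q ϑ x x') θ e / q θ x x' + fderiv ℝ (fun ϑ => h ϑ k x') θ e / h θ k x'

/-- Differentiation under the integral reproduces the transfer operator with the source term
`kernelScore * lik`, which is the recursion required by `TransferDeriv`. -/
lemma fderiv_lik_succ (H : RegularFamily μ q h c C S G) {θ : E} (hθ : θ ∈ G) (e : E) (n : ℕ)
    {a b : ℤ} (hb : b = a + 1) (x : 𝓧) :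
    fderiv ℝ (fun ϑ => lik (q ϑ) μ (h ϑ) (n + 1) a x) θ e =
      ∫ x', q θ x x' * h θ b x' * (fderiv ℝ (fun ϑ => lik (q ϑ) μ (h ϑ) n b x') θ e +
        kernelScore q h θ e b x x' * lik (q θ) μ (h θ) n b x') ∂μ := by
  subst hb
  simp only [lik]
  rw [LogDiffOn.fderiv_integral_apply (μ := μ) (S := S + S + n * (2 * S)) (b := C * C * C ^ n)
    H.isOpen (fun x' => ?_) (fun θ hθ => ?_) (fun θ hθ x' => ?_) hθ]
  · refine integral_congr_ae (Eventually.of_forall fun x' => ?_)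
    have R := H.regular θ hθ
    have hq0 := ((R.posBdd_q x).pos x').ne'
    have hh0 := ((R.posBdd_h (a + 1)).pos x').ne'
    have d1 := (H.q_diff x x' θ hθ).1
    have d2 := (H.h_diff (a + 1) x' θ hθ).1
    have d3 := (H.lik_logDiffOn n (a + 1) x' θ hθ).1
    dsimp only
    rw [fderiv_fun_mul (d1.fun_mul d2) d3, fderiv_fun_mul d1 d2]
    simp only [kernelScore, add_apply, smul_apply,
      smul_eq_mul]
    field_simp
    ring
  · refine ((H.q_diff x x').mul (H.h_diff _ _) (fun θ hθ => ?_) (fun θ hθ => ?_)).mul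
      (H.lik_logDiffOn _ _ _) (fun θ hθ => ?_) (fun θ hθ => ?_)
    · exact (((H.regular θ hθ).posBdd_q x).pos x').le
    · exact (((H.regular θ hθ).posBdd_h _).pos x').le
    · exact mul_nonneg (((H.regular θ hθ).posBdd_q x).pos x').le
        (((H.regular θ hθ).posBdd_h _).pos x').le
    · exact ((H.regular θ hθ).lik_pos _ _ _).le
  · exact (((H.regular θ hθ).measurable_q_right x).mul ((H.regular θ hθ).measurable_h _)).mul
      ((H.regular θ hθ).measurable_lik_right _ _)
  · have R := H.regular θ hθ
    have hC := R.C_pos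
    rw [abs_of_pos (mul_pos (mul_pos ((R.posBdd_q x).pos x') ((R.posBdd_h _).pos x'))
      (R.lik_pos _ _ _))]
    exact mul_le_mul (mul_le_mul (R.q_mem _ _).2 (R.h_mem _ _).2 ((R.posBdd_h _).pos x').le hC.le)
      (R.lik_mem _ _ _).2 (R.lik_pos _ _ _).le (by positivity)

lemma abs_fderiv_lik_le (H : RegularFamily μ q h c C S G) {θ : E} (hθ : θ ∈ G) {e : E}
    (he : ‖e‖ ≤ 1) (n : ℕ) (a : ℤ) (x : 𝓧) :
    |fderiv ℝ (fun ϑ => lik (q ϑ) μ (h ϑ) n a x) θ e| ≤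
      n * (2 * S) * lik (q θ) μ (h θ) n a x := by
  have h1 := ((fderiv ℝ (fun ϑ => lik (q ϑ) μ (h ϑ) n a x) θ).le_opNorm e)
  rw [Real.norm_eq_abs] at h1
  have h2 := (H.lik_logDiffOn n a x θ hθ).2
  calc _ ≤ _ := h1
    _ ≤ ‖fderiv ℝ (fun ϑ => lik (q ϑ) μ (h ϑ) n a x) θ‖ * 1 := by gcongr
    _ ≤ _ := by rw [mul_one]; exact h2

lemma bddMeas_fderiv_lik (H : RegularFamily μ q h c C S G) {θ : E} (hθ : θ ∈ G) {e : E}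
    (he : ‖e‖ ≤ 1) (n : ℕ) (a : ℤ) :
    BddMeas fun x => fderiv ℝ (fun ϑ => lik (q ϑ) μ (h ϑ) n a x) θ e := by
  refine ⟨measurable_fderiv_apply_of_eventually (fun x => (H.lik_logDiffOn n a x θ hθ).1) ?_ e,
    n * (2 * S) * C ^ n, fun x => (H.abs_fderiv_lik_le hθ he n a x).trans ?_⟩
  · filter_upwards [H.isOpen.mem_nhds hθ] with ϑ hϑ using
      (H.regular ϑ hϑ).measurable_lik_right n a
  · have := H.S_nonneg
    exact mul_le_mul_of_nonneg_left ((H.regular θ hθ).lik_mem n a x).2 (by positivity)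

lemma abs_kernelScore_le (H : RegularFamily μ q h c C S G) {θ : E} (hθ : θ ∈ G) {e : E}
    (he : ‖e‖ ≤ 1) (k : ℤ) (x x' : 𝓧) : |kernelScore q h θ e k x x'| ≤ 2 * S := by
  have key : ∀ {F : E → ℝ}, LogDiffOn S G F → 0 < F θ → |fderiv ℝ F θ e / F θ| ≤ S := by
    intro F hF h0
    rw [abs_div, abs_of_pos h0, div_le_iff₀ h0]
    calc |fderiv ℝ F θ e| ≤ ‖fderiv ℝ F θ‖ * ‖e‖ := (fderiv ℝ F θ).le_opNorm e
      _ ≤ ‖fderiv ℝ F θ‖ * 1 := by gcongr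
      _ ≤ _ := by rw [mul_one]; exact (hF θ hθ).2
  have R := H.regular θ hθ
  have h1 := key (H.q_diff x x') ((R.posBdd_q x).pos x')
  have h2 := key (H.h_diff k x') ((R.posBdd_h k).pos x')
  unfold kernelScore
  refine (abs_add_le _ _).trans ?_
  linarith

lemma measurable_kernelScore (H : RegularFamily μ q h c C S G) {θ : E} (hθ : θ ∈ G) (e : E)
    (k : ℤ) (x : 𝓧) : Measurable (kernelScore q h θ e k x) := by
  unfold kernelScore
  refine Measurable.add (Measurable.div ?_ ((H.regular θ hθ).measurable_q_right x))
    (Measurable.div ?_ ((H.regular θ hθ).measurable_h k))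
  · refine measurable_fderiv_apply_of_eventually (F := fun ϑ x' => q ϑ x x')
      (fun x' => (H.q_diff x x' θ hθ).1) ?_ e
    filter_upwards [H.isOpen.mem_nhds hθ] with ϑ hϑ using (H.regular ϑ hϑ).measurable_q_right x
  · refine measurable_fderiv_apply_of_eventually (F := fun ϑ x' => h ϑ k x')
      (fun x' => (H.h_diff k x' θ hθ).1) ?_ e
    filter_upwards [H.isOpen.mem_nhds hθ] with ϑ hϑ using (H.regular ϑ hϑ).measurable_h k

lemma transferDeriv {h' : E → ℤ → 𝓧 → ℝ} (H : RegularFamily μ q h c C S G)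
    (H' : RegularFamily μ q h' c C S G) {θ : E} (hθ : θ ∈ G) {e : E} (he : ‖e‖ ≤ 1)
    (b : ℤ) (N N' : ℕ) (hh : ∀ k ≤ b, ∀ ϑ, h ϑ k = h' ϑ k) :
    TransferDeriv μ (q θ) (fun j => h θ (b - j)) (fun j => lik (q θ) μ (h θ) (N + j) (b - j))
      (fun j => lik (q θ) μ (h' θ) (N' + j) (b - j))
      (fun j => kernelScore q h θ e (b - j)) (2 * S)
      (fun j x => fderiv ℝ (fun ϑ => lik (q ϑ) μ (h ϑ) (N + j) (b - j) x) θ e)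
      (fun j x => fderiv ℝ (fun ϑ => lik (q ϑ) μ (h' ϑ) (N' + j) (b - j) x) θ e) where
  measurable_s _ x := H.measurable_kernelScore hθ e _ x
  abs_s_le _ x x' := H.abs_kernelScore_le hθ he _ x x'
  bddMeas_u' _ := H.bddMeas_fderiv_lik hθ he _ _
  bddMeas_v' _ := H'.bddMeas_fderiv_lik hθ he _ _
  u'_succ n x := H.fderiv_lik_succ hθ e _ (by push_cast; ring) x
  v'_succ n x := by
    have : ∀ x', kernelScore q h θ e (b - n) x x' = kernelScore q h' θ e (b - n) x x' := by
      intro x'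
      simp only [kernelScore, hh (b - n) (by lia)]
    simp only [this, hh (b - n) (by lia)]
    exact H'.fderiv_lik_succ hθ e _ (by push_cast; ring) x

/-- The derivative of the log-likelihood in the direction `e` has bounded oscillation, uniformly
in the length of the window. -/
lemma exists_interval_logDeriv [NeZero μ] (H : RegularFamily μ q h c C S G) {θ : E} (hθ : θ ∈ G)
    {e : E} (he : ‖e‖ ≤ 1) (n : ℕ) (a : ℤ) :
    ∃ A, ∀ x,
      A ≤ fderiv ℝ (fun ϑ => lik (q ϑ) μ (h ϑ) n a x) θ e / lik (q θ) μ (h θ) n a x ∧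
      fderiv ℝ (fun ϑ => lik (q ϑ) μ (h ϑ) n a x) θ e / lik (q θ) μ (h θ) n a x ≤
        A + 4 * S * C / c := by
  have R := H.regular θ hθ
  have hc := R.c_pos
  have hC := R.C_pos
  have hS := H.S_nonneg
  -- The kernel score is bounded by `2 * S`, and `K = 4 * S * C / c` solves `2 * (2 * S) = c / C *
  -- K`. The iteration starts from the empty window, whose derivative is `0`.
  have := TransferDeriv.exists_interval (μ := μ) (c := c) (C := C) (K := 4 * S * C / c)
    (R.transferPair R (a + n) 0 0 (fun _ _ => rfl))
    (H.transferDeriv H hθ he (a + n) 0 0 (fun _ _ _ => rfl)) hc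
    R.measurable_q_right R.q_mem (le_of_eq (by field_simp; ring))
    ⟨0, fun x => by
      have : (fun ϑ => lik (q ϑ) μ (h ϑ) (0 + 0) (a + n - (0 : ℕ)) x) = fun _ => 1 := rfl
      rw [this]
      simp only [fderiv_fun_const, Pi.zero_apply, zero_apply, zero_div,
        zero_add, le_refl, true_and]
      positivity⟩ n
  simpa using this

/-- The derivative of the log-likelihood of a window. -/
def logLikDeriv (μ : Measure 𝓧) (q : E → 𝓧 → 𝓧 → ℝ) (h : E → ℤ → 𝓧 → ℝ) (θ : E) (n : ℕ) (a : ℤ)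
    (x : 𝓧) : E →L[ℝ] ℝ :=
  fderiv ℝ (fun ϑ => Real.log (lik (q ϑ) μ (h ϑ) n a x)) θ

/-- The derivative of the logarithm of the conditional density of the observation at time `t`. -/
def condScore (μ : Measure 𝓧) (q : E → 𝓧 → 𝓧 → ℝ) (h : E → ℤ → 𝓧 → ℝ) (t : ℤ) (θ : E) (n : ℕ)
    (a : ℤ) (x : 𝓧) : E →L[ℝ] ℝ :=
  fderiv ℝ (fun ϑ => Real.log (condLik (q ϑ) μ (h ϑ) t n a x)) θ

lemma logLikDeriv_apply (H : RegularFamily μ q h c C S G) {θ : E} (hθ : θ ∈ G) (n : ℕ) (a : ℤ)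
    (x : 𝓧) (e : E) :
    logLikDeriv μ q h θ n a x e =
      fderiv ℝ (fun ϑ => lik (q ϑ) μ (h ϑ) n a x) θ e / lik (q θ) μ (h θ) n a x := by
  have h0 := ((H.regular θ hθ).lik_pos n a x).ne'
  unfold logLikDeriv
  rw [fderiv.log (H.lik_logDiffOn n a x θ hθ).1 h0, smul_apply, smul_eq_mul]
  field_simp

lemma norm_logLikDeriv_le (H : RegularFamily μ q h c C S G) {θ : E} (hθ : θ ∈ G) (n : ℕ) (a : ℤ)
    (x : 𝓧) : ‖logLikDeriv μ q h θ n a x‖ ≤ n * (2 * S) := by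
  have hS := H.S_nonneg
  have h0 := (H.regular θ hθ).lik_pos n a x
  refine ContinuousLinearMap.opNorm_le_of_unit_norm (by positivity) fun e he => ?_
  rw [H.logLikDeriv_apply hθ, Real.norm_eq_abs, abs_div, abs_of_pos h0, div_le_iff₀ h0]
  exact H.abs_fderiv_lik_le hθ he.le n a x

lemma hasFDerivAt_log_condLik (H : RegularFamily μ q h c C S G) (t : ℤ) {θ : E} (hθ : θ ∈ G)
    (n : ℕ) (a : ℤ) (x : 𝓧) :
    HasFDerivAt (fun ϑ => Real.log (condLik (q ϑ) μ (h ϑ) t n a x))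
      (logLikDeriv μ q h θ n a x -
        logLikDeriv μ q (fun ϑ => Function.update (h ϑ) t fun _ => 1) θ n a x) θ := by
  have H' := H.update_one t
  have d1 := ((H.lik_logDiffOn n a x θ hθ).1.log ((H.regular θ hθ).lik_pos n a x).ne').hasFDerivAt
  have d2 := ((H'.lik_logDiffOn n a x θ hθ).1.log
    ((H'.regular θ hθ).lik_pos n a x).ne').hasFDerivAt
  refine (d1.sub d2).congr_of_eventuallyEq ?_
  filter_upwards [H.isOpen.mem_nhds hθ] with ϑ hϑ using (H.regular ϑ hϑ).log_condLik t n a x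

lemma condScore_eq (H : RegularFamily μ q h c C S G) (t : ℤ) {θ : E} (hθ : θ ∈ G) (n : ℕ) (a : ℤ)
    (x : 𝓧) : condScore μ q h t θ n a x = logLikDeriv μ q h θ n a x -
        logLikDeriv μ q (fun ϑ => Function.update (h ϑ) t fun _ => 1) θ n a x :=
  (H.hasFDerivAt_log_condLik t hθ n a x).fderiv

/-- Averaging keeps the interval and the kernel score widens it by `2 * S` on both sides. This
covers the step across time `t`, where the likelihoods with and without the observation differ. -/
lemma logDeriv_succ_mem [NeZero μ] (H : RegularFamily μ q h c C S G) {θ : E} (hθ : θ ∈ G)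
    {e : E} (he : ‖e‖ ≤ 1) {n : ℕ} {a b : ℤ} (hb : b = a + 1) {A K : ℝ}
    (hA : ∀ x, A ≤ logLikDeriv μ q h θ n b x e ∧ logLikDeriv μ q h θ n b x e ≤ A + K) (x : 𝓧) :
    A - 2 * S ≤ logLikDeriv μ q h θ (n + 1) a x e ∧
      logLikDeriv μ q h θ (n + 1) a x e ≤ A + K + 2 * S := by
  have R := H.regular θ hθ
  have hl := R.posBdd_lik n b
  have hw : PosBdd fun x' => q θ x x' * (h θ b x' * lik (q θ) μ (h θ) n b x') :=
    (R.posBdd_q x).mul ((R.posBdd_h b).mul hl)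
  have hb' := (H.bddMeas_fderiv_lik hθ he n b).div hl
  have hs : BddMeas (kernelScore q h θ e b x) :=
    ⟨H.measurable_kernelScore hθ e b x, 2 * S, H.abs_kernelScore_le hθ he b x⟩
  simp only [H.logLikDeriv_apply hθ] at hA ⊢
  rw [H.fderiv_lik_succ hθ e n hb, lik_succ_of_eq hb, TransferDeriv.logDeriv_succ hl]
  have hm : ∀ x', |kernelScore q h θ e b x x'| ≤ 2 * S := H.abs_kernelScore_le hθ he b x
  constructor
  · rw [← wavg_const (μ := μ) hw (A - 2 * S)]
    refine wavg_mono hw (.const _) (hb'.add hs) fun x' => ?_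
    have h1 := (hA x').1
    have h2 := (abs_le.1 (hm x')).1
    linarith
  · rw [← wavg_const (μ := μ) hw (A + K + 2 * S)]
    refine wavg_mono hw (hb'.add hs) (.const _) fun x' => ?_
    have h1 := (hA x').2
    have h2 := (abs_le.1 (hm x')).2
    linarith

lemma logLikDeriv_update_of_le (t : ℤ) (θ : E) (n : ℕ) {a : ℤ} (ha : t ≤ a) (x : 𝓧) :
    logLikDeriv μ q (fun ϑ => Function.update (h ϑ) t fun _ => 1) θ n a x =
      logLikDeriv μ q h θ n a x := by
  unfold logLikDeriv
  congr 1
  ext ϑ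
  rw [lik_congr (fun j hj _ => Function.update_of_ne (by lia) _ _) x]

/-- The constant in the forgetting property of the scores. -/
lemma exists_condScore_bounds [NeZero μ] {c C S : ℝ} (hc : 0 < c) (hc1 : c ≤ 1) (hC1 : 1 ≤ C)
    (hS : 0 ≤ S) :
    ∃ B : ℝ, 0 ≤ B ∧ ∀ (q : E → 𝓧 → 𝓧 → ℝ) (h : E → ℤ → 𝓧 → ℝ) (G : Set E),
      RegularFamily μ q h c C S G → ∀ (t : ℤ), ∀ θ ∈ G,
      (∀ i j k x x', 1 ≤ i → i ≤ j → ‖condScore μ q h t θ (j + k) (t - j) x -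
        condScore μ q h t θ (i + k) (t - i) x'‖ ≤ B * rate c C ^ i) ∧
      (∀ n k x, ‖condScore μ q h t θ (n + (k + 1)) (t - n) x -
        condScore μ q h t θ (n + k) (t - n) x‖ ≤ B * rate c C ^ k) := by
  have hC : 0 < C := by linarith
  have hr0 := rate_pos hc (hc1.trans hC1)
  have hr1 := rate_lt_one hc hC
  have hρr := lt_rate hc hC
  have h1r : 0 < 1 - rate c C := by linarith
  -- Oscillation `4 * S * C / c` for windows starting at `t`, plus `2 * S` on either side for the
  -- step across `t`. The same `K` bounds the initial difference of the two logarithmic derivatives.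
  obtain ⟨K, hKdef⟩ : ∃ K, K = 4 * S * C / c + 4 * S := ⟨_, rfl⟩
  obtain ⟨e₁, he₁⟩ : ∃ e₁, 2 * C * (1 + (1 - rate c C)⁻¹) * (K + 2 * S) / c = e₁ := ⟨_, rfl⟩
  obtain ⟨b, hb⟩ : ∃ b, 2 * K + 2 * e₁ / (rate c C - (1 - c / C)) = b := ⟨_, rfl⟩
  obtain ⟨B, hB⟩ : ∃ B, B = (b + e₁) * (1 + (1 - rate c C)⁻¹) := ⟨_, rfl⟩
  have hK0 : 0 ≤ K := by rw [hKdef]; positivity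
  have he₁0 : 0 ≤ e₁ := by rw [← he₁]; positivity
  have hb0 : 0 ≤ b := by
    rw [← hb]
    have : 0 ≤ rate c C - (1 - c / C) := by linarith
    positivity
  have hB0 : 0 ≤ B := by rw [hB]; positivity
  have hKS : 2 * (2 * S) ≤ c / C * K := by
    have : c / C * K = 4 * S + c / C * (4 * S) := by rw [hKdef]; field_simp
    rw [this]
    have : 0 ≤ c / C * (4 * S) := by positivity
    linarith
  have hSK : 2 * S ≤ K := by
    have : 0 ≤ 4 * S * C / c := by positivity
    rw [hKdef]; linarith
  -- The division by the rate pays for starting the iteration at `t - 1`, the factor `2` for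
  -- treating separately the likelihoods with and without the observation at `t`.
  refine ⟨max (B / rate c C) (2 * B), by positivity, fun q h G H t θ hθ => ⟨?_, ?_⟩⟩
  · intro i j k x x' hi hij
    have hmax : B / rate c C * rate c C ^ i ≤ max (B / rate c C) (2 * B) * rate c C ^ i :=
      mul_le_mul_of_nonneg_right (le_max_left _ _) (by positivity)
    refine ContinuousLinearMap.opNorm_le_of_unit_norm (by positivity) fun e he => ?_
    refine le_trans ?_ hmax
    obtain ⟨i, rfl⟩ := Nat.exists_eq_add_of_le' hi
    obtain ⟨j, rfl⟩ := Nat.exists_eq_add_of_le' (hi.trans hij)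
    have H' := H.update_one t
    have R := H.regular θ hθ
    have R' := H'.regular θ hθ
    have e1 : ∀ (n : ℕ) (x : 𝓧),
        condScore μ q h t θ (n + 1 + k) (t - ((n + 1 : ℕ) : ℤ)) x e =
        fderiv ℝ (fun ϑ => lik (q ϑ) μ (h ϑ) (k + 1 + n) (t - 1 - n) x) θ e /
          lik (q θ) μ (h θ) (k + 1 + n) (t - 1 - n) x -
        fderiv ℝ (fun ϑ => lik (q ϑ) μ (Function.update (h ϑ) t fun _ => 1)
            (k + 1 + n) (t - 1 - n) x) θ e /
          lik (q θ) μ (Function.update (h θ) t fun _ => 1) (k + 1 + n) (t - 1 - n) x := by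
      intro n x
      have e1 : n + 1 + k = k + 1 + n := by ring
      have e2 : t - ((n + 1 : ℕ) : ℤ) = t - 1 - n := by push_cast; ring
      rw [e1, e2, H.condScore_eq t hθ, sub_apply, H.logLikDeriv_apply hθ,
        H'.logLikDeriv_apply hθ]
    have htb : t = t - 1 - ((0 : ℕ) : ℤ) + 1 := by simp
    -- Windows starting at `t` do not contain time `t`, so a single `A` serves for both families.
    obtain ⟨A, hA⟩ := H.exists_interval_logDeriv hθ he.le k t
    simp only [← H.logLikDeriv_apply hθ] at hA
    have hA1 := H.logDeriv_succ_mem hθ he.le htb hA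
    have hA2 := H'.logDeriv_succ_mem hθ he.le (n := k) htb (A := A) (K := 4 * S * C / c) (by
      intro x
      rw [logLikDeriv_update_of_le t θ k le_rfl]
      exact hA x)
    simp only [H.logLikDeriv_apply hθ] at hA1
    simp only [H'.logLikDeriv_apply hθ] at hA2
    have key := TransferDeriv.abs_sub_le (μ := μ) (c := c) (C := C) (α := c) (β := C)
      (K := K) (e := e₁) (b := b)
      (R.transferPair R' (t - 1) (k + 1) (k + 1)
        (fun l hl => (Function.update_of_ne (by lia) _ _).symm))
      (H.transferDeriv H' hθ he.le (t - 1) (k + 1) (k + 1)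
        (fun l hl ϑ => (Function.update_of_ne (by lia) _ _).symm)) hc
      R.measurable_q_right R.q_mem hc hr1 hρr hr0
      (fun x => R.lik_ratio_update_mem htb k x) hKS
      ⟨A - 2 * S, fun x => ⟨(hA2 x).1, (hA2 x).2.trans (by rw [hKdef]; linarith)⟩⟩
      (fun x => by
        have h1 := hA1 x
        have h2 := hA2 x
        rw [hKdef, abs_le]
        constructor <;> linarith)
      he₁ hb (show i ≤ j by lia) x x'
    rw [sub_apply, e1, e1, Real.norm_eq_abs]
    refine key.trans (le_of_eq ?_)
    rw [← hB, pow_succ]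
    field_simp
  · intro n k x
    have hmax : 2 * B * rate c C ^ k ≤ max (B / rate c C) (2 * B) * rate c C ^ k :=
      mul_le_mul_of_nonneg_right (le_max_right _ _) (by positivity)
    refine ContinuousLinearMap.opNorm_le_of_unit_norm (by positivity) fun e he => ?_
    refine le_trans ?_ hmax
    have key : ∀ {h' : E → ℤ → 𝓧 → ℝ}, RegularFamily μ q h' c C S G →
        |(logLikDeriv μ q h' θ (n + (k + 1)) (t - n) x e -
          logLikDeriv μ q h' θ (n + k) (t - n) x e) -
         (logLikDeriv μ q h' θ (k + 1) t x e - logLikDeriv μ q h' θ k t x e)| ≤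
        B * rate c C ^ k := by
      intro h' H'
      have R' := H'.regular θ hθ
      have hone : ∀ x, lik (q θ) μ (h' θ) (0 + 0) (t + k - (0 : ℕ)) x = 1 := fun x => rfl
      have hone' : ∀ x, fderiv ℝ (fun ϑ => lik (q ϑ) μ (h' ϑ) (0 + 0) (t + k - (0 : ℕ)) x) θ e
          = 0 := by
        intro x
        have : (fun ϑ => lik (q ϑ) μ (h' ϑ) (0 + 0) (t + k - (0 : ℕ)) x) = fun _ => 1 := rfl
        rw [this]
        simp
      have := TransferDeriv.abs_sub_le (μ := μ) (c := c) (C := C) (α := c) (β := C)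
        (K := K) (e := e₁) (b := b)
        (R'.transferPair R' (t + k) 1 0 (fun _ _ => rfl))
        (H'.transferDeriv H' hθ he.le (t + k) 1 0 (fun _ _ _ => rfl)) hc
        R'.measurable_q_right R'.q_mem hc hr1 hρr hr0
        (fun x => by rw [hone, div_one]; exact R'.lik_one_mem _ _) hKS
        ⟨0, fun x => by rw [hone']; simpa using hK0⟩
        (fun x => by
          rw [hone', zero_div, sub_zero]
          have h0 := R'.lik_pos (1 + 0) (t + k - (0 : ℕ)) x
          rw [abs_div, abs_of_pos h0, div_le_iff₀ h0]
          refine (H'.abs_fderiv_lik_le hθ he.le _ _ x).trans ?_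
          refine mul_le_mul_of_nonneg_right ?_ h0.le
          simpa using hSK)
        he₁ hb (show k ≤ k + n by lia) x x
      simp only [← H'.logLikDeriv_apply hθ] at this
      have e1 : (1 + (k + n)) = n + (k + 1) := by ring
      have e2 : t + (k : ℤ) - ((k + n : ℕ) : ℤ) = t - n := by push_cast; ring
      have e3 : 0 + (k + n) = n + k := by ring
      have e4 : 1 + k = k + 1 := by ring
      have e5 : t + (k : ℤ) - (k : ℤ) = t := by ring
      rw [e1, e2, e3, e4, e5, zero_add, ← hB] at this
      exact this
    have h1 := key H
    have h2 := key (H.update_one t)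
    rw [logLikDeriv_update_of_le t θ _ le_rfl, logLikDeriv_update_of_le t θ _ le_rfl] at h2
    rw [H.condScore_eq t hθ, H.condScore_eq t hθ]
    simp only [sub_apply]
    rw [Real.norm_eq_abs]
    rw [abs_le] at h1 h2 ⊢
    constructor <;> linarith

/-- The scores of finite windows converge, uniformly in the initial state. -/
lemma exists_condScore_limit [NeZero μ] [Nonempty 𝓧] {c C S : ℝ} (hc : 0 < c) (hc1 : c ≤ 1)
    (hC1 : 1 ≤ C) (hS : 0 ≤ S) :
    ∃ B : ℝ, 0 ≤ B ∧ ∀ (q : E → 𝓧 → 𝓧 → ℝ) (h : E → ℤ → 𝓧 → ℝ) (G : Set E),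
      RegularFamily μ q h c C S G → ∀ (t : ℤ), ∀ θ ∈ G,
      ∃ L : E →L[ℝ] ℝ, ∀ (n k : ℕ) (x : 𝓧), 1 ≤ n →
        ‖condScore μ q h t θ (n + k) (t - n) x - L‖ ≤ B * (rate c C ^ n + rate c C ^ k) := by
  obtain ⟨B, hB0, hB⟩ := exists_condScore_bounds (E := E) (μ := μ) hc hc1 hC1 hS
  have hr1 := rate_lt_one hc (zero_lt_one.trans_le hC1)
  have h1r : 0 < 1 - rate c C := by linarith
  refine ⟨B * (1 - rate c C)⁻¹, by positivity, fun q h G H t θ hθ => ?_⟩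
  obtain ⟨h1, h2⟩ := hB q h G H t θ hθ
  exact exists_limit_of_windows (V := E →L[ℝ] ℝ) hB0 (rate_pos hc (hc1.trans hC1)) hr1
    (G := fun n k x => condScore μ q h t θ (n + k) (t - n) x) h1 h2

end RegularFamily

end Families

/-! ### The law of a finite window of observations -/

section Law

open scoped ENNReal

variable {𝓧 𝓞 : Type*} [MeasurableSpace 𝓧] [MeasurableSpace 𝓞] {μ : Measure 𝓧} [IsFiniteMeasure μ]

/-- Iterated transfer operators with terminal function `f`, for `ℝ≥0∞`-valued functions. -/
def ltransfer (μ : Measure 𝓧) (q : 𝓧 → 𝓧 → ℝ) (h : ℤ → 𝓧 → ℝ) :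
    ℕ → ℤ → (𝓧 → ℝ≥0∞) → 𝓧 → ℝ≥0∞
  | 0, _, f, x => f x
  | n + 1, a, f, x =>
    ∫⁻ x', ENNReal.ofReal (q x x' * h (a + 1) x') * ltransfer μ q h n (a + 1) f x' ∂μ

/-- Peels off the last transition instead of the first, as needed in an induction that extends the
window to the right. -/
lemma ltransfer_succ_right (q : 𝓧 → 𝓧 → ℝ) (h : ℤ → 𝓧 → ℝ) (n : ℕ) {a b : ℤ} (hb : b = a + n + 1)
    (f : 𝓧 → ℝ≥0∞) (x : 𝓧) :
    ltransfer μ q h (n + 1) a f x =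
      ltransfer μ q h n a (fun y => ∫⁻ x', ENNReal.ofReal (q y x' * h b x') * f x' ∂μ) x := by
  subst hb
  induction n generalizing a x with
  | zero => simp [ltransfer]
  | succ n ih =>
    rw [ltransfer]
    simp_rw [ih]
    rw [ltransfer]
    have : a + 1 + n + 1 = a + ((n + 1 : ℕ) : ℤ) + 1 := by push_cast; ring
    rw [this]

lemma ltransfer_congr {q : 𝓧 → 𝓧 → ℝ} {h h' : ℤ → 𝓧 → ℝ} {n : ℕ} {a : ℤ}
    (hh : ∀ k, a < k → k ≤ a + n → h k = h' k) (f : 𝓧 → ℝ≥0∞) (x : 𝓧) :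
    ltransfer μ q h n a f x = ltransfer μ q h' n a f x := by
  induction n generalizing a x with
  | zero => rfl
  | succ n ih =>
    have h1 : h (a + 1) = h' (a + 1) := hh _ (by lia) (by push_cast; lia)
    have h2 : ∀ x', ltransfer μ q h n (a + 1) f x' = ltransfer μ q h' n (a + 1) f x' :=
      fun x' => ih (fun k hk hk' => hh k (by lia) (by push_cast; lia)) x'
    simp only [ltransfer, h1, h2]

lemma measurable_ltransfer {β : Type*} [MeasurableSpace β] {q : 𝓧 → 𝓧 → ℝ}
    (hq : Measurable (Function.uncurry q)) {h : β → ℤ → 𝓧 → ℝ}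
    (hh : ∀ k, Measurable fun p : β × 𝓧 => h p.1 k p.2) {f : β → 𝓧 → ℝ≥0∞}
    (hf : Measurable (Function.uncurry f)) (n : ℕ) (a : ℤ) :
    Measurable fun p : β × 𝓧 => ltransfer μ q (h p.1) n a (f p.1) p.2 := by
  induction n generalizing a with
  | zero => exact hf
  | succ n ih =>
    simp only [ltransfer]
    have : Measurable fun p : (β × 𝓧) × 𝓧 =>
        ENNReal.ofReal (q p.1.2 p.2 * h p.1.1 (a + 1) p.2) *
          ltransfer μ q (h p.1.1) n (a + 1) (f p.1.1) p.2 :=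
      ((hq.comp (measurable_fst.snd.prodMk measurable_snd)).mul
        ((hh (a + 1)).comp (measurable_fst.fst.prodMk measurable_snd))).ennreal_ofReal.mul
        ((ih (a + 1)).comp (measurable_fst.fst.prodMk measurable_snd))
    exact this.lintegral_prod_right'

lemma lintegral_ltransfer {β : Type*} [MeasurableSpace β] {ρ : Measure β} [SFinite ρ]
    {q : 𝓧 → 𝓧 → ℝ} (hq : Measurable (Function.uncurry q)) {h : ℤ → 𝓧 → ℝ}
    (hh : ∀ k, Measurable (h k)) {f : β → 𝓧 → ℝ≥0∞}
    (hf : Measurable (Function.uncurry f)) (n : ℕ) (a : ℤ) (x : 𝓧) :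
    ∫⁻ v, ltransfer μ q h n a (f v) x ∂ρ = ltransfer μ q h n a (fun y => ∫⁻ v, f v y ∂ρ) x := by
  induction n generalizing a x with
  | zero => rfl
  | succ n ih =>
    simp only [ltransfer]
    have hm := measurable_ltransfer (μ := μ) hq (h := fun _ : β => h)
      (fun k => (hh k).comp measurable_snd) hf n (a + 1)
    have hk : Measurable fun x' => ENNReal.ofReal (q x x' * h (a + 1) x') :=
      ((hq.comp measurable_prodMk_left).mul (hh _)).ennreal_ofReal
    rw [lintegral_lintegral_swap ((hk.comp measurable_snd).mul hm).aemeasurable]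
    refine lintegral_congr fun x' => ?_
    rw [lintegral_const_mul _ (by exact hm.comp measurable_prodMk_right), ih]

lemma RegularHMM.ltransfer_const {q : 𝓧 → 𝓧 → ℝ} {h : ℤ → 𝓧 → ℝ} {c C : ℝ}
    (H : RegularHMM μ q h c C) (n : ℕ) (a : ℤ) (K : ℝ≥0∞) (x : 𝓧) :
    ltransfer μ q h n a (fun _ => K) x = ENNReal.ofReal (lik q μ h n a x) * K := by
  induction n generalizing a x with
  | zero => simp [ltransfer, lik]
  | succ n ih =>
    simp only [ltransfer, lik, ih]
    have hw := ((H.posBdd_q x).mul (H.posBdd_h (a + 1))).mul (H.posBdd_lik n (a + 1))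
    rw [ofReal_integral_eq_lintegral_ofReal (hw.integrable μ)
      (Eventually.of_forall fun x' => (hw.pos x').le), ← lintegral_mul_const _ (by
        exact hw.1.ennreal_ofReal)]
    refine lintegral_congr fun x' => ?_
    rw [ENNReal.ofReal_mul (mul_pos ((H.posBdd_q x).pos x') ((H.posBdd_h (a + 1)).pos x')).le,
      mul_assoc]

/-- Emission densities `e k v x` (of the observation `v` at time `k` given the state `x`, with
respect to `ρ k`) satisfying the standing regularity assumptions. -/
structure RegularEmission (μ : Measure 𝓧) (q : 𝓧 → 𝓧 → ℝ) (e : ℤ → 𝓞 → 𝓧 → ℝ)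
    (ρ : ℤ → Measure 𝓞) (c C : ℝ) : Prop where
  measurable_e : ∀ k, Measurable (Function.uncurry (e k))
  regular : ∀ u : ℤ → 𝓞, RegularHMM μ q (fun k => e k (u k)) c C
  integral_e : ∀ k x, ∫ v, e k v x ∂ρ k = 1

/-- `X` is a Markov chain with transition density `q`, observed through `U` with emission
densities `e`. -/
structure IsObservedChain {Ω : Type*} [MeasurableSpace Ω] (μ : Measure 𝓧) (q : 𝓧 → 𝓧 → ℝ)
    (e : ℤ → 𝓞 → 𝓧 → ℝ) (ρ : ℤ → Measure 𝓞) (P : Measure Ω) (X : Ω → ℤ → 𝓧)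
    (U : Ω → ℤ → 𝓞) : Prop where
  measurable_X : ∀ k, Measurable fun ω => X ω k
  measurable_U : Measurable U
  lintegral_succ : ∀ a k : ℤ, a ≤ k → ∀ F : 𝓧 → (ℤ → 𝓞) → 𝓧 → ℝ≥0∞,
    (Measurable fun p : 𝓧 × (ℤ → 𝓞) × 𝓧 => F p.1 p.2.1 p.2.2) →
    (∀ x u u' x', (∀ j, a < j → j ≤ k + 1 → u j = u' j) → F x u x' = F x u' x') →
    ∫⁻ ω, F (X ω a) (U ω) (X ω (k + 1)) ∂P = ∫⁻ ω, ∫⁻ x', ∫⁻ v,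
      ENNReal.ofReal (q (X ω k) x' * e (k + 1) v x') *
        F (X ω a) (Function.update (U ω) (k + 1) v) x' ∂ρ (k + 1) ∂μ ∂P

variable {q : 𝓧 → 𝓧 → ℝ} {e : ℤ → 𝓞 → 𝓧 → ℝ} {ρ : ℤ → Measure 𝓞} [∀ k, IsFiniteMeasure (ρ k)]
  {c C : ℝ}

namespace RegularEmission

lemma measurable_likelihood (H : RegularEmission μ q e ρ c C) (k : ℤ) :
    Measurable fun p : (ℤ → 𝓞) × 𝓧 => e k (p.1 k) p.2 := by
  have h : Measurable fun p : (ℤ → 𝓞) × 𝓧 => (p.1 k, p.2) :=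
    ((measurable_pi_apply k).comp measurable_fst).prodMk measurable_snd
  exact (H.measurable_e k).comp h

lemma measurable_q [Nonempty 𝓞] (H : RegularEmission μ q e ρ c C) :
    Measurable (Function.uncurry q) :=
  (H.regular fun _ => Classical.arbitrary 𝓞).measurable_q

lemma measurable_lik [Nonempty 𝓞] (H : RegularEmission μ q e ρ c C) (n : ℕ) (a : ℤ) :
    Measurable fun p : (ℤ → 𝓞) × 𝓧 => lik q μ (fun k => e k (p.1 k)) n a p.2 :=
  ABCHMM.measurable_lik (h := fun (u : ℤ → 𝓞) k => e k (u k)) H.measurable_q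
    H.measurable_likelihood n a

lemma measurable_lik_update [Nonempty 𝓞] (H : RegularEmission μ q e ρ c C) (t : ℤ) (n : ℕ)
    (a : ℤ) : Measurable fun p : (ℤ → 𝓞) × 𝓧 =>
      lik q μ (Function.update (fun k => e k (p.1 k)) t fun _ => 1) n a p.2 := by
  refine ABCHMM.measurable_lik (h := fun u : ℤ → 𝓞 =>
    Function.update (fun k => e k (u k)) t fun _ => 1) H.measurable_q (fun k => ?_) n a
  rcases eq_or_ne k t with rfl | hk
  · simp only [Function.update_self]; exact measurable_const
  · simp only [Function.update_of_ne hk]; exact H.measurable_likelihood k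

lemma measurable_condLik [Nonempty 𝓞] (H : RegularEmission μ q e ρ c C) (t : ℤ) (n : ℕ) (a : ℤ) :
    Measurable fun p : (ℤ → 𝓞) × 𝓧 => condLik q μ (fun k => e k (p.1 k)) t n a p.2 :=
  (H.measurable_lik n a).div (H.measurable_lik_update t n a)

/-- Replacing the observation at time `t` and then forgetting it. -/
lemma update_likelihood_update (e : ℤ → 𝓞 → 𝓧 → ℝ) (u : ℤ → 𝓞) (t : ℤ) (v : 𝓞) :
    Function.update (fun k => e k (Function.update u t v k)) t (fun _ => 1) =
      Function.update (fun k => e k (u k)) t fun _ => 1 := by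
  ext k x
  rcases eq_or_ne k t with rfl | hk
  · simp
  · simp [Function.update_of_ne hk]

lemma lintegral_e [Nonempty 𝓞] (H : RegularEmission μ q e ρ c C) (k : ℤ) (x : 𝓧) :
    ∫⁻ v, ENNReal.ofReal (e k v x) ∂ρ k = 1 := by
  have h0 : ∀ v, 0 ≤ e k v x := fun v =>
    (((H.regular fun _ => v).posBdd_h k).pos x).le
  have hi : Integrable (fun v => e k v x) (ρ k) :=
    .of_integral_ne_zero (by rw [H.integral_e]; exact one_ne_zero)
  rw [← ofReal_integral_eq_lintegral_ofReal hi (Eventually.of_forall h0), H.integral_e,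
    ENNReal.ofReal_one]

/-- Integrating out the observation at time `t`. -/
lemma lintegral_lik_update [Nonempty 𝓞] (H : RegularEmission μ q e ρ c C) {t : ℤ} {n : ℕ} {a : ℤ}
    (hat : a < t) (htn : t ≤ a + n) (u : ℤ → 𝓞) (x : 𝓧) :
    ∫⁻ v, ENNReal.ofReal (lik q μ (fun k => e k (Function.update u t v k)) n a x) ∂ρ t =
      ENNReal.ofReal (lik q μ (Function.update (fun k => e k (u k)) t fun _ => 1) n a x) := by
  have hcst : ∀ (h : ℤ → 𝓧 → ℝ) (_ : RegularHMM μ q h c C) (n : ℕ) (a : ℤ) (x : 𝓧),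
      ENNReal.ofReal (lik q μ h n a x) = ltransfer μ q h n a (fun _ => 1) x :=
    fun h Hh n a x => by rw [Hh.ltransfer_const, mul_one]
  have hreg := fun v => H.regular (Function.update u t v)
  have hreg' := (H.regular u).update_one t
  rw [hcst _ hreg']
  simp_rw [fun v => hcst _ (hreg v) n a x]
  clear hcst
  induction n generalizing a x with
  | zero => simp at htn; lia
  | succ n ih =>
    have hup : ∀ k, Measurable fun p : 𝓞 × 𝓧 => e k (Function.update u t p.1 k) p.2 := fun k =>
      (H.measurable_likelihood k).comp
        (((measurable_update u).comp measurable_fst).prodMk measurable_snd)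
    have hm := measurable_ltransfer (μ := μ) H.measurable_q
      (h := fun (v : 𝓞) k => e k (Function.update u t v k)) hup
      (f := fun _ _ => 1) measurable_const n (a + 1)
    have hqx : Measurable (q x) := H.measurable_q.comp measurable_prodMk_left
    have hk : Measurable fun p : 𝓞 × 𝓧 =>
        ENNReal.ofReal (q x p.2 * e (a + 1) (Function.update u t p.1 (a + 1)) p.2) :=
      ((hqx.comp measurable_snd).mul (hup _)).ennreal_ofReal
    simp only [ltransfer]
    rw [lintegral_lintegral_swap (hk.mul hm).aemeasurable]
    refine lintegral_congr fun x' => ?_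
    have hq0 : 0 ≤ q x x' := (((H.regular u).posBdd_q x).pos x').le
    -- At time `t` the emission density integrates to `1` and later factors do not involve `v`;
    -- before `t` the integral passes through the recursion.
    rcases eq_or_ne t (a + 1) with rfl | hne
    · have h1 : ∀ v, ltransfer μ q (fun k => e k (Function.update u (a + 1) v k)) n (a + 1)
          (fun _ => 1) x' = ltransfer μ q (Function.update (fun k => e k (u k)) (a + 1) fun _ => 1)
          n (a + 1) (fun _ => 1) x' := by
        intro v
        refine ltransfer_congr (fun k hk _ => ?_) _ _
        rw [Function.update_of_ne (by lia), Function.update_of_ne (by lia)]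
      simp only [h1, Function.update_self, mul_one]
      simp_rw [ENNReal.ofReal_mul hq0]
      have hem : Measurable fun v => ENNReal.ofReal (e (a + 1) v x') :=
        ((H.measurable_e _).comp measurable_prodMk_right).ennreal_ofReal
      rw [lintegral_mul_const _ (hem.const_mul _), lintegral_const_mul _ hem,
        H.lintegral_e, mul_one]
    · have h1 : ∀ v, Function.update u t v (a + 1) = u (a + 1) := fun v =>
        Function.update_of_ne hne.symm _ _
      simp only [h1, Function.update_of_ne hne.symm]
      rw [lintegral_const_mul _ (by exact hm.comp measurable_prodMk_right),
        ih (by lia) (by push_cast at htn; lia)]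

/-- The denominator of the conditional density does not depend on `v` and is the integral of the
numerator. -/
lemma lintegral_condLik_update [Nonempty 𝓞] (H : RegularEmission μ q e ρ c C) {t : ℤ} {n : ℕ}
    {a : ℤ} (hat : a < t) (htn : t ≤ a + n) (u : ℤ → 𝓞) (x : 𝓧) :
    ∫⁻ v, ENNReal.ofReal (condLik q μ (fun k => e k (Function.update u t v k)) t n a x) ∂ρ t
      = 1 := by
  have h0 := ((H.regular u).update_one t).lik_pos n a x
  have hm : Measurable fun v => lik q μ (fun k => e k (Function.update u t v k)) n a x :=
    (H.measurable_lik n a).comp ((measurable_update u).prodMk measurable_const)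
  unfold condLik
  simp_rw [update_likelihood_update, fun v => ENNReal.ofReal_div_of_pos
    (x := lik q μ (fun k => e k (Function.update u t v k)) n a x) h0, div_eq_mul_inv]
  rw [lintegral_mul_const _ hm.ennreal_ofReal, H.lintegral_lik_update hat htn]
  exact ENNReal.mul_inv_cancel (by simpa using h0) ENNReal.ofReal_ne_top

end RegularEmission

namespace IsObservedChain

variable {Ω : Type*} [MeasurableSpace Ω] {P : Measure Ω} [IsProbabilityMeasure P]
  {X : Ω → ℤ → 𝓧} {U : Ω → ℤ → 𝓞}

/-- The joint law of the initial state, the observations in a window and the final state. -/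
lemma lintegral_window [Nonempty 𝓞] (hX : IsObservedChain μ q e ρ P X U)
    (H : RegularEmission μ q e ρ c C) (u₀ : ℤ → 𝓞) (n : ℕ) (a : ℤ)
    {F : 𝓧 → (ℤ → 𝓞) → 𝓧 → ℝ≥0∞}
    (hF : Measurable fun p : 𝓧 × (ℤ → 𝓞) × 𝓧 => F p.1 p.2.1 p.2.2)
    (hdep : ∀ x u u' x', (∀ j, a < j → j ≤ a + n → u j = u' j) → F x u x' = F x u' x') :
    ∫⁻ ω, F (X ω a) (U ω) (X ω (a + n)) ∂P =
      ∫⁻ ω, (∫⋯∫⁻_Finset.Ioc a (a + n), (fun u => ltransfer μ q (fun k => e k (u k)) n a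
        (F (X ω a) u) (X ω a)) ∂ρ) u₀ ∂P := by
  induction n generalizing F with
  | zero =>
    simp only [Nat.cast_zero, add_zero, Finset.Ioc_self, lmarginal_empty, ltransfer]
    refine lintegral_congr fun ω => hdep _ _ _ _ fun j h1 h2 => ?_
    simp at h2; lia
  | succ n ih =>
    have e1 : a + ((n + 1 : ℕ) : ℤ) = a + n + 1 := by push_cast; ring
    rw [e1] at hdep ⊢
    -- One step of the chain integrates out the last hidden state and observation, leaving a
    -- function of the shorter window for the induction hypothesis. The sequence `u₀` only fills the
    -- coordinates outside the window.
    rw [hX.lintegral_succ a (a + n) (by lia) F hF hdep]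
    have hq := H.measurable_q
    have hFu : Measurable fun p : (𝓧 × (ℤ → 𝓞) × 𝓧) × 𝓧 × 𝓞 =>
        ENNReal.ofReal (q p.1.2.2 p.2.1 * e (a + n + 1) p.2.2 p.2.1) *
        F p.1.1 (Function.update p.1.2.1 (a + n + 1) p.2.2) p.2.1 := by
      refine Measurable.mul (Measurable.ennreal_ofReal (Measurable.mul ?_ ?_)) ?_
      · exact hq.comp (measurable_fst.snd.snd.prodMk measurable_snd.fst)
      · exact (H.measurable_e _).comp (measurable_snd.snd.prodMk measurable_snd.fst)
      · exact hF.comp (measurable_fst.fst.prodMk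
          ((measurable_update'.comp (measurable_fst.snd.fst.prodMk measurable_snd.snd)).prodMk
            measurable_snd.fst))
    have hF₁ : Measurable fun p : 𝓧 × (ℤ → 𝓞) × 𝓧 => ∫⁻ x', ∫⁻ v,
        ENNReal.ofReal (q p.2.2 x' * e (a + n + 1) v x') *
        F p.1 (Function.update p.2.1 (a + n + 1) v) x' ∂ρ (a + n + 1) ∂μ := by
      have h1 : Measurable fun p : (𝓧 × (ℤ → 𝓞) × 𝓧) × 𝓧 => ∫⁻ v,
          ENNReal.ofReal (q p.1.2.2 p.2 * e (a + n + 1) v p.2) *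
          F p.1.1 (Function.update p.1.2.1 (a + n + 1) v) p.2 ∂ρ (a + n + 1) :=
        Measurable.lintegral_prod_right' (f := fun p : ((𝓧 × (ℤ → 𝓞) × 𝓧) × 𝓧) × 𝓞 =>
          ENNReal.ofReal (q p.1.1.2.2 p.1.2 * e (a + n + 1) p.2 p.1.2) *
          F p.1.1.1 (Function.update p.1.1.2.1 (a + n + 1) p.2) p.1.2)
          (hFu.comp (measurable_fst.fst.prodMk (measurable_fst.snd.prodMk measurable_snd)))
      exact h1.lintegral_prod_right'
    rw [ih (F := fun x u y => ∫⁻ x', ∫⁻ v, ENNReal.ofReal (q y x' * e (a + n + 1) v x') *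
        F x (Function.update u (a + n + 1) v) x' ∂ρ (a + n + 1) ∂μ) hF₁]
    · refine lintegral_congr fun ω => ?_
      have hset : Finset.Ioc a (a + n + 1) = insert (a + n + 1) (Finset.Ioc a (a + n)) := by
        ext j; simp only [Finset.mem_Ioc, Finset.mem_insert]; lia
      have hFω : Measurable fun p : (ℤ → 𝓞) × 𝓧 => F (X ω a) p.1 p.2 :=
        hF.comp (measurable_const.prodMk measurable_id)
      have hmeas : Measurable fun u : ℤ → 𝓞 =>
          ltransfer μ q (fun k => e k (u k)) (n + 1) a (F (X ω a) u) (X ω a) := (measurable_ltransfer (μ := μ) hq (h := fun (u : ℤ → 𝓞) k => e k (u k))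
        H.measurable_likelihood (f := fun u => F (X ω a) u) hFω (n + 1) a).comp
        (measurable_id.prodMk (measurable_const (a := X ω a)))
      rw [hset, lmarginal_insert' _ hmeas (by simp)]
      congr 1
      ext u
      have h2 : ∀ v, ltransfer μ q (fun k => e k (Function.update u (a + n + 1) v k)) (n + 1) a
          (F (X ω a) (Function.update u (a + n + 1) v)) (X ω a) =
          ltransfer μ q (fun k => e k (u k)) n a (fun y => ∫⁻ x',
            ENNReal.ofReal (q y x' * e (a + n + 1) v x') *
            F (X ω a) (Function.update u (a + n + 1) v) x' ∂μ) (X ω a) := by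
        intro v
        rw [ltransfer_succ_right q _ n rfl]
        simp only [Function.update_self]
        refine ltransfer_congr (fun k hk hk' => ?_) _ _
        rw [Function.update_of_ne (by lia)]
      simp_rw [h2]
      have hF₂ : Measurable fun p : (𝓞 × 𝓧) × 𝓧 =>
          ENNReal.ofReal (q p.1.2 p.2 * e (a + n + 1) p.1.1 p.2) *
          F (X ω a) (Function.update u (a + n + 1) p.1.1) p.2 :=
        hFu.comp ((measurable_const.prodMk (measurable_const.prodMk measurable_fst.snd)).prodMk
          (measurable_snd.prodMk measurable_fst.fst))
      rw [lintegral_ltransfer hq (fun k => (H.regular u).measurable_h k)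
        (f := fun v y => ∫⁻ x', ENNReal.ofReal (q y x' * e (a + n + 1) v x') *
          F (X ω a) (Function.update u (a + n + 1) v) x' ∂μ) hF₂.lintegral_prod_right']
      congr 1
      ext y
      exact lintegral_lintegral_swap (f := fun x' v =>
        ENNReal.ofReal (q y x' * e (a + n + 1) v x') *
          F (X ω a) (Function.update u (a + n + 1) v) x')
        (hF₂.comp ((measurable_snd.prodMk measurable_const).prodMk measurable_fst)).aemeasurable
    · intro x u u' y huu
      refine lintegral_congr fun x' => lintegral_congr fun v => ?_
      rw [hdep x (Function.update u (a + n + 1) v) (Function.update u' (a + n + 1) v) x']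
      intro j h1 h2
      rcases eq_or_ne j (a + n + 1) with rfl | hj
      · simp
      · rw [Function.update_of_ne hj, Function.update_of_ne hj]
        exact huu j h1 (by lia)

lemma lintegral_window_lik [Nonempty 𝓞] (hX : IsObservedChain μ q e ρ P X U)
    (H : RegularEmission μ q e ρ c C) (u₀ : ℤ → 𝓞) (n : ℕ) (a : ℤ)
    {F : 𝓧 → (ℤ → 𝓞) → ℝ≥0∞} (hF : Measurable (Function.uncurry F))
    (hdep : ∀ x u u', (∀ j, a < j → j ≤ a + n → u j = u' j) → F x u = F x u') :
    ∫⁻ ω, F (X ω a) (U ω) ∂P =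
      ∫⁻ ω, (∫⋯∫⁻_Finset.Ioc a (a + n), (fun u =>
        ENNReal.ofReal (lik q μ (fun k => e k (u k)) n a (X ω a)) * F (X ω a) u) ∂ρ) u₀ ∂P := by
  rw [hX.lintegral_window H u₀ n a (F := fun x u _ => F x u)
    (hF.comp (measurable_fst.prodMk measurable_snd.fst)) fun x u u' _ h => hdep x u u' h]
  simp_rw [fun u => (H.regular u).ltransfer_const]

/-- Resampling the observation at time `t` from its conditional density given the initial state
and the other observations in the window. -/
lemma lintegral_resample [Nonempty 𝓞] (hX : IsObservedChain μ q e ρ P X U)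
    (H : RegularEmission μ q e ρ c C) {t : ℤ} {n : ℕ} {a : ℤ} (hat : a < t) (htn : t ≤ a + n)
    {F : 𝓧 → (ℤ → 𝓞) → ℝ≥0∞} (hF : Measurable (Function.uncurry F))
    (hdep : ∀ x u u', (∀ j, a < j → j ≤ a + n → u j = u' j) → F x u = F x u') :
    ∫⁻ ω, F (X ω a) (U ω) ∂P = ∫⁻ ω, ∫⁻ v, ENNReal.ofReal
      (condLik q μ (fun k => e k (Function.update (U ω) t v k)) t n a (X ω a)) *
        F (X ω a) (Function.update (U ω) t v) ∂ρ t ∂P := by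
  let u₀ : ℤ → 𝓞 := fun _ => Classical.arbitrary 𝓞
  have hlik := H.measurable_lik n a
  have hcond := H.measurable_condLik t n a
  have hF₁ : Measurable fun p : (𝓧 × (ℤ → 𝓞)) × 𝓞 => ENNReal.ofReal
      (condLik q μ (fun k => e k (Function.update p.1.2 t p.2 k)) t n a p.1.1) *
        F p.1.1 (Function.update p.1.2 t p.2) := by
    have hup : Measurable fun p : (𝓧 × (ℤ → 𝓞)) × 𝓞 => Function.update p.1.2 t p.2 :=
      measurable_update'.comp (measurable_fst.snd.prodMk measurable_snd)
    exact (hcond.comp (hup.prodMk measurable_fst.fst)).ennreal_ofReal.mul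
      (hF.comp (measurable_fst.fst.prodMk hup))
  have hF₂ : Measurable (Function.uncurry fun (x : 𝓧) (u : ℤ → 𝓞) => ∫⁻ v, ENNReal.ofReal
      (condLik q μ (fun k => e k (Function.update u t v k)) t n a x) *
        F x (Function.update u t v) ∂ρ t) := hF₁.lintegral_prod_right'
  rw [hX.lintegral_window_lik H u₀ n a hF hdep,
    hX.lintegral_window_lik H u₀ n a (F := fun x u => ∫⁻ v, ENNReal.ofReal
      (condLik q μ (fun k => e k (Function.update u t v k)) t n a x) *
        F x (Function.update u t v) ∂ρ t) hF₂ ?_]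
  · refine lintegral_congr fun ω => ?_
    have hl : Measurable fun u : ℤ → 𝓞 =>
        ENNReal.ofReal (lik q μ (fun k => e k (u k)) n a (X ω a)) :=
      (hlik.comp (measurable_id.prodMk measurable_const)).ennreal_ofReal
    have hFω : Measurable fun u : ℤ → 𝓞 => F (X ω a) u :=
      hF.comp (measurable_const.prodMk measurable_id)
    have hFω₂ : Measurable fun u : ℤ → 𝓞 => ∫⁻ v, ENNReal.ofReal
        (condLik q μ (fun k => e k (Function.update u t v k)) t n a (X ω a)) *
          F (X ω a) (Function.update u t v) ∂ρ t :=
      hF₂.comp (measurable_const.prodMk measurable_id)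
    -- It suffices to integrate over coordinate `t` alone. There the resampled term is constant;
    -- integrating the likelihood leaves that of the other observations, whose product with
    -- `condLik` is the likelihood again.
    refine congrFun (lmarginal_eq_of_subset (s := {t}) (by simp; lia)
      (hl.mul hFω) (hl.mul hFω₂) ?_) u₀
    rw [lmarginal_singleton, lmarginal_singleton]
    ext u
    simp only [Pi.mul_apply, Function.update_idem]
    have hlu : Measurable fun v => ENNReal.ofReal
        (lik q μ (fun k => e k (Function.update u t v k)) n a (X ω a)) :=
      hl.comp (measurable_update u)
    have hFu : Measurable fun v => ENNReal.ofReal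
        (condLik q μ (fun k => e k (Function.update u t v k)) t n a (X ω a)) *
          F (X ω a) (Function.update u t v) :=
      (hcond.comp ((measurable_update u).prodMk measurable_const)).ennreal_ofReal.mul
        (hFω.comp (measurable_update u))
    conv_rhs => rw [lintegral_mul_const _ hlu, H.lintegral_lik_update hat htn,
      ← lintegral_const_mul _ hFu]
    refine lintegral_congr fun v => ?_
    have h0 := ((H.regular u).update_one t).lik_pos n a (X ω a)
    rw [← mul_assoc, ← ENNReal.ofReal_mul h0.le]
    congr 2
    unfold condLik
    rw [RegularEmission.update_likelihood_update]
    field_simp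
  · intro x u u' huu
    have hup : ∀ v, ∀ j, a < j → j ≤ a + n → Function.update u t v j = Function.update u' t v j := by
      intro v j h1 h2
      rcases eq_or_ne j t with rfl | hj
      · simp
      · rw [Function.update_of_ne hj, Function.update_of_ne hj]
        exact huu j h1 h2
    refine lintegral_congr fun v => ?_
    rw [hdep x _ _ (hup v)]
    congr 2
    unfold condLik
    congr 1
    · exact lik_congr (fun k h1 h2 => by rw [hup v k h1 h2]) x
    · refine lik_congr (fun k h1 h2 => ?_) x
      rcases eq_or_ne k t with rfl | hk
      · simp
      · simp only [Function.update_of_ne hk, huu k h1 h2]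

end IsObservedChain

end Law

/-! ### Resampling one observation: bounded real functions -/

section Resampling

variable {𝓧 𝓞 : Type*} [MeasurableSpace 𝓧] [MeasurableSpace 𝓞] {μ : Measure 𝓧} [IsFiniteMeasure μ]
  {ρ : ℤ → Measure 𝓞} [∀ k, IsFiniteMeasure (ρ k)] {c C : ℝ}
  {Ω : Type*} [MeasurableSpace Ω] {P : Measure Ω} [IsProbabilityMeasure P]
  {X : Ω → ℤ → 𝓧} {U : Ω → ℤ → 𝓞}

lemma RegularHMM.condLik_le {q : 𝓧 → 𝓧 → ℝ} {h : ℤ → 𝓧 → ℝ} (H : RegularHMM μ q h c C) (t : ℤ)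
    (n : ℕ) (a : ℤ) (x : 𝓧) : condLik q μ h t n a x ≤ C ^ n / c ^ n := by
  have hc := H.c_pos
  have hC := H.C_pos
  exact div_le_div₀ (by positivity) (H.lik_mem n a x).2 (by positivity)
    ((H.update_one t).lik_mem n a x).1

lemma condLik_congr {q : 𝓧 → 𝓧 → ℝ} {h h' : ℤ → 𝓧 → ℝ} {n : ℕ} {a : ℤ} (t : ℤ)
    (hh : ∀ k, a < k → k ≤ a + n → h k = h' k) (x : 𝓧) :
    condLik q μ h t n a x = condLik q μ h' t n a x := by
  unfold condLik
  rw [lik_congr hh, lik_congr (h := Function.update h t fun _ => 1)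
    (h' := Function.update h' t fun _ => 1)]
  intro k h1 h2
  rcases eq_or_ne k t with rfl | hk
  · simp
  · simp only [Function.update_of_ne hk, hh k h1 h2]

variable {q : 𝓧 → 𝓧 → ℝ} {e : ℤ → 𝓞 → 𝓧 → ℝ}

lemma RegularEmission.integrable_condLik_update [Nonempty 𝓞] (H : RegularEmission μ q e ρ c C)
    (t : ℤ) (n : ℕ) (a : ℤ) (u : ℤ → 𝓞) (x : 𝓧) :
    Integrable (fun v => condLik q μ (fun k => e k (Function.update u t v k)) t n a x) (ρ t) := by
  refine Integrable.of_bound (C := C ^ n / c ^ n) ?_ (Eventually.of_forall fun v => ?_)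
  · exact ((H.measurable_condLik t n a).comp
      ((measurable_update u).prodMk measurable_const)).aestronglyMeasurable
  · have R := H.regular (Function.update u t v)
    rw [Real.norm_of_nonneg (R.condLik_pos t n a x).le]
    exact R.condLik_le t n a x

lemma RegularEmission.integral_condLik_update [Nonempty 𝓞] (H : RegularEmission μ q e ρ c C)
    {t : ℤ} {n : ℕ} {a : ℤ} (hat : a < t) (htn : t ≤ a + n) (u : ℤ → 𝓞) (x : 𝓧) :
    ∫ v, condLik q μ (fun k => e k (Function.update u t v k)) t n a x ∂ρ t = 1 := by
  have h1 := ofReal_integral_eq_lintegral_ofReal (H.integrable_condLik_update t n a u x)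
    (Eventually.of_forall fun v => ((H.regular (Function.update u t v)).condLik_pos t n a x).le)
  rw [H.lintegral_condLik_update hat htn] at h1
  exact ENNReal.ofReal_eq_one.1 h1

/-- Resampling, for bounded functions. -/
lemma IsObservedChain.integral_resample [Nonempty 𝓞] (hX : IsObservedChain μ q e ρ P X U)
    (H : RegularEmission μ q e ρ c C) {t : ℤ} {n : ℕ} {a : ℤ} (hat : a < t) (htn : t ≤ a + n)
    {F : 𝓧 → (ℤ → 𝓞) → ℝ} (hF : Measurable (Function.uncurry F)) {K : ℝ}
    (hK : ∀ x u, |F x u| ≤ K)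
    (hdep : ∀ x u u', (∀ j, a < j → j ≤ a + n → u j = u' j) → F x u = F x u') :
    ∫ ω, F (X ω a) (U ω) ∂P = ∫ ω, ∫ v,
      condLik q μ (fun k => e k (Function.update (U ω) t v k)) t n a (X ω a) *
        F (X ω a) (Function.update (U ω) t v) ∂ρ t ∂P := by
  set W : 𝓧 → (ℤ → 𝓞) → ℝ := fun x u => condLik q μ (fun k => e k (u k)) t n a x with hW
  have hWm : Measurable (Function.uncurry W) :=
    (H.measurable_condLik t n a).comp measurable_swap
  have hW0 : ∀ x u, 0 < W x u := fun x u => (H.regular u).condLik_pos t n a x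
  have hWi : ∀ x u, Integrable (fun v => W x (Function.update u t v)) (ρ t) :=
    fun x u => H.integrable_condLik_update t n a u x
  have hW1 : ∀ x u, ∫ v, W x (Function.update u t v) ∂ρ t = 1 :=
    fun x u => H.integral_condLik_update hat htn u x
  have hupF : ∀ x u, Measurable fun v => F x (Function.update u t v) := fun x u =>
    hF.comp (measurable_const.prodMk (measurable_update u))
  have hWF : ∀ x u, Integrable (fun v => W x (Function.update u t v) *
      F x (Function.update u t v)) (ρ t) := fun x u =>
    (hWi x u).mul_bdd (c := K) (hupF x u).aestronglyMeasurable (Eventually.of_forall fun v => hK _ _)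
  set I : Ω → ℝ := fun ω => ∫ v, W (X ω a) (Function.update (U ω) t v) *
    F (X ω a) (Function.update (U ω) t v) ∂ρ t with hI
  have hIm : Measurable I := by
    have h1 : Measurable fun p : Ω × 𝓞 => (X p.1 a, Function.update (U p.1) t p.2) :=
      ((hX.measurable_X a).comp measurable_fst).prodMk
        (measurable_update'.comp ((hX.measurable_U.comp measurable_fst).prodMk measurable_snd))
    exact (((hWm.comp h1).mul (hF.comp h1)).stronglyMeasurable.integral_prod_right).measurable
  have hIK : ∀ ω, |I ω| ≤ K := by
    intro ω
    calc |I ω| ≤ ∫ v, |W (X ω a) (Function.update (U ω) t v) *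
          F (X ω a) (Function.update (U ω) t v)| ∂ρ t := abs_integral_le_integral_abs
      _ ≤ ∫ v, W (X ω a) (Function.update (U ω) t v) * K ∂ρ t := by
          refine integral_mono (hWF _ _).abs ((hWi _ _).mul_const K) fun v => ?_
          dsimp only
          rw [abs_mul, abs_of_pos (hW0 _ _)]
          exact mul_le_mul_of_nonneg_left (hK _ _) (hW0 _ _).le
      _ = K := by rw [integral_mul_const, hW1, one_mul]
  have hFm : Measurable fun ω => F (X ω a) (U ω) :=
    hF.comp ((hX.measurable_X a).prodMk hX.measurable_U)
  have hFi : Integrable (fun ω => F (X ω a) (U ω)) P :=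
    .of_bound hFm.aestronglyMeasurable K (Eventually.of_forall fun ω => hK _ _)
  have hIi : Integrable I P :=
    .of_bound hIm.aestronglyMeasurable K (Eventually.of_forall hIK)
  -- Adding `K` makes the function nonnegative; since the conditional density integrates to `1`,
  -- both sides increase by the same constant.
  have key := hX.lintegral_resample H hat htn (F := fun x u => ENNReal.ofReal (F x u + K))
    (hF.add measurable_const).ennreal_ofReal (fun x u u' h => by rw [hdep x u u' h])
  have hinner : ∀ ω, ∫⁻ v, ENNReal.ofReal
      (condLik q μ (fun k => e k (Function.update (U ω) t v k)) t n a (X ω a)) *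
        ENNReal.ofReal (F (X ω a) (Function.update (U ω) t v) + K) ∂ρ t =
      ENNReal.ofReal (I ω + K) := by
    intro ω
    have e1 : I ω + K = ∫ v, W (X ω a) (Function.update (U ω) t v) *
        (F (X ω a) (Function.update (U ω) t v) + K) ∂ρ t := by
      simp only [mul_add]
      rw [integral_add (hWF _ _) ((hWi _ _).mul_const K), integral_mul_const, hW1, one_mul]
    have hFK : ∀ v, 0 ≤ F (X ω a) (Function.update (U ω) t v) + K := fun v => by
      have := (abs_le.1 (hK (X ω a) (Function.update (U ω) t v))).1
      linarith
    rw [e1, ofReal_integral_eq_lintegral_ofReal]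
    · refine lintegral_congr fun v => ?_
      rw [ENNReal.ofReal_mul (hW0 _ _).le]
    · simp only [mul_add]
      exact (hWF _ _).add ((hWi _ _).mul_const K)
    · exact Eventually.of_forall fun v => mul_nonneg (hW0 _ _).le (hFK v)
  simp_rw [hinner] at key
  have hK0 : ∀ ω, 0 ≤ F (X ω a) (U ω) + K := fun ω => by
    have := (abs_le.1 (hK (X ω a) (U ω))).1
    linarith
  have hI0 : ∀ ω, 0 ≤ I ω + K := fun ω => by
    have := (abs_le.1 (hIK ω)).1
    linarith
  rw [← ofReal_integral_eq_lintegral_ofReal (hFi.fun_add (integrable_const K))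
      (Eventually.of_forall hK0),
    ← ofReal_integral_eq_lintegral_ofReal (hIi.fun_add (integrable_const K))
      (Eventually.of_forall hI0),
    ENNReal.ofReal_eq_ofReal_iff (integral_nonneg hK0) (integral_nonneg hI0),
    integral_add hFi (integrable_const K), integral_add hIi (integrable_const K)] at key
  linarith

end Resampling

/-! ### Scores of windows and the chain rule for their information -/

section Scores

variable {E : Type*} [NormedAddCommGroup E] [NormedSpace ℝ E] [FiniteDimensional ℝ E]
  {𝓧 𝓞 : Type*} [MeasurableSpace 𝓧] [MeasurableSpace 𝓞] {μ : Measure 𝓧} [IsFiniteMeasure μ]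
  {ρ : ℤ → Measure 𝓞} [∀ k, IsFiniteMeasure (ρ k)] {c C S : ℝ}

/-- A parametric family of observed Markov chains satisfying the standing assumptions: bounds for
parameters in `Θ`, differentiability for parameters in `G`. -/
structure RegularModel (μ : Measure 𝓧) (q : E → 𝓧 → 𝓧 → ℝ) (e : E → ℤ → 𝓞 → 𝓧 → ℝ)
    (ρ : ℤ → Measure 𝓞) (c C S : ℝ) (Θ G : Set E) : Prop where
  emission : ∀ θ ∈ Θ, RegularEmission μ (q θ) (e θ) ρ c C
  family : ∀ u : ℤ → 𝓞, RegularFamily μ q (fun θ k => e θ k (u k)) c C S G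
  subset : G ⊆ Θ

variable {q : E → 𝓧 → 𝓧 → ℝ} {e : E → ℤ → 𝓞 → 𝓧 → ℝ} {Θ G : Set E}

open RegularFamily

namespace RegularModel

lemma isOpen [Nonempty 𝓞] (H : RegularModel μ q e ρ c C S Θ G) : IsOpen G :=
  (H.family fun _ => Classical.arbitrary 𝓞).isOpen

lemma S_nonneg [Nonempty 𝓞] (H : RegularModel μ q e ρ c C S Θ G) : 0 ≤ S :=
  (H.family fun _ => Classical.arbitrary 𝓞).S_nonneg

/-- The score of the observation at time `t` given the other observations in a window. -/
def windowScore (μ : Measure 𝓧) (q : E → 𝓧 → 𝓧 → ℝ) (e : E → ℤ → 𝓞 → 𝓧 → ℝ) (θ : E) (t : ℤ)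
    (n : ℕ) (a : ℤ) (x : 𝓧) (u : ℤ → 𝓞) : E →L[ℝ] ℝ :=
  condScore μ q (fun ϑ k => e ϑ k (u k)) t θ n a x

/-- The score of the observations in a window, except the one at time `t`. -/
def restScore (μ : Measure 𝓧) (q : E → 𝓧 → 𝓧 → ℝ) (e : E → ℤ → 𝓞 → 𝓧 → ℝ) (θ : E) (t : ℤ)
    (n : ℕ) (a : ℤ) (x : 𝓧) (u : ℤ → 𝓞) : E →L[ℝ] ℝ :=
  logLikDeriv μ q (fun ϑ => Function.update (fun k => e ϑ k (u k)) t fun _ => 1) θ n a x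

/-- The score of all the observations in a window. -/
def fullScore (μ : Measure 𝓧) (q : E → 𝓧 → 𝓧 → ℝ) (e : E → ℤ → 𝓞 → 𝓧 → ℝ) (θ : E)
    (n : ℕ) (a : ℤ) (x : 𝓧) (u : ℤ → 𝓞) : E →L[ℝ] ℝ :=
  logLikDeriv μ q (fun ϑ k => e ϑ k (u k)) θ n a x

lemma fullScore_eq (H : RegularModel μ q e ρ c C S Θ G) {θ : E} (hθ : θ ∈ G) (t : ℤ) (n : ℕ)
    (a : ℤ) (x : 𝓧) (u : ℤ → 𝓞) :
    fullScore μ q e θ n a x u = restScore μ q e θ t n a x u + windowScore μ q e θ t n a x u := by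
  unfold fullScore restScore windowScore
  rw [(H.family u).condScore_eq t hθ]
  abel

lemma norm_restScore_le (H : RegularModel μ q e ρ c C S Θ G) {θ : E} (hθ : θ ∈ G) (t : ℤ) (n : ℕ)
    (a : ℤ) (x : 𝓧) (u : ℤ → 𝓞) : ‖restScore μ q e θ t n a x u‖ ≤ n * (2 * S) :=
  ((H.family u).update_one t).norm_logLikDeriv_le hθ n a x

lemma norm_fullScore_le (H : RegularModel μ q e ρ c C S Θ G) {θ : E} (hθ : θ ∈ G) (n : ℕ)
    (a : ℤ) (x : 𝓧) (u : ℤ → 𝓞) : ‖fullScore μ q e θ n a x u‖ ≤ n * (2 * S) :=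
  (H.family u).norm_logLikDeriv_le hθ n a x

lemma norm_windowScore_le (H : RegularModel μ q e ρ c C S Θ G) {θ : E} (hθ : θ ∈ G) (t : ℤ) (n : ℕ)
    (a : ℤ) (x : 𝓧) (u : ℤ → 𝓞) : ‖windowScore μ q e θ t n a x u‖ ≤ 2 * (n * (2 * S)) := by
  have h1 := H.norm_restScore_le hθ t n a x u
  have h2 := H.norm_fullScore_le hθ n a x u
  rw [H.fullScore_eq hθ t] at h2
  have h3 : windowScore μ q e θ t n a x u = (restScore μ q e θ t n a x u +
    windowScore μ q e θ t n a x u) - restScore μ q e θ t n a x u := by abel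
  rw [h3]
  refine (norm_sub_le _ _).trans ?_
  linarith

lemma measurable_restScore [Nonempty 𝓞] (H : RegularModel μ q e ρ c C S Θ G) {θ : E} (hθ : θ ∈ G)
    (t : ℤ) (n : ℕ) (a : ℤ) (d : E) :
    Measurable fun p : 𝓧 × (ℤ → 𝓞) => restScore μ q e θ t n a p.1 p.2 d := by
  refine measurable_fderiv_apply_of_eventually (F := fun ϑ (p : 𝓧 × (ℤ → 𝓞)) =>
    Real.log (lik (q ϑ) μ (Function.update (fun k => e ϑ k (p.2 k)) t fun _ => 1) n a p.1))
    (fun p => ?_) ?_ d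
  · have H' := (H.family p.2).update_one t
    exact (H'.lik_logDiffOn n a p.1 θ hθ).1.log ((H'.regular θ hθ).lik_pos n a p.1).ne'
  · filter_upwards [H.isOpen.mem_nhds hθ] with ϑ hϑ using Real.measurable_log.comp
      (((H.emission ϑ (H.subset hϑ)).measurable_lik_update t n a).comp measurable_swap)

lemma measurable_windowScore [Nonempty 𝓞] (H : RegularModel μ q e ρ c C S Θ G) {θ : E}
    (hθ : θ ∈ G) (t : ℤ) (n : ℕ) (a : ℤ) (d : E) :
    Measurable fun p : 𝓧 × (ℤ → 𝓞) => windowScore μ q e θ t n a p.1 p.2 d := by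
  refine measurable_fderiv_apply_of_eventually (F := fun ϑ (p : 𝓧 × (ℤ → 𝓞)) =>
    Real.log (condLik (q ϑ) μ (fun k => e ϑ k (p.2 k)) t n a p.1))
    (fun p => ((H.family p.2).hasFDerivAt_log_condLik t hθ n a p.1).differentiableAt) ?_ d
  filter_upwards [H.isOpen.mem_nhds hθ] with ϑ hϑ using Real.measurable_log.comp
      (((H.emission ϑ (H.subset hϑ)).measurable_condLik t n a).comp measurable_swap)

/-- Obtained by exponentiating the differentiable logarithm. It allows the identity `∫ condLik = 1`
to be differentiated under the integral. -/
lemma condLik_logDiffOn (H : RegularModel μ q e ρ c C S Θ G) (t : ℤ) (n : ℕ) (a : ℤ) (x : 𝓧)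
    (u : ℤ → 𝓞) :
    LogDiffOn (2 * (n * (2 * S))) G (fun θ => condLik (q θ) μ (fun k => e θ k (u k)) t n a x) := by
  intro θ hθ
  have h1 := (H.family u).hasFDerivAt_log_condLik t hθ n a x
  have h0 := ((H.family u).regular θ hθ).condLik_pos t n a x
  have h2 : HasFDerivAt (fun θ => condLik (q θ) μ (fun k => e θ k (u k)) t n a x)
      (condLik (q θ) μ (fun k => e θ k (u k)) t n a x • windowScore μ q e θ t n a x u) θ := by
    have h3 := h1.exp
    rw [Real.exp_log h0, ← (H.family u).condScore_eq t hθ] at h3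
    refine h3.congr_of_eventuallyEq ?_
    filter_upwards [(H.family u).isOpen.mem_nhds hθ] with ϑ hϑ
    exact (Real.exp_log (((H.family u).regular ϑ hϑ).condLik_pos t n a x)).symm
  refine ⟨h2.differentiableAt, ?_⟩
  rw [h2.fderiv, norm_smul, Real.norm_of_nonneg h0.le, mul_comm]
  exact mul_le_mul_of_nonneg_right (H.norm_windowScore_le hθ t n a x u) h0.le

lemma fderiv_condLik (H : RegularModel μ q e ρ c C S Θ G) (t : ℤ) (n : ℕ) (a : ℤ) (x : 𝓧)
    (u : ℤ → 𝓞) {θ : E} (hθ : θ ∈ G) (d : E) :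
    fderiv ℝ (fun θ => condLik (q θ) μ (fun k => e θ k (u k)) t n a x) θ d =
      condLik (q θ) μ (fun k => e θ k (u k)) t n a x * windowScore μ q e θ t n a x u d := by
  have h0 := ((H.family u).regular θ hθ).condLik_pos t n a x
  unfold windowScore condScore
  rw [fderiv.log (H.condLik_logDiffOn t n a x u θ hθ).1 h0.ne', smul_apply, smul_eq_mul,
    mul_inv_cancel_left₀ h0.ne']

/-- The conditional score is centred. -/
lemma integral_condLik_mul_windowScore [Nonempty 𝓞] (H : RegularModel μ q e ρ c C S Θ G) {t : ℤ}
    {n : ℕ} {a : ℤ} (hat : a < t) (htn : t ≤ a + n) (x : 𝓧) (u : ℤ → 𝓞) {θ : E} (hθ : θ ∈ G)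
    (d : E) :
    ∫ v, condLik (q θ) μ (fun k => e θ k (Function.update u t v k)) t n a x *
      windowScore μ q e θ t n a x (Function.update u t v) d ∂ρ t = 0 := by
  simp_rw [← H.fderiv_condLik t n a x _ hθ d]
  -- The integral becomes the derivative of the total mass of the conditional density, which is `1`
  -- near `θ`.
  rw [← LogDiffOn.fderiv_integral_apply (μ := ρ t) (b := C ^ n / c ^ n) H.isOpen
    (F := fun ϑ v => condLik (q ϑ) μ (fun k => e ϑ k (Function.update u t v k)) t n a x)
    (fun v => H.condLik_logDiffOn t n a x (Function.update u t v)) (fun ϑ hϑ => ?_)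
    (fun ϑ hϑ v => ?_) hθ d]
  · have : (fun ϑ => ∫ v, condLik (q ϑ) μ (fun k => e ϑ k (Function.update u t v k)) t n a x ∂ρ t)
        =ᶠ[𝓝 θ] fun _ => 1 := by
      filter_upwards [H.isOpen.mem_nhds hθ] with ϑ hϑ using
        (H.emission ϑ (H.subset hϑ)).integral_condLik_update hat htn u x
    rw [this.fderiv_eq]
    simp
  · exact ((H.emission ϑ (H.subset hϑ)).measurable_condLik t n a).comp
      ((measurable_update u).prodMk measurable_const)
  · have R := (H.emission ϑ (H.subset hϑ)).regular (Function.update u t v)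
    rw [abs_of_pos (R.condLik_pos t n a x)]
    exact R.condLik_le t n a x

lemma logLikDeriv_congr {h h' : E → ℤ → 𝓧 → ℝ} {n : ℕ} {a : ℤ} (θ : E)
    (hh : ∀ ϑ k, a < k → k ≤ a + n → h ϑ k = h' ϑ k) (x : 𝓧) :
    logLikDeriv μ q h θ n a x = logLikDeriv μ q h' θ n a x := by
  unfold logLikDeriv
  congr 1
  ext ϑ
  rw [lik_congr (hh ϑ)]

lemma restScore_congr {θ : E} {t : ℤ} {n : ℕ} {a : ℤ} {x : 𝓧} {u u' : ℤ → 𝓞}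
    (huu : ∀ j, a < j → j ≤ a + n → j ≠ t → u j = u' j) :
    restScore μ q e θ t n a x u = restScore μ q e θ t n a x u' := by
  refine logLikDeriv_congr θ (fun ϑ k h1 h2 => ?_) x
  rcases eq_or_ne k t with rfl | hk
  · simp
  · simp only [Function.update_of_ne hk, huu k h1 h2 hk]

lemma windowScore_congr {θ : E} {t : ℤ} {n : ℕ} {a : ℤ} {x : 𝓧} {u u' : ℤ → 𝓞}
    (huu : ∀ j, a < j → j ≤ a + n → u j = u' j) :
    windowScore μ q e θ t n a x u = windowScore μ q e θ t n a x u' := by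
  unfold windowScore condScore
  congr 1
  ext ϑ
  rw [condLik_congr t (h' := fun k => e ϑ k (u' k)) (fun k h1 h2 => by simp only [huu k h1 h2])]

variable {Ω : Type*} [MeasurableSpace Ω] {P : Measure Ω} [IsProbabilityMeasure P]
  {X : Ω → ℤ → 𝓧} {U : Ω → ℤ → 𝓞}

/-- The conditional score is uncorrelated with the score of the other observations. -/
lemma integral_restScore_mul_windowScore [Nonempty 𝓞] (H : RegularModel μ q e ρ c C S Θ G) {θ : E}
    (hθ : θ ∈ G) (hX : IsObservedChain μ (q θ) (e θ) ρ P X U) {t : ℤ} {n : ℕ} {a : ℤ}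
    (hat : a < t) (htn : t ≤ a + n) (d d' : E) :
    ∫ ω, restScore μ q e θ t n a (X ω a) (U ω) d *
      windowScore μ q e θ t n a (X ω a) (U ω) d' ∂P = 0 := by
  have hS := H.S_nonneg
  -- The observation at time `t` is redrawn given the initial state and the rest: `restScore` does
  -- not see it and comes out of the inner integral, which then vanishes.
  rw [hX.integral_resample (H.emission θ (H.subset hθ)) hat htn
    (F := fun x u => restScore μ q e θ t n a x u d * windowScore μ q e θ t n a x u d')
    ((H.measurable_restScore hθ t n a d).mul (H.measurable_windowScore hθ t n a d'))
    (K := n * (2 * S) * ‖d‖ * (2 * (n * (2 * S)) * ‖d'‖)) (fun x u => ?_)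
    (fun x u u' huu => by
      rw [restScore_congr fun j h1 h2 _ => huu j h1 h2, windowScore_congr huu])]
  · have h1 : ∀ ω v, restScore μ q e θ t n a (X ω a) (Function.update (U ω) t v) d =
        restScore μ q e θ t n a (X ω a) (U ω) d := fun ω v => by
      rw [restScore_congr fun j _ _ hj => Function.update_of_ne hj _ _]
    simp_rw [h1, mul_left_comm, integral_const_mul,
      H.integral_condLik_mul_windowScore hat htn _ _ hθ d', mul_zero, integral_zero]
  · rw [abs_mul]
    refine mul_le_mul ?_ ?_ (abs_nonneg _) (by positivity)
    · exact ((restScore μ q e θ t n a x u).le_opNorm d).trans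
        (mul_le_mul_of_nonneg_right (H.norm_restScore_le hθ t n a x u) (norm_nonneg _))
    · exact ((windowScore μ q e θ t n a x u).le_opNorm d').trans
        (mul_le_mul_of_nonneg_right (H.norm_windowScore_le hθ t n a x u) (norm_nonneg _))

lemma integrable_mul_of_norm_le {A B : Ω → E →L[ℝ] ℝ} {K K' : ℝ} (d d' : E)
    (hA : Measurable fun ω => A ω d) (hB : Measurable fun ω => B ω d')
    (hAK : ∀ ω, ‖A ω‖ ≤ K) (hBK : ∀ ω, ‖B ω‖ ≤ K') :
    Integrable (fun ω => A ω d * B ω d') P := by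
  refine Integrable.of_bound (hA.mul hB).aestronglyMeasurable (K * ‖d‖ * (K' * ‖d'‖))
    (Eventually.of_forall fun ω => ?_)
  have hK : 0 ≤ K := (norm_nonneg _).trans (hAK ω)
  rw [norm_mul]
  refine mul_le_mul ?_ ?_ (norm_nonneg _) (by positivity)
  · exact ((A ω).le_opNorm d).trans (mul_le_mul_of_nonneg_right (hAK ω) (norm_nonneg _))
  · exact ((B ω).le_opNorm d').trans (mul_le_mul_of_nonneg_right (hBK ω) (norm_nonneg _))

/-- Chain rule for the Fisher information of a window. -/
lemma integral_fullScore_mul_fullScore [Nonempty 𝓞] (H : RegularModel μ q e ρ c C S Θ G) {θ : E}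
    (hθ : θ ∈ G) (hX : IsObservedChain μ (q θ) (e θ) ρ P X U) {t : ℤ} {n : ℕ} {a : ℤ}
    (hat : a < t) (htn : t ≤ a + n) (d d' : E) :
    ∫ ω, fullScore μ q e θ n a (X ω a) (U ω) d * fullScore μ q e θ n a (X ω a) (U ω) d' ∂P =
      ∫ ω, restScore μ q e θ t n a (X ω a) (U ω) d *
        restScore μ q e θ t n a (X ω a) (U ω) d' ∂P +
      ∫ ω, windowScore μ q e θ t n a (X ω a) (U ω) d *
        windowScore μ q e θ t n a (X ω a) (U ω) d' ∂P := by
  have hXU : Measurable fun ω => (X ω a, U ω) := (hX.measurable_X a).prodMk hX.measurable_U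
  have mr : ∀ d, Measurable fun ω => restScore μ q e θ t n a (X ω a) (U ω) d :=
    fun d => (H.measurable_restScore hθ t n a d).comp hXU
  have mw : ∀ d, Measurable fun ω => windowScore μ q e θ t n a (X ω a) (U ω) d :=
    fun d => (H.measurable_windowScore hθ t n a d).comp hXU
  have br : ∀ ω, ‖restScore μ q e θ t n a (X ω a) (U ω)‖ ≤ n * (2 * S) :=
    fun ω => H.norm_restScore_le hθ t n a _ _
  have bw : ∀ ω, ‖windowScore μ q e θ t n a (X ω a) (U ω)‖ ≤ 2 * (n * (2 * S)) :=
    fun ω => H.norm_windowScore_le hθ t n a _ _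
  have i1 := integrable_mul_of_norm_le (P := P) d d' (mr d) (mr d') br br
  have i2 := integrable_mul_of_norm_le (P := P) d d' (mr d) (mw d') br bw
  have i3 := integrable_mul_of_norm_le (P := P) d' d (mr d') (mw d) br bw
  have i4 := integrable_mul_of_norm_le (P := P) d d' (mw d) (mw d') bw bw
  have z1 := H.integral_restScore_mul_windowScore hθ hX hat htn d d'
  have z2 := H.integral_restScore_mul_windowScore hθ hX hat htn d' d
  have : ∀ ω, fullScore μ q e θ n a (X ω a) (U ω) d * fullScore μ q e θ n a (X ω a) (U ω) d' =
      (restScore μ q e θ t n a (X ω a) (U ω) d * restScore μ q e θ t n a (X ω a) (U ω) d' +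
       restScore μ q e θ t n a (X ω a) (U ω) d * windowScore μ q e θ t n a (X ω a) (U ω) d') +
      (restScore μ q e θ t n a (X ω a) (U ω) d' * windowScore μ q e θ t n a (X ω a) (U ω) d +
       windowScore μ q e θ t n a (X ω a) (U ω) d *
        windowScore μ q e θ t n a (X ω a) (U ω) d') := by
    intro ω
    rw [H.fullScore_eq hθ t]
    simp only [add_apply]
    ring
  simp_rw [this]
  rw [integral_add (i1.fun_add i2) (i3.fun_add i4), integral_add i1 i2, integral_add i3 i4, z1, z2]
  ring

end RegularModel

end Scores

/-! ### Conditional densities given infinitely many observations -/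

section CondDensity

variable {𝓧 : Type*} [MeasurableSpace 𝓧] {μ : Measure 𝓧} [IsFiniteMeasure μ] [Nonempty 𝓧]

/-- The conditional density of the observation at time `t` given all the other observations. -/
def condDensity (q : 𝓧 → 𝓧 → ℝ) (μ : Measure 𝓧) (h : ℤ → 𝓧 → ℝ) (t : ℤ) : ℝ :=
  limUnder atTop fun n : ℕ =>
    condLik q μ h t ((n + 1) + (n + 1)) (t - ((n + 1 : ℕ) : ℤ)) (Classical.arbitrary 𝓧)

lemma tendsto_const_mul_pow_succ {B r : ℝ} (hr0 : 0 ≤ r) (hr1 : r < 1) :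
    Tendsto (fun n : ℕ => B * (r ^ (n + 1) + r ^ (n + 1))) atTop (𝓝 0) := by
  have h := (tendsto_pow_atTop_nhds_zero_of_lt_one hr0 hr1).comp (tendsto_add_atTop_nat 1)
  simpa using (h.add h).const_mul B

lemma tendsto_of_abs_log_sub_le {ι : Type*} {l : Filter ι} {W b : ι → ℝ} {p : ℝ}
    (hW : ∀ i, 0 < W i) (hp : 0 < p) (hb : Tendsto b l (𝓝 0))
    (h : ∀ᶠ i in l, |Real.log (W i) - Real.log p| ≤ b i) : Tendsto W l (𝓝 p) := by
  have h1 : Tendsto (fun i => Real.log (W i) - Real.log p) l (𝓝 0) :=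
    squeeze_zero_norm' h hb
  have h2 : Tendsto (fun i => Real.log (W i)) l (𝓝 (Real.log p)) := by
    simpa using h1.add_const (Real.log p)
  have h3 := (Real.continuous_exp.tendsto _).comp h2
  rw [Real.exp_log hp] at h3
  exact h3.congr fun i => Real.exp_log (hW i)

namespace RegularHMM

/-- The logarithms converge by forgetting and the density is the exponential of their limit, hence
positive. The constant is chosen before `q`, `h` and `t`, so the later estimates are uniform in the
observations. -/
lemma exists_condDensity_bound [NeZero μ] {c C : ℝ} (hc : 0 < c) (hc1 : c ≤ 1) (hC1 : 1 ≤ C) :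
    ∃ B : ℝ, 0 ≤ B ∧ ∀ (q : 𝓧 → 𝓧 → ℝ) (h : ℤ → 𝓧 → ℝ), RegularHMM μ q h c C → ∀ t : ℤ,
      0 < condDensity q μ h t ∧ ∀ (n k : ℕ) (x : 𝓧), 1 ≤ n →
        |Real.log (condLik q μ h t (n + k) (t - n) x) - Real.log (condDensity q μ h t)| ≤
          B * (rate c C ^ n + rate c C ^ k) := by
  obtain ⟨B, hB0, hB⟩ := exists_log_condLik_limit (μ := μ) hc hc1 hC1
  refine ⟨B, hB0, fun q h H t => ?_⟩
  obtain ⟨l, hl⟩ := hB q h H t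
  have hr0 := rate_pos hc (hc1.trans hC1)
  have hr1 := rate_lt_one hc (zero_lt_one.trans_le hC1)
  have h1 : condDensity q μ h t = Real.exp l := by
    refine Tendsto.limUnder_eq (tendsto_of_abs_log_sub_le (fun n => H.condLik_pos _ _ _ _)
      (Real.exp_pos l) (tendsto_const_mul_pow_succ (B := B) hr0.le hr1)
      (Eventually.of_forall fun n => ?_))
    rw [Real.log_exp]
    exact hl (n + 1) (n + 1) _ (by lia)
  rw [h1, Real.log_exp]
  exact ⟨Real.exp_pos l, hl⟩

lemma condDensity_pos [NeZero μ] {q : 𝓧 → 𝓧 → ℝ} {h : ℤ → 𝓧 → ℝ} {c C : ℝ}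
    (H : RegularHMM μ q h c C) (t : ℤ) : 0 < condDensity q μ h t := by
  obtain ⟨B, -, hB⟩ := exists_condDensity_bound (μ := μ) H.c_pos H.c_le_one H.one_le_C
  exact (hB q h H t).1

/-- Convergence of the window densities, uniformly in the initial state. -/
lemma tendsto_condLik [NeZero μ] {q : 𝓧 → 𝓧 → ℝ} {h : ℤ → 𝓧 → ℝ} {c C : ℝ}
    (H : RegularHMM μ q h c C) (t : ℤ) :
    Tendsto (fun w : (ℕ × ℕ) × 𝓧 => condLik q μ h t (w.1.1 + w.1.2) (t - w.1.1) w.2)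
      ((atTop ×ˢ atTop) ×ˢ ⊤) (𝓝 (condDensity q μ h t)) := by
  obtain ⟨B, -, hB⟩ := exists_condDensity_bound (μ := μ) H.c_pos H.c_le_one H.one_le_C
  obtain ⟨h0, hlim⟩ := hB q h H t
  have hr0 := rate_pos H.c_pos (H.c_le_one.trans H.one_le_C)
  have hr1 := rate_lt_one H.c_pos H.C_pos
  have hp := tendsto_pow_atTop_nhds_zero_of_lt_one hr0.le hr1
  have hb : Tendsto (fun w : (ℕ × ℕ) × 𝓧 => B * (rate c C ^ w.1.1 + rate c C ^ w.1.2))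
      ((atTop ×ˢ atTop) ×ˢ ⊤) (𝓝 0) := by
    have h1 : Tendsto (fun w : ℕ × ℕ => rate c C ^ w.1) (atTop ×ˢ atTop) (𝓝 0) :=
      hp.comp tendsto_fst
    have h2 : Tendsto (fun w : ℕ × ℕ => rate c C ^ w.2) (atTop ×ˢ atTop) (𝓝 0) :=
      hp.comp tendsto_snd
    have h3 := ((h1.add h2).const_mul B).comp (tendsto_fst (g := (⊤ : Filter 𝓧)))
    simpa [Function.comp_def] using h3
  refine tendsto_of_abs_log_sub_le (fun w => H.condLik_pos _ _ _ _) h0 hb ?_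
  have h1 : ∀ᶠ w : (ℕ × ℕ) × 𝓧 in (atTop ×ˢ atTop) ×ˢ ⊤, 1 ≤ w.1.1 :=
    (tendsto_fst.comp tendsto_fst).eventually (eventually_ge_atTop 1)
  filter_upwards [h1] with w hw using hlim _ _ _ hw

lemma condLik_add_of_one {q : 𝓧 → 𝓧 → ℝ} {h : ℤ → 𝓧 → ℝ} {c C : ℝ} (H : RegularHMM μ q h c C)
    {t : ℤ} (hone : ∀ k, t < k → h k = fun _ => 1) {n : ℕ} {a : ℤ} (hta : t ≤ a + n) (k : ℕ)
    (x : 𝓧) : condLik q μ h t (n + k) a x = condLik q μ h t n a x := by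
  unfold condLik
  rw [H.lik_add_of_one fun j hj _ => hone j (by lia),
    (H.update_one t).lik_add_of_one fun j hj _ => ?_]
  rw [Function.update_of_ne (by lia), hone j (by lia)]

/-- Convergence of the window densities when no observation is made after time `t`. -/
lemma tendsto_condLik_of_one [NeZero μ] {q : 𝓧 → 𝓧 → ℝ} {h : ℤ → 𝓧 → ℝ} {c C : ℝ}
    (H : RegularHMM μ q h c C) {t : ℤ} (hone : ∀ k, t < k → h k = fun _ => 1) :
    Tendsto (fun w : ℕ × 𝓧 => condLik q μ h t (w.1 + 1) (t - 1 - w.1) w.2)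
      (atTop ×ˢ ⊤) (𝓝 (condDensity q μ h t)) := by
  -- Padding the window on the right with `w.1` missing observations does not change the density, so
  -- the one-sided limit is a case of the two-sided one.
  have h1 : Tendsto (fun w : ℕ × 𝓧 => ((w.1 + 1, w.1), w.2)) (atTop ×ˢ ⊤)
      ((atTop ×ˢ atTop) ×ˢ ⊤) :=
    (((tendsto_add_atTop_nat 1).comp tendsto_fst).prodMk tendsto_fst).prodMk tendsto_snd
  refine ((H.tendsto_condLik t).comp h1).congr fun w => ?_
  simp only [Function.comp]
  rw [H.condLik_add_of_one hone (by push_cast; lia)]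
  congr 1
  push_cast; ring

/-- The crude bound `C / c` holds for a window with a single observation. The uniform logarithmic
estimate carries it to every other window: `2 * B` to reach the limit and `2 * B` back. This is the
dominating constant for limits under the integral. -/
lemma exists_condLik_le [NeZero μ] {c C : ℝ} (hc : 0 < c) (hc1 : c ≤ 1) (hC1 : 1 ≤ C) :
    ∃ K : ℝ, 0 ≤ K ∧ ∀ (q : 𝓧 → 𝓧 → ℝ) (h : ℤ → 𝓧 → ℝ), RegularHMM μ q h c C → ∀ t : ℤ,
      condDensity q μ h t ≤ K ∧ ∀ (n k : ℕ) (x : 𝓧), 1 ≤ n →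
        condLik q μ h t (n + k) (t - n) x ≤ K := by
  obtain ⟨B, hB0, hB⟩ := exists_condDensity_bound (μ := μ) hc hc1 hC1
  have hr0 := rate_pos hc (hc1.trans hC1)
  have hr1 := rate_lt_one hc (zero_lt_one.trans_le hC1)
  have hpow : ∀ n : ℕ, rate c C ^ n ≤ 1 := fun n => pow_le_one₀ hr0.le hr1.le
  refine ⟨Real.exp (Real.log (C / c) + 4 * B), (Real.exp_pos _).le, fun q h H t => ?_⟩
  obtain ⟨h0, hl⟩ := hB q h H t
  have hb : ∀ (n k : ℕ) (x : 𝓧), 1 ≤ n → |Real.log (condLik q μ h t (n + k) (t - n) x) -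
      Real.log (condDensity q μ h t)| ≤ 2 * B := fun n k x hn => by
    refine (hl n k x hn).trans ?_
    nlinarith [hpow n, hpow k]
  have hlog : Real.log (condDensity q μ h t) ≤ Real.log (C / c) + 2 * B := by
    have h1 := hb 1 0 (Classical.arbitrary 𝓧) le_rfl
    have h2 := H.condLik_le t (1 + 0) (t - (1 : ℕ)) (Classical.arbitrary 𝓧)
    have h3 := Real.log_le_log (H.condLik_pos _ _ _ _) h2
    simp only [add_zero, pow_one, Nat.cast_one] at h3 h1
    linarith [(abs_le.1 h1).1]
  refine ⟨?_, fun n k x hn => ?_⟩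
  · rw [← Real.log_le_iff_le_exp h0]; linarith
  · rw [← Real.log_le_iff_le_exp (H.condLik_pos _ _ _ _)]
    linarith [(abs_le.1 (hb n k x hn)).2]

end RegularHMM

end CondDensity

/-! ### The limit is the density of the conditional law -/

section CondLaw

variable {𝓧 𝓞 : Type*} [MeasurableSpace 𝓧] [MeasurableSpace 𝓞] {μ : Measure 𝓧} [IsFiniteMeasure μ]
  [NeZero μ] [Nonempty 𝓧] [Nonempty 𝓞]
  {ρ : ℤ → Measure 𝓞} [∀ k, IsFiniteMeasure (ρ k)] {c C : ℝ}
  {q : 𝓧 → 𝓧 → ℝ} {e : ℤ → 𝓞 → 𝓧 → ℝ}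

lemma RegularEmission.tendsto_condLik_seq (H : RegularEmission μ q e ρ c C) (t : ℤ) (u : ℤ → 𝓞)
    (x : ℕ → 𝓧) :
    Tendsto (fun n : ℕ => condLik q μ (fun k => e k (u k)) t (n + n) (t - n) (x n)) atTop
      (𝓝 (condDensity q μ (fun k => e k (u k)) t)) := by
  have h1 : Tendsto (fun n : ℕ => ((n, n), x n)) atTop ((atTop ×ˢ atTop) ×ˢ ⊤) :=
    (tendsto_id.prodMk tendsto_id).prodMk tendsto_top
  exact ((H.regular u).tendsto_condLik t).comp h1

lemma RegularEmission.measurable_condDensity (H : RegularEmission μ q e ρ c C) (t : ℤ) :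
    Measurable fun u : ℤ → 𝓞 => condDensity q μ (fun k => e k (u k)) t := by
  refine measurable_of_tendsto_metrizable (f := fun (n : ℕ) (u : ℤ → 𝓞) =>
    condLik q μ (fun k => e k (u k)) t (n + n) (t - n) (Classical.arbitrary 𝓧)) (fun n => ?_)
    (tendsto_pi_nhds.2 fun u => H.tendsto_condLik_seq t u _)
  exact (H.measurable_condLik t _ _).comp (measurable_id.prodMk measurable_const)

variable {Ω : Type*} [mΩ : MeasurableSpace Ω] {P : Measure Ω} [IsProbabilityMeasure P]
  {X : Ω → ℤ → 𝓧} {U : Ω → ℤ → 𝓞}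

/-- The cylinder is read off the path with the value at `t` overwritten by `o`, so resampling the
observation at `t` leaves it untouched once the window contains the times in `s`. One side of the
resampling identity does not depend on the window; the other converges by dominated convergence. -/
lemma IsObservedChain.integral_cylinder (hX : IsObservedChain μ q e ρ P X U)
    (H : RegularEmission μ q e ρ c C) (t : ℤ) (o : 𝓞) {A : Set 𝓞} (hA : MeasurableSet A)
    (s : Finset ℤ) {T : Set (∀ _ : s, 𝓞)} (hT : MeasurableSet T) :
    ∫ ω in (fun ω => Function.update (U ω) t o) ⁻¹' (s.restrict ⁻¹' T),
        A.indicator (fun _ => (1 : ℝ)) (U ω t) ∂P =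
      ∫ ω in (fun ω => Function.update (U ω) t o) ⁻¹' (s.restrict ⁻¹' T),
        ∫ v in A, condDensity q μ (fun k => e k (Function.update (U ω) t v k)) t ∂ρ t ∂P := by
  obtain ⟨K, hK0, hK⟩ := RegularHMM.exists_condLik_le (μ := μ)
    (H.regular fun _ => Classical.arbitrary 𝓞).c_pos
    (H.regular fun _ => Classical.arbitrary 𝓞).c_le_one
    (H.regular fun _ => Classical.arbitrary 𝓞).one_le_C
  have hcyl : MeasurableSet (s.restrict ⁻¹' T : Set (ℤ → 𝓞)) := s.measurable_restrict hT
  have hup : Measurable fun u : ℤ → 𝓞 => Function.update u t o :=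
    measurable_update'.comp (measurable_id.prodMk measurable_const)
  have hVm : Measurable fun ω => Function.update (U ω) t o := hup.comp hX.measurable_U
  set D : (ℤ → 𝓞) → ℝ := fun u =>
    (s.restrict ⁻¹' T).indicator (fun _ => (1 : ℝ)) (Function.update u t o) with hD
  have hDm : Measurable D := (measurable_const.indicator hcyl).comp hup
  have hDabs : ∀ u, |D u| ≤ 1 := fun u => by
    simp only [hD, indicator]; split_ifs <;> simp
  have hDup : ∀ u v, D (Function.update u t v) = D u := fun u v => by
    simp only [hD, Function.update_idem]
  set a : 𝓞 → ℝ := A.indicator fun _ => (1 : ℝ) with ha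
  have ham : Measurable a := measurable_const.indicator hA
  have haabs : ∀ v, |a v| ≤ 1 := fun v => by
    simp only [ha, indicator]; split_ifs <;> simp
  obtain ⟨N, hN1, hN⟩ : ∃ N : ℕ, 1 ≤ N ∧ ∀ j ∈ s, |j - t| < N := by
    refine ⟨s.sup (fun j => (|j - t|).toNat) + 1, by lia, fun j hj => ?_⟩
    have := Finset.le_sup (f := fun j => (|j - t|).toNat) hj
    have h2 : (0 : ℤ) ≤ |j - t| := abs_nonneg _
    lia
  have hDdep : ∀ n : ℕ, N ≤ n → ∀ u u' : ℤ → 𝓞,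
      (∀ j, t - n < j → j ≤ t - n + (n + n : ℕ) → u j = u' j) → D u = D u' := by
    intro n hn u u' huu
    have : s.restrict (Function.update u t o) = s.restrict (Function.update u' t o) := by
      ext ⟨j, hj⟩
      simp only [Finset.restrict]
      rcases eq_or_ne j t with rfl | hjt
      · simp
      · rw [Function.update_of_ne hjt, Function.update_of_ne hjt]
        have := abs_lt.1 (hN j hj)
        exact huu j (by lia) (by push_cast; lia)
    simp only [hD, indicator]
    have h2 := iff_of_eq (congrArg (· ∈ T) this)
    split_ifs with h h' h'
    · rfl
    · exact absurd (h2.1 h) h'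
    · exact absurd (h2.2 h') h
    · rfl
  have hres : ∀ n : ℕ, N ≤ n → ∫ ω, a (U ω t) * D (U ω) ∂P = ∫ ω, (∫ v,
      condLik q μ (fun k => e k (Function.update (U ω) t v k)) t (n + n) (t - n) (X ω (t - n)) *
        (a v * D (U ω)) ∂ρ t) ∂P := by
    intro n hn
    rw [hX.integral_resample H (t := t) (n := n + n) (a := t - n) (by lia) (by push_cast; lia)
      (F := fun _ u => a (u t) * D u) (K := 1) ?_ ?_ ?_]
    · simp only [Function.update_self, hDup]
    · exact ((ham.comp (measurable_pi_apply t)).mul hDm).comp measurable_snd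
    · intro _ u
      rw [abs_mul]
      exact mul_le_one₀ (haabs _) (abs_nonneg _) (hDabs u)
    · intro _ u u' huu
      rw [hDdep n hn u u' huu, huu t (by lia) (by push_cast; lia)]
  have hWm : ∀ n : ℕ, Measurable fun p : Ω × 𝓞 =>
      condLik q μ (fun k => e k (Function.update (U p.1) t p.2 k)) t (n + n) (t - n)
        (X p.1 (t - n)) * (a p.2 * D (U p.1)) := by
    intro n
    refine Measurable.mul ?_ ((ham.comp measurable_snd).mul
      (hDm.comp (hX.measurable_U.comp measurable_fst)))
    exact (H.measurable_condLik t (n + n) (t - n)).comp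
      ((measurable_update'.comp ((hX.measurable_U.comp measurable_fst).prodMk
        measurable_snd)).prodMk ((hX.measurable_X _).comp measurable_fst))
  have hbd : ∀ n : ℕ, 1 ≤ n → ∀ ω v,
      ‖condLik q μ (fun k => e k (Function.update (U ω) t v k)) t (n + n) (t - n) (X ω (t - n)) *
        (a v * D (U ω))‖ ≤ K := by
    intro n hn ω v
    have R := H.regular (Function.update (U ω) t v)
    rw [norm_mul, Real.norm_of_nonneg (R.condLik_pos _ _ _ _).le, norm_mul, Real.norm_eq_abs,
      Real.norm_eq_abs]
    have h1 : |a v| * |D (U ω)| ≤ 1 := mul_le_one₀ (haabs _) (abs_nonneg _) (hDabs _)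
    have h2 := (hK q _ R t).2 n n (X ω (t - n)) hn
    have h3 := (R.condLik_pos t (n + n) (t - n) (X ω (t - n))).le
    exact (mul_le_of_le_one_right h3 h1).trans h2
  have hlim : Tendsto (fun n : ℕ => ∫ ω, (∫ v,
      condLik q μ (fun k => e k (Function.update (U ω) t v k)) t (n + n) (t - n) (X ω (t - n)) *
        (a v * D (U ω)) ∂ρ t) ∂P) atTop
      (𝓝 (∫ ω, (∫ v, condDensity q μ (fun k => e k (Function.update (U ω) t v k)) t *
        (a v * D (U ω)) ∂ρ t) ∂P)) := by
    refine tendsto_integral_filter_of_dominated_convergence (fun _ => K * (ρ t).real univ)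
      (Eventually.of_forall fun n => ?_) ?_ (integrable_const _) (Eventually.of_forall fun ω => ?_)
    · exact ((hWm n).stronglyMeasurable.integral_prod_right).aestronglyMeasurable
    · filter_upwards [eventually_ge_atTop 1] with n hn
      refine Eventually.of_forall fun ω => ?_
      exact norm_integral_le_of_norm_le_const (Eventually.of_forall fun v => hbd n hn ω v)
    · refine tendsto_integral_filter_of_dominated_convergence (fun _ => K)
        (Eventually.of_forall fun n => ?_) ?_ (integrable_const _)
        (Eventually.of_forall fun v => ?_)
      · exact ((hWm n).comp measurable_prodMk_left).aestronglyMeasurable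
      · filter_upwards [eventually_ge_atTop 1] with n hn
        exact Eventually.of_forall fun v => hbd n hn ω v
      · exact (H.tendsto_condLik_seq t (Function.update (U ω) t v) fun n => X ω (t - n)).mul_const _
  have hconst : Tendsto (fun n : ℕ => ∫ ω, (∫ v,
      condLik q μ (fun k => e k (Function.update (U ω) t v k)) t (n + n) (t - n) (X ω (t - n)) *
        (a v * D (U ω)) ∂ρ t) ∂P) atTop (𝓝 (∫ ω, a (U ω t) * D (U ω) ∂P)) := by
    refine tendsto_const_nhds.congr' ?_
    filter_upwards [eventually_ge_atTop N] with n hn using hres n hn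
  have hfin := tendsto_nhds_unique hconst hlim
  rw [← integral_indicator (hVm hcyl), ← integral_indicator (hVm hcyl)]
  have e1 : ∀ (f : Ω → ℝ) ω, ((fun ω => Function.update (U ω) t o) ⁻¹' (s.restrict ⁻¹' T)).indicator f ω =
      f ω * D (U ω) := by
    intro f ω
    by_cases h : Function.update (U ω) t o ∈ (s.restrict ⁻¹' T : Set (ℤ → 𝓞))
    · rw [indicator_of_mem (by exact h)]; simp only [hD, indicator_of_mem h, mul_one]
    · rw [indicator_of_notMem (by exact h)]; simp only [hD, indicator_of_notMem h, mul_zero]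
  simp_rw [e1]
  rw [hfin]
  refine integral_congr_ae (Eventually.of_forall fun ω => ?_)
  simp only
  rw [← integral_indicator hA, ← integral_mul_const]
  refine integral_congr_ae (Eventually.of_forall fun v => ?_)
  simp only [ha, indicator]
  split_ifs <;> simp

/-- Cylinders generate the product σ-algebra and are stable under intersections, so the identity of
`IsObservedChain.integral_cylinder` extends to all events. Overwriting the value at `t` by a
constant expresses the σ-algebra of the other observations as a pullback under a path-valued map. -/
lemma IsObservedChain.condLaw (hX : IsObservedChain μ q e ρ P X U)
    (H : RegularEmission μ q e ρ c C) (t : ℤ) (o : 𝓞) {A : Set 𝓞} (hA : MeasurableSet A) :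
    P[fun ω => A.indicator (fun _ => (1 : ℝ)) (U ω t) |
        MeasurableSpace.comap (fun ω => Function.update (U ω) t o) MeasurableSpace.pi] =ᵐ[P]
      fun ω => ∫ v in A, condDensity q μ (fun k => e k (Function.update (U ω) t v k)) t ∂ρ t := by
  obtain ⟨K, hK0, hK⟩ := RegularHMM.exists_condLik_le (μ := μ)
    (H.regular fun _ => Classical.arbitrary 𝓞).c_pos
    (H.regular fun _ => Classical.arbitrary 𝓞).c_le_one
    (H.regular fun _ => Classical.arbitrary 𝓞).one_le_C
  have hup : Measurable fun u : ℤ → 𝓞 => Function.update u t o :=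
    measurable_update'.comp (measurable_id.prodMk measurable_const)
  set V : Ω → ℤ → 𝓞 := fun ω => Function.update (U ω) t o with hV
  have hVm : Measurable V := hup.comp hX.measurable_U
  have hle : MeasurableSpace.comap V MeasurableSpace.pi ≤ mΩ := hVm.comap_le
  have hgm : Measurable fun u : ℤ → 𝓞 =>
      ∫ v in A, condDensity q μ (fun k => e k (Function.update u t v k)) t ∂ρ t := by
    have h1 : Measurable fun p : (ℤ → 𝓞) × 𝓞 =>
        condDensity q μ (fun k => e k (Function.update p.1 t p.2 k)) t :=
      (H.measurable_condDensity t).comp measurable_update'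
    exact (h1.stronglyMeasurable.integral_prod_right (ν := (ρ t).restrict A)).measurable
  set g : Ω → ℝ := fun ω =>
    ∫ v in A, condDensity q μ (fun k => e k (Function.update (U ω) t v k)) t ∂ρ t with hg
  have hgV : g = (fun u : ℤ → 𝓞 =>
      ∫ v in A, condDensity q μ (fun k => e k (Function.update u t v k)) t ∂ρ t) ∘ V := by
    ext ω
    simp only [hg, hV, Function.comp, Function.update_idem]
  have hgi : Integrable g P := by
    refine Integrable.of_bound (C := K * ((ρ t).restrict A).real univ)
      (hgm.comp hX.measurable_U).aestronglyMeasurable (Eventually.of_forall fun ω => ?_)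
    refine norm_integral_le_of_norm_le_const (Eventually.of_forall fun v => ?_)
    have R := H.regular (Function.update (U ω) t v)
    rw [Real.norm_of_nonneg (R.condDensity_pos t).le]
    exact (hK q _ R t).1
  have hfi : Integrable (fun ω => A.indicator (fun _ => (1 : ℝ)) (U ω t)) P := by
    refine Integrable.of_bound (C := 1) ?_ (Eventually.of_forall fun ω => ?_)
    · exact ((measurable_const.indicator hA).comp
        ((measurable_pi_apply t).comp hX.measurable_U)).aestronglyMeasurable
    · simp only [indicator]; split_ifs <;> simp
  have hkey : ∀ B : Set (ℤ → 𝓞), MeasurableSet B →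
      ∫ ω in V ⁻¹' B, A.indicator (fun _ => (1 : ℝ)) (U ω t) ∂P = ∫ ω in V ⁻¹' B, g ω ∂P := by
    -- The whole space is the cylinder over no coordinates; this case is needed for complements.
    have huniv : ∫ ω, A.indicator (fun _ => (1 : ℝ)) (U ω t) ∂P = ∫ ω, g ω ∂P := by
      have h := hX.integral_cylinder H t o hA ∅ (T := univ) MeasurableSet.univ
      rw [preimage_univ] at h
      simpa only [preimage_univ, Measure.restrict_univ] using h
    refine MeasurableSpace.induction_on_inter generateFrom_measurableCylinders.symm
      isPiSystem_measurableCylinders (by simp) ?_ ?_ ?_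
    · intro B hB
      obtain ⟨s, T, hT, rfl⟩ := (mem_measurableCylinders _).1 hB
      exact hX.integral_cylinder H t o hA s hT
    · intro B hB h
      have h1 := integral_add_compl (hVm hB) hfi
      have h2 := integral_add_compl (hVm hB) hgi
      rw [preimage_compl]
      linarith
    · intro f hf hfm h
      rw [preimage_iUnion, integral_iUnion (fun i => hVm (hfm i))
        (fun i j hij => (hf hij).preimage V) hfi.integrableOn,
        integral_iUnion (fun i => hVm (hfm i))
        (fun i j hij => (hf hij).preimage V) hgi.integrableOn]
      simp_rw [h]
  refine (ae_eq_condExp_of_forall_setIntegral_eq hle hfi (fun _ _ _ => hgi.integrableOn)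
    ?_ ?_).symm
  · rintro _ ⟨B, hB, rfl⟩ -
    exact (hkey B hB).symm
  · rw [hgV]
    exact (hgm.comp (comap_measurable V)).aestronglyMeasurable

end CondLaw

/-! ### Differentiability of the limit densities and approximation of their information -/

section LimScore

variable {E : Type*} [NormedAddCommGroup E] [NormedSpace ℝ E] [FiniteDimensional ℝ E]
  {𝓧 : Type*} [MeasurableSpace 𝓧] {μ : Measure 𝓧} [IsFiniteMeasure μ] [NeZero μ] [Nonempty 𝓧]

open RegularFamily

/-- Window scores converge uniformly on the open set `G` and the log-densities converge pointwise,
which permits exchanging limit and derivative. The limit of the window scores is then the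
derivative, with the same error bound. -/
lemma RegularFamily.exists_fderiv_log_condDensity_bound {c C S : ℝ} (hc : 0 < c) (hc1 : c ≤ 1)
    (hC1 : 1 ≤ C) (hS : 0 ≤ S) :
    ∃ B : ℝ, 0 ≤ B ∧ ∀ (q : E → 𝓧 → 𝓧 → ℝ) (h : E → ℤ → 𝓧 → ℝ) (G : Set E),
      RegularFamily μ q h c C S G → ∀ t : ℤ, ∀ θ ∈ G,
      DifferentiableAt ℝ (fun ϑ => Real.log (condDensity (q ϑ) μ (h ϑ) t)) θ ∧
      ∀ (n k : ℕ) (x : 𝓧), 1 ≤ n →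
        ‖condScore μ q h t θ (n + k) (t - n) x -
          fderiv ℝ (fun ϑ => Real.log (condDensity (q ϑ) μ (h ϑ) t)) θ‖ ≤
          B * (rate c C ^ n + rate c C ^ k) := by
  obtain ⟨B, hB0, hB⟩ := exists_condScore_limit (E := E) (μ := μ) hc hc1 hC1 hS
  refine ⟨B, hB0, fun q h G H t θ hθ => ?_⟩
  have hr0 := rate_pos hc (hc1.trans hC1)
  have hr1 := rate_lt_one hc (zero_lt_one.trans_le hC1)
  choose! L hL using hB q h G H t
  have hD : HasFDerivAt (fun ϑ => Real.log (condDensity (q ϑ) μ (h ϑ) t)) (L θ) θ := by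
    refine hasFDerivAt_of_tendstoUniformlyOn (l := atTop) H.isOpen
      (f := fun (n : ℕ) ϑ => Real.log (condLik (q ϑ) μ (h ϑ) t ((n + 1) + (n + 1))
        (t - ((n + 1 : ℕ) : ℤ)) (Classical.arbitrary 𝓧)))
      (f' := fun n ϑ => condScore μ q h t ϑ ((n + 1) + (n + 1)) (t - ((n + 1 : ℕ) : ℤ))
        (Classical.arbitrary 𝓧)) ?_ ?_ ?_ hθ
    · rw [Metric.tendstoUniformlyOn_iff]
      intro ε hε
      filter_upwards [(tendsto_const_mul_pow_succ (B := B) hr0.le hr1).eventually_lt_const hε]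
        with n hn ϑ hϑ
      rw [dist_comm, dist_eq_norm]
      exact (hL ϑ hϑ (n + 1) (n + 1) _ (by lia)).trans_lt hn
    · intro n ϑ hϑ
      rw [H.condScore_eq t hϑ]
      exact H.hasFDerivAt_log_condLik t hϑ _ _ _
    · intro ϑ hϑ
      have R := H.regular ϑ hϑ
      have h1 : Tendsto (fun n : ℕ => ((n + 1, n + 1), Classical.arbitrary 𝓧)) atTop
          ((atTop ×ˢ atTop) ×ˢ ⊤) :=
        ((tendsto_add_atTop_nat 1).prodMk (tendsto_add_atTop_nat 1)).prodMk tendsto_top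
      exact ((R.tendsto_condLik t).comp h1).log (R.condDensity_pos t).ne'
  rw [hD.fderiv]
  exact ⟨hD.differentiableAt, hL θ hθ⟩

end LimScore

namespace RegularModel

variable {E : Type*} [NormedAddCommGroup E] [NormedSpace ℝ E] [FiniteDimensional ℝ E]
  {𝓧 𝓞 : Type*} [MeasurableSpace 𝓧] [MeasurableSpace 𝓞] {μ : Measure 𝓧} [IsFiniteMeasure μ]
  [NeZero μ] [Nonempty 𝓧] [Nonempty 𝓞]
  {ρ : ℤ → Measure 𝓞} [∀ k, IsFiniteMeasure (ρ k)] {c C S : ℝ}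
  {q : E → 𝓧 → 𝓧 → ℝ} {e : E → ℤ → 𝓞 → 𝓧 → ℝ} {Θ G : Set E}

/-- The score of the observation at time `t` given all the other observations. -/
def limScore (μ : Measure 𝓧) (q : E → 𝓧 → 𝓧 → ℝ) (e : E → ℤ → 𝓞 → 𝓧 → ℝ) (θ : E) (t : ℤ)
    (u : ℤ → 𝓞) : E →L[ℝ] ℝ :=
  fderiv ℝ (fun ϑ => Real.log (condDensity (q ϑ) μ (fun k => e ϑ k (u k)) t)) θ

/-- Geometric approximation of the conditional score by window scores. -/
lemma exists_windowScore_bound (H : RegularModel μ q e ρ c C S Θ G) {θ : E} (hθ : θ ∈ G) (t : ℤ) :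
    ∃ B : ℝ, 0 ≤ B ∧ ∀ u : ℤ → 𝓞,
      DifferentiableAt ℝ (fun ϑ => Real.log (condDensity (q ϑ) μ (fun k => e ϑ k (u k)) t)) θ ∧
      ‖limScore μ q e θ t u‖ ≤ B ∧
      ∀ (n k : ℕ) (x : 𝓧), 1 ≤ n → ‖windowScore μ q e θ t (n + k) (t - n) x u‖ ≤ B ∧
        ‖windowScore μ q e θ t (n + k) (t - n) x u - limScore μ q e θ t u‖ ≤
          B * (rate c C ^ n + rate c C ^ k) := by
  have R := (H.family fun _ => Classical.arbitrary 𝓞).regular θ hθ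
  have hS := H.S_nonneg
  have hr0 := rate_pos R.c_pos (R.c_le_one.trans R.one_le_C)
  have hr1 := rate_lt_one R.c_pos R.C_pos
  have hpow : ∀ n : ℕ, rate c C ^ n ≤ 1 := fun n => pow_le_one₀ hr0.le hr1.le
  have hpow0 : ∀ n : ℕ, 0 ≤ rate c C ^ n := fun n => pow_nonneg hr0.le n
  obtain ⟨B, hB0, hB⟩ := RegularFamily.exists_fderiv_log_condDensity_bound (E := E) (μ := μ)
    R.c_pos R.c_le_one R.one_le_C hS
  -- A window with a single observation has a conditional score of norm at most `4 * S`; each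
  -- passage between a window and the limit costs `2 * B`.
  refine ⟨4 * S + 4 * B, by positivity, fun u => ?_⟩
  obtain ⟨hd, hl⟩ := hB q _ G (H.family u) t θ hθ
  have hl' : ∀ (n k : ℕ) (x : 𝓧), 1 ≤ n →
      ‖windowScore μ q e θ t (n + k) (t - n) x u - limScore μ q e θ t u‖ ≤ 2 * B := by
    intro n k x hn
    refine (hl n k x hn).trans ?_
    nlinarith [hpow n, hpow k]
  have hlim : ‖limScore μ q e θ t u‖ ≤ 4 * S + 2 * B := by
    have h1 := H.norm_windowScore_le hθ t (1 + 0) (t - (1 : ℕ)) (Classical.arbitrary 𝓧) u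
    have h2 := hl' 1 0 (Classical.arbitrary 𝓧) le_rfl
    have h3 := norm_sub_norm_le (limScore μ q e θ t u)
      (windowScore μ q e θ t (1 + 0) (t - (1 : ℕ)) (Classical.arbitrary 𝓧) u)
    rw [norm_sub_rev] at h3
    norm_num at h1 h2 h3
    linarith
  refine ⟨hd, by linarith, fun n k x hn => ⟨?_, ?_⟩⟩
  · have h2 := hl' n k x hn
    have h3 := norm_sub_norm_le (windowScore μ q e θ t (n + k) (t - n) x u)
      (limScore μ q e θ t u)
    linarith
  · refine (hl n k x hn).trans ?_
    have := hpow0 n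
    have := hpow0 k
    gcongr
    linarith

lemma measurable_limScore (H : RegularModel μ q e ρ c C S Θ G) {θ : E} (hθ : θ ∈ G) (t : ℤ)
    (d : E) : Measurable fun u => limScore μ q e θ t u d := by
  refine measurable_fderiv_apply_of_eventually (F := fun ϑ (u : ℤ → 𝓞) =>
    Real.log (condDensity (q ϑ) μ (fun k => e ϑ k (u k)) t)) (fun u => ?_) ?_ d
  · obtain ⟨B, -, hB⟩ := H.exists_windowScore_bound hθ t
    exact (hB u).1
  · filter_upwards [H.isOpen.mem_nhds hθ] with ϑ hϑ using Real.measurable_log.comp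
      ((H.emission ϑ (H.subset hϑ)).measurable_condDensity t)

lemma windowScore_add_of_one (H : RegularModel μ q e ρ c C S Θ G) {θ : E} (hθ : θ ∈ G) {t : ℤ}
    {u : ℤ → 𝓞} (hone : ∀ ϑ k, t < k → e ϑ k (u k) = fun _ => 1) {n : ℕ} {a : ℤ}
    (hta : t ≤ a + n) (k : ℕ) (x : 𝓧) :
    windowScore μ q e θ t (n + k) a x u = windowScore μ q e θ t n a x u := by
  unfold windowScore RegularFamily.condScore
  refine Filter.EventuallyEq.fderiv_eq ?_
  filter_upwards [H.isOpen.mem_nhds hθ] with ϑ hϑ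
  rw [((H.family u).regular ϑ hϑ).condLik_add_of_one (hone ϑ) hta]

variable {Ω : Type*} [MeasurableSpace Ω] {P : Measure Ω} [IsProbabilityMeasure P]
  {X : Ω → ℤ → 𝓧} {U : Ω → ℤ → 𝓞}

/-- The information in the observation at time `t` given the other ones, approximated by
windows. -/
lemma exists_integral_windowScore_bound (H : RegularModel μ q e ρ c C S Θ G) {θ : E} (hθ : θ ∈ G)
    (hX : ∀ k, Measurable fun ω => X ω k) (hU : Measurable U) (t : ℤ) (d d' : E) :
    ∃ B : ℝ, 0 ≤ B ∧ ∀ n k : ℕ, 1 ≤ n →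
      |∫ ω, windowScore μ q e θ t (n + k) (t - n) (X ω (t - n)) (U ω) d *
          windowScore μ q e θ t (n + k) (t - n) (X ω (t - n)) (U ω) d' ∂P -
        ∫ ω, limScore μ q e θ t (U ω) d * limScore μ q e θ t (U ω) d' ∂P| ≤
      B * (rate c C ^ n + rate c C ^ k) := by
  obtain ⟨B, hB0, hB⟩ := H.exists_windowScore_bound hθ t
  have R := (H.family fun _ => Classical.arbitrary 𝓞).regular θ hθ
  have hr0 := rate_pos R.c_pos (R.c_le_one.trans R.one_le_C)
  refine ⟨2 * (B * ‖d‖ * (B * ‖d'‖)), by positivity, fun n k hn => ?_⟩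
  have hXU : Measurable fun ω => (X ω (t - n), U ω) := (hX _).prodMk hU
  have mw : ∀ d, Measurable fun ω => windowScore μ q e θ t (n + k) (t - n) (X ω (t - n)) (U ω) d :=
    fun d => (H.measurable_windowScore hθ t _ _ d).comp hXU
  have ml : ∀ d, Measurable fun ω => limScore μ q e θ t (U ω) d :=
    fun d => (H.measurable_limScore hθ t d).comp hU
  have bw : ∀ ω, ‖windowScore μ q e θ t (n + k) (t - n) (X ω (t - n)) (U ω)‖ ≤ B :=
    fun ω => ((hB (U ω)).2.2 n k _ hn).1
  have bl : ∀ ω, ‖limScore μ q e θ t (U ω)‖ ≤ B := fun ω => (hB (U ω)).2.1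
  rw [← integral_sub (integrable_mul_of_norm_le (P := P) d d' (mw d) (mw d') bw bw)
    (integrable_mul_of_norm_le (P := P) d d' (ml d) (ml d') bl bl), ← Real.norm_eq_abs]
  refine (norm_integral_le_of_norm_le_const (C := 2 * (B * ‖d‖ * (B * ‖d'‖)) *
    (rate c C ^ n + rate c C ^ k)) (Eventually.of_forall fun ω => ?_)).trans_eq (by simp)
  set w := windowScore μ q e θ t (n + k) (t - n) (X ω (t - n)) (U ω) with hw
  set l := limScore μ q e θ t (U ω) with hl
  set δ := rate c C ^ n + rate c C ^ k
  have hδ : 0 ≤ δ := by positivity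
  have hwl : ‖w - l‖ ≤ B * δ := ((hB (U ω)).2.2 n k _ hn).2
  have e1 : w d * w d' - l d * l d' = (w - l) d * w d' + l d * (w - l) d' := by
    simp only [sub_apply]; ring
  have f1 : ∀ (A : E →L[ℝ] ℝ) (K : ℝ) (v : E), ‖A‖ ≤ K → ‖A v‖ ≤ K * ‖v‖ := fun A K v h =>
    (A.le_opNorm v).trans (mul_le_mul_of_nonneg_right h (norm_nonneg _))
  rw [e1]
  refine (norm_add_le _ _).trans ?_
  rw [norm_mul, norm_mul]
  have g1 := mul_le_mul (f1 _ _ d hwl) (f1 _ _ d' (bw ω)) (norm_nonneg _) (by positivity)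
  have g2 := mul_le_mul (f1 _ _ d (bl ω)) (f1 _ _ d' hwl) (norm_nonneg _) (by positivity)
  calc _ ≤ B * δ * ‖d‖ * (B * ‖d'‖) + B * ‖d‖ * (B * δ * ‖d'‖) := add_le_add g1 g2
    _ = _ := by ring

/-- The same, when no observation is made after time `t`. -/
lemma exists_integral_windowScore_bound_of_one (H : RegularModel μ q e ρ c C S Θ G) {θ : E}
    (hθ : θ ∈ G) (hX : ∀ k, Measurable fun ω => X ω k) (hU : Measurable U) (t : ℤ)
    (hone : ∀ ϑ k, t < k → ∀ v, e ϑ k v = fun _ => 1) (d d' : E) :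
    ∃ B : ℝ, 0 ≤ B ∧ ∀ n : ℕ, 1 ≤ n →
      |∫ ω, windowScore μ q e θ t n (t - n) (X ω (t - n)) (U ω) d *
          windowScore μ q e θ t n (t - n) (X ω (t - n)) (U ω) d' ∂P -
        ∫ ω, limScore μ q e θ t (U ω) d * limScore μ q e θ t (U ω) d' ∂P| ≤ B * rate c C ^ n := by
  obtain ⟨B, hB0, hB⟩ := H.exists_integral_windowScore_bound (P := P) hθ hX hU t d d'
  have R := (H.family fun _ => Classical.arbitrary 𝓞).regular θ hθ
  have hr0 := rate_pos R.c_pos (R.c_le_one.trans R.one_le_C)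
  have hr1 := rate_lt_one R.c_pos R.C_pos
  refine ⟨B, hB0, fun n hn => ?_⟩
  -- With nothing observed after `t` the left side of the estimate does not depend on `k`, so `k →
  -- ∞` removes the term `rate c C ^ k`.
  have h1 : Tendsto (fun k : ℕ => B * (rate c C ^ n + rate c C ^ k)) atTop
      (𝓝 (B * (rate c C ^ n + 0))) :=
    ((tendsto_pow_atTop_nhds_zero_of_lt_one hr0.le hr1).const_add _).const_mul _
  rw [add_zero] at h1
  refine ge_of_tendsto' h1 fun k => ?_
  have h2 := hB n k hn
  have h3 : ∀ ω, windowScore μ q e θ t (n + k) (t - n) (X ω (t - n)) (U ω) =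
      windowScore μ q e θ t n (t - n) (X ω (t - n)) (U ω) := fun ω =>
    H.windowScore_add_of_one hθ (fun ϑ k hk => hone ϑ k hk _) (by lia) k _
  simp_rw [h3] at h2
  exact h2

end RegularModel

section

open scoped ENNReal

/-! ### Resampling a coordinate of a product measure or of a Markov path -/

section ProductMeasures

/-- Resampling one coordinate of an infinite product measure. -/
lemma lintegral_infinitePi_update {ι : Type*} [DecidableEq ι] {α : Type*} [MeasurableSpace α]
    (p : Measure α) [IsProbabilityMeasure p] (i : ι) {f : (ι → α) → ℝ≥0∞} (hf : Measurable f) :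
    ∫⁻ z, f z ∂Measure.infinitePi (fun _ : ι => p) =
      ∫⁻ z, ∫⁻ ζ, f (Function.update z i ζ) ∂p ∂Measure.infinitePi (fun _ : ι => p) := by
  have hup : Measurable fun w : (ι → α) × α => Function.update w.1 i w.2 := measurable_update'
  have hmap : ((Measure.infinitePi fun _ : ι => p).prod p).map
      (fun w : (ι → α) × α => Function.update w.1 i w.2) = Measure.infinitePi fun _ : ι => p := by
    refine Measure.eq_infinitePi _ fun s t ht => ?_
    rw [Measure.map_apply hup (.pi s.countable_toSet fun j _ => ht j)]
    by_cases hi : i ∈ s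
    · have : (fun w : (ι → α) × α => Function.update w.1 i w.2) ⁻¹' (s : Set ι).pi t =
          ((s.erase i : Finset ι) : Set ι).pi t ×ˢ t i := by
        ext w
        simp only [mem_preimage, Set.mem_pi, mem_prod, Finset.mem_coe, Finset.mem_erase]
        constructor
        · intro h
          refine ⟨fun j hj => ?_, ?_⟩
          · have := h j hj.2
            rwa [Function.update_of_ne hj.1] at this
          · simpa using h i hi
        · rintro ⟨h1, h2⟩ j hj
          rcases eq_or_ne j i with rfl | hji
          · simpa using h2
          · rw [Function.update_of_ne hji]; exact h1 j ⟨hji, hj⟩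
      rw [this, Measure.prod_prod, Measure.infinitePi_pi _ fun j _ => ht j,
        Finset.prod_erase_mul _ _ hi]
    · have : (fun w : (ι → α) × α => Function.update w.1 i w.2) ⁻¹' (s : Set ι).pi t =
          (s : Set ι).pi t ×ˢ univ := by
        ext w
        simp only [mem_preimage, Set.mem_pi, mem_prod, Finset.mem_coe, mem_univ, and_true]
        refine forall₂_congr fun j hj => ?_
        rw [Function.update_of_ne (fun h : j = i => hi (h ▸ hj))]
      rw [this, Measure.prod_prod, Measure.infinitePi_pi _ fun j _ => ht j, measure_univ, mul_one]
  conv_lhs => rw [← hmap]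
  rw [lintegral_map hf hup, lintegral_prod _ (by exact (hf.comp hup).aemeasurable)]

/-- One step of a Markov chain, for functions of the path up to time `k + 1`. -/
lemma IsStationaryMarkovLaw.lintegral_update {S : Type*} [MeasurableSpace S] {κ : Kernel S S}
    [IsSFiniteKernel κ] {P : Measure (ℤ → S)} (hP : IsStationaryMarkovLaw κ P) (k : ℤ)
    {Φ : (ℤ → S) → ℝ≥0∞} (hΦ : Measurable Φ)
    (hdep : ∀ w w', (∀ j ≤ k + 1, w j = w' j) → Φ w = Φ w') :
    ∫⁻ w, Φ w ∂P = ∫⁻ w, ∫⁻ s, Φ (Function.update w (k + 1) s) ∂κ (w k) ∂P := by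
  have := hP.isProbabilityMeasure
  -- `ext` prolongs a past up to `k` and a next state to a full path; its values after `k + 1` are
  -- immaterial, as `Φ` ignores them.
  set ext : (Set.Iic k → S) × S → ℤ → S := fun p j => if h : j ≤ k then p.1 ⟨j, h⟩ else p.2
    with hext
  have hextm : Measurable ext := by
    refine measurable_pi_lambda _ fun j => ?_
    by_cases h : j ≤ k
    · simp only [hext, h, dite_true]
      exact (measurable_pi_apply _).comp measurable_fst
    · simp only [hext, h, dite_false]; exact measurable_snd
  have hr : Measurable fun (w : ℤ → S) (j : Set.Iic k) => w j :=
    measurable_pi_lambda _ fun j => measurable_pi_apply _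
  have e1 : ∀ w : ℤ → S, Φ w = Φ (ext ((fun j : Set.Iic k => w j), w (k + 1))) := fun w => by
    refine hdep _ _ fun j hj => ?_
    by_cases h : j ≤ k
    · simp [hext, h]
    · have : j = k + 1 := by lia
      subst this
      simp [hext]
  have e2 : ∀ (w : ℤ → S) s, Φ (ext ((fun j : Set.Iic k => w j), s)) =
      Φ (Function.update w (k + 1) s) := fun w s => by
    refine hdep _ _ fun j hj => ?_
    by_cases h : j ≤ k
    · rw [Function.update_of_ne (by lia)]; simp [hext, h]
    · have : j = k + 1 := by lia
      subst this
      simp [hext]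
  have hm := hP.markov k
  have h1 : ∫⁻ w, Φ w ∂P = ∫⁻ p, Φ (ext p)
      ∂(P.map fun w => ((fun j : Set.Iic k => w j), w (k + 1))) := by
    rw [lintegral_map (by exact hΦ.comp hextm) (hr.prodMk (measurable_pi_apply _))]
    exact lintegral_congr e1
  have hin : Measurable fun past : Set.Iic k → S => ∫⁻ s, Φ (ext (past, s))
      ∂(κ.comap (fun past : Set.Iic k → S => past ⟨k, le_refl k⟩) (measurable_pi_apply _)) past :=
    (hΦ.comp hextm).lintegral_kernel_prod_right'
  rw [h1, hm, Measure.lintegral_compProd (by exact hΦ.comp hextm),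
    lintegral_map hin hr]
  refine lintegral_congr fun w => ?_
  simp only [Kernel.comap_apply, e2]

end ProductMeasures

/-! ### Averaging over the noise -/

section Noise

variable {m : ℕ}

instance isProbabilityMeasure_unifBall : IsProbabilityMeasure (unifBall m) :=
  cond_isProbabilityMeasure_of_finite
    (Metric.measure_closedBall_pos volume (0 : EuclideanSpace ℝ (Fin m)) one_pos).ne'
    measure_closedBall_lt_top.ne

/-- Averaging over the noise is averaging over a ball. -/
lemma exists_lintegral_unifBall {ε : ℝ} (hε : 0 < ε) :
    ∃ κ : ℝ≥0∞, ∀ (y : EuclideanSpace ℝ (Fin m)) (ψ : EuclideanSpace ℝ (Fin m) → ℝ≥0∞), Measurable ψ →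
      ∫⁻ ζ, ψ (y + ε • ζ) ∂unifBall m = κ * ∫⁻ v in Metric.closedBall y ε, ψ v := by
  -- The inverse volume of the unit ball times the Jacobian of the scaling by `ε`; later only its
  -- independence of `y` and `ψ` matters.
  refine ⟨(volume (Metric.closedBall (0 : EuclideanSpace ℝ (Fin m)) 1))⁻¹ *
    ENNReal.ofReal |(ε ^ Module.finrank ℝ (EuclideanSpace ℝ (Fin m)))⁻¹|, fun y ψ hψ => ?_⟩
  unfold unifBall
  rw [ProbabilityTheory.cond, lintegral_smul_measure, smul_eq_mul, mul_assoc]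
  congr 1
  have hf : Measurable ((Metric.closedBall y ε).indicator ψ) :=
    hψ.indicator Metric.isClosed_closedBall.measurableSet
  have e1 : ∀ ζ : EuclideanSpace ℝ (Fin m), (Metric.closedBall (0 : EuclideanSpace ℝ (Fin m)) 1).indicator (fun ζ => ψ (y + ε • ζ)) ζ =
      (Metric.closedBall y ε).indicator ψ (y + ε • ζ) := by
    intro ζ
    have : ζ ∈ Metric.closedBall (0 : EuclideanSpace ℝ (Fin m)) 1 ↔ y + ε • ζ ∈ Metric.closedBall y ε := by
      simp only [Metric.mem_closedBall, dist_eq_norm, sub_zero, add_sub_cancel_left,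
        norm_smul, Real.norm_of_nonneg hε.le]
      constructor <;> intro h
      · nlinarith
      · by_contra h'; nlinarith
    by_cases h : ζ ∈ Metric.closedBall (0 : EuclideanSpace ℝ (Fin m)) 1
    · rw [indicator_of_mem h, indicator_of_mem (this.1 h)]
    · rw [indicator_of_notMem h, indicator_of_notMem (fun h' => h (this.2 h'))]
  rw [← lintegral_indicator Metric.isClosed_closedBall.measurableSet,
    ← lintegral_indicator Metric.isClosed_closedBall.measurableSet]
  simp_rw [e1]
  have hs : Measurable fun ζ : EuclideanSpace ℝ (Fin m) => ε • ζ := measurable_const_smul ε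
  rw [← lintegral_map (f := fun v => (Metric.closedBall y ε).indicator ψ (y + v))
    (hf.comp (measurable_const_add y)) hs, Measure.map_addHaar_smul _ hε.ne',
    lintegral_smul_measure, smul_eq_mul,
    lintegral_add_left_eq_self (μ := volume) ((Metric.closedBall y ε).indicator ψ) y]

lemma measurableSet_dist_le (ε : ℝ) : MeasurableSet {p : EuclideanSpace ℝ (Fin m) × EuclideanSpace ℝ (Fin m) | dist p.2 p.1 ≤ ε} :=
  measurableSet_le (measurable_snd.dist measurable_fst) measurable_const

/-- Integrals against the law of a noisy observation. -/
lemma exists_lintegral_noisy (ν : Measure (EuclideanSpace ℝ (Fin m))) [IsFiniteMeasure ν] {ε : ℝ} (hε : 0 < ε) :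
    ∃ κ : ℝ≥0∞, ∀ (ψ : EuclideanSpace ℝ (Fin m) → ℝ≥0∞) (f : EuclideanSpace ℝ (Fin m) → ℝ≥0∞), Measurable ψ → Measurable f →
      ∫⁻ y, f y * ∫⁻ ζ, ψ (y + ε • ζ) ∂unifBall m ∂ν =
        κ * ∫⁻ v, ψ v * ∫⁻ y in Metric.closedBall v ε, f y ∂ν := by
  obtain ⟨κ, hκ⟩ := exists_lintegral_unifBall (m := m) hε
  refine ⟨κ, fun ψ f hψ hf => ?_⟩
  have hI : Measurable fun p : EuclideanSpace ℝ (Fin m) × EuclideanSpace ℝ (Fin m) =>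
      {p : EuclideanSpace ℝ (Fin m) × EuclideanSpace ℝ (Fin m) | dist p.2 p.1 ≤ ε}.indicator (fun _ => (1 : ℝ≥0∞)) p :=
    measurable_const.indicator (measurableSet_dist_le ε)
  -- Membership in the ball is symmetric in centre and point; written as an indicator on pairs it
  -- lets Tonelli's theorem exchange their roles.
  have e1 : ∀ y, f y * ∫⁻ ζ, ψ (y + ε • ζ) ∂unifBall m = κ * ∫⁻ v, f y * ψ v *
      {p : EuclideanSpace ℝ (Fin m) × EuclideanSpace ℝ (Fin m) | dist p.2 p.1 ≤ ε}.indicator (fun _ => (1 : ℝ≥0∞)) (y, v) := by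
    intro y
    rw [hκ y ψ hψ, ← lintegral_indicator Metric.isClosed_closedBall.measurableSet,
      mul_left_comm, ← lintegral_const_mul _
        (hψ.indicator Metric.isClosed_closedBall.measurableSet)]
    congr 1
    refine lintegral_congr fun v => ?_
    simp only [indicator, Metric.mem_closedBall, mem_ofPred_eq]
    split_ifs <;> simp
  simp_rw [e1]
  have hm : Measurable fun p : EuclideanSpace ℝ (Fin m) × EuclideanSpace ℝ (Fin m) => f p.1 * ψ p.2 *
      {p : EuclideanSpace ℝ (Fin m) × EuclideanSpace ℝ (Fin m) | dist p.2 p.1 ≤ ε}.indicator (fun _ => (1 : ℝ≥0∞)) p :=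
    ((hf.comp measurable_fst).mul (hψ.comp measurable_snd)).mul hI
  rw [lintegral_const_mul _ (by exact hm.lintegral_prod_right'),
    lintegral_lintegral_swap (by exact hm.aemeasurable)]
  congr 1
  refine lintegral_congr fun v => ?_
  rw [← lintegral_indicator Metric.isClosed_closedBall.measurableSet,
    ← lintegral_const_mul _ (hf.indicator Metric.isClosed_closedBall.measurableSet)]
  refine lintegral_congr fun y => ?_
  simp only [indicator, Metric.mem_closedBall, mem_ofPred_eq, dist_comm y v]
  split_ifs <;> simp [mul_comm]

end Noise

namespace HMMFamily

variable {𝓧 : Type*} [MeasurableSpace 𝓧] {d m : ℕ}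

instance isFiniteMeasure_νNoisy (M : HMMFamily 𝓧 d m) (ε : ℝ) : IsFiniteMeasure (M.νNoisy ε) := by
  unfold νNoisy; infer_instance

lemma measurable_add_smul (ε : ℝ) :
    Measurable fun z : EuclideanSpace ℝ (Fin m) × EuclideanSpace ℝ (Fin m) => z.1 + ε • z.2 :=
  measurable_fst.add (measurable_snd.const_smul ε)

lemma lintegral_νNoisy (M : HMMFamily 𝓧 d m) (ε : ℝ) {ψ : EuclideanSpace ℝ (Fin m) → ℝ≥0∞}
    (hψ : Measurable ψ) :
    ∫⁻ v, ψ v ∂M.νNoisy ε = ∫⁻ y, ∫⁻ ζ, ψ (y + ε • ζ) ∂unifBall m ∂M.ν := by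
  unfold νNoisy
  rw [lintegral_map hψ (measurable_add_smul ε),
    lintegral_prod _ (by exact (hψ.comp (measurable_add_smul ε)).aemeasurable)]

lemma measurable_measure_closedBall (M : HMMFamily 𝓧 d m) (ε : ℝ) :
    Measurable fun v => M.ν (Metric.closedBall v ε) := by
  have h := measurable_measure_prodMk_left (ν := M.ν) (measurableSet_dist_le (m := m) ε)
  exact h

/-- Noisy observations are at points where the perturbed density is defined. -/
lemma ae_νNoisy (M : HMMFamily 𝓧 d m) {ε : ℝ} (hε : 0 < ε) :
    ∀ᵐ v ∂M.νNoisy ε, M.ν (Metric.closedBall v ε) ≠ 0 := by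
  obtain ⟨κ, hκ⟩ := exists_lintegral_noisy M.ν hε
  have hN : MeasurableSet {v | M.ν (Metric.closedBall v ε) = 0} :=
    M.measurable_measure_closedBall ε (measurableSet_singleton 0)
  have hm : Measurable ({v | M.ν (Metric.closedBall v ε) = 0}.indicator fun _ => (1 : ℝ≥0∞)) :=
    measurable_const.indicator hN
  have h1 := hκ _ (fun _ => 1) hm measurable_const
  simp only [one_mul] at h1
  rw [← M.lintegral_νNoisy ε hm, lintegral_indicator_const hN, one_mul] at h1
  rw [ae_iff]
  simp only [not_not]
  rw [h1]
  -- Up to the constant, the measure of the ball about `v` is the Lebesgue density of `M.νNoisy ε`,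
  -- and it vanishes on the set in question.
  have : ∀ v, {v | M.ν (Metric.closedBall v ε) = 0}.indicator (fun _ => (1 : ℝ≥0∞)) v *
      ∫⁻ _ in Metric.closedBall v ε, 1 ∂M.ν = 0 := by
    intro v
    simp only [indicator, mem_ofPred_eq]
    split_ifs with h <;> simp [h]
  simp only [this, lintegral_zero, mul_zero]

end HMMFamily

end

/-! ### Clean, noisy and missing observations -/

section

open scoped ENNReal

/-- The ways in which a hidden state can be observed. -/
inductive ObsKind
  | clean
  | noisy
  | missing

/-- The observation made of a given kind, as a function of the clean observation and the noise. -/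
def obs {m : ℕ} (ε : ℝ) : ObsKind → EuclideanSpace ℝ (Fin m) → EuclideanSpace ℝ (Fin m) →
    EuclideanSpace ℝ (Fin m)
  | .clean, y, _ => y
  | .noisy, y, z => y + ε • z
  | .missing, _, _ => 0

lemma measurable_obs {m : ℕ} (ε : ℝ) (κ : ObsKind) :
    Measurable (Function.uncurry (obs (m := m) ε κ)) := by
  cases κ
  · exact measurable_fst
  · exact HMMFamily.measurable_add_smul ε
  · exact measurable_const

namespace HMMFamily

variable {𝓧 : Type*} [MeasurableSpace 𝓧] {d m : ℕ}

/-- The dominating measures of the observations. -/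
def obsMeasure (M : HMMFamily 𝓧 d m) (ε : ℝ) : ObsKind → Measure (EuclideanSpace ℝ (Fin m))
  | .clean => M.ν
  | .noisy => M.νNoisy ε
  | .missing => Measure.dirac 0

instance isFiniteMeasure_obsMeasure (M : HMMFamily 𝓧 d m) (ε : ℝ) (κ : ObsKind) :
    IsFiniteMeasure (M.obsMeasure ε κ) := by
  cases κ <;> unfold obsMeasure <;> infer_instance

open Classical in
/-- The conditional densities of the observations, set to `1` where they are not specified. -/
def obsDensity (M : HMMFamily 𝓧 d m) (ε : ℝ) : ObsKind → EuclideanSpace ℝ (Fin d) →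
    EuclideanSpace ℝ (Fin m) → 𝓧 → ℝ
  | .clean, θ, y, x => if y ∈ M.𝒴 then M.g θ y x else 1
  | .noisy, θ, y, x => if M.ν (Metric.closedBall y ε) = 0 then 1 else M.gNoisy ε θ y x
  | .missing, _, _, _ => 1

/-- Uniform bounds on the densities and their logarithmic derivatives. -/
structure Regular (M : HMMFamily 𝓧 d m) (G : Set (EuclideanSpace ℝ (Fin d))) (c C S : ℝ) :
    Prop where
  c_pos : 0 < c
  c_le_one : c ≤ 1
  one_le_C : 1 ≤ C
  S_nonneg : 0 ≤ S
  isOpen : IsOpen G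
  subset : G ⊆ M.Θ
  q_mem : ∀ θ ∈ M.Θ, ∀ x x', c ≤ M.q θ x x' ∧ M.q θ x x' ≤ C
  g_mem : ∀ θ ∈ M.Θ, ∀ y ∈ M.𝒴, ∀ x, c ≤ M.g θ y x ∧ M.g θ y x ≤ C
  q_diff : ∀ x x', LogDiffOn S G fun θ => M.q θ x x'
  g_diff : ∀ y ∈ M.𝒴, ∀ x, LogDiffOn S G fun θ => M.g θ y x

lemma logDiffOn_of_gradient_log {S : ℝ} {G : Set (EuclideanSpace ℝ (Fin d))} (hG : IsOpen G)
    {F : EuclideanSpace ℝ (Fin d) → ℝ} (hF : ContDiffOn ℝ 2 F G) (h0 : ∀ θ ∈ G, 0 < F θ)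
    (hS : ∀ θ ∈ G, ‖gradient (fun ϑ => Real.log (F ϑ)) θ‖ ≤ S) : LogDiffOn S G F := by
  intro θ hθ
  have hd : DifferentiableAt ℝ F θ :=
    (hF.contDiffAt (hG.mem_nhds hθ)).differentiableAt (by norm_num)
  refine ⟨hd, ?_⟩
  have h1 := hS θ hθ
  have h2 := h0 θ hθ
  rw [gradient, LinearIsometryEquiv.norm_map, fderiv.log hd h2.ne', norm_smul, norm_inv,
    Real.norm_of_nonneg h2.le, inv_mul_le_iff₀ h2] at h1
  linarith

lemma exists_regular (M : HMMFamily 𝓧 d m) {G : Set (EuclideanSpace ℝ (Fin d))} (hG : IsOpen G)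
    (hGΘ : G ⊆ M.Θ) (h3 : M.A3) (h4 : M.A4 G) (h5 : M.A5 G) :
    ∃ c C S : ℝ, M.Regular G c C S := by
  obtain ⟨c, C, hc, hC, hb⟩ := h3
  obtain ⟨S, hS, hs⟩ := h5
  -- The value `1`, used for missing observations and where a density is not specified, has to lie
  -- between the bounds.
  refine ⟨min c 1, max C 1, S, ?_⟩
  refine ⟨lt_min hc one_pos, min_le_right _ _, le_max_right _ _, hS.le, hG, hGΘ, ?_, ?_, ?_, ?_⟩
  · intro θ hθ x x'
    obtain ⟨h1, h2⟩ := (hb θ hθ).1 x x'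
    exact ⟨(min_le_left _ _).trans h1, h2.trans (le_max_left _ _)⟩
  · intro θ hθ y hy x
    obtain ⟨h1, h2⟩ := (hb θ hθ).2 y hy x
    exact ⟨(min_le_left _ _).trans h1, h2.trans (le_max_left _ _)⟩
  · intro x x'
    exact logDiffOn_of_gradient_log hG (h4.1 x x')
      (fun θ hθ => hc.trans_le ((hb θ (hGΘ hθ)).1 x x').1) fun θ hθ => ((hs θ hθ).1 x x').1
  · intro y hy x
    exact logDiffOn_of_gradient_log hG (h4.2 y hy x)
      (fun θ hθ => hc.trans_le ((hb θ (hGΘ hθ)).2 y hy x).1) fun θ hθ => ((hs θ hθ).2 y hy x).1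

lemma ae_mem_𝒴 (M : HMMFamily 𝓧 d m) : ∀ᵐ y ∂M.ν, y ∈ M.𝒴 := by
  rw [ae_iff]; exact M.ν_compl

lemma measurable_obsDensity_clean (M : HMMFamily 𝓧 d m) (ε : ℝ) {θ : EuclideanSpace ℝ (Fin d)}
    (hθ : θ ∈ M.Θ) : Measurable (Function.uncurry (M.obsDensity ε .clean θ)) :=
  Measurable.ite (measurable_fst M.measurableSet_𝒴) (M.measurable_g θ hθ) measurable_const

/-- The perturbed density, in terms of the density of clean observations. -/
lemma gNoisy_eq (M : HMMFamily 𝓧 d m) (ε : ℝ) (θ : EuclideanSpace ℝ (Fin d))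
    (y : EuclideanSpace ℝ (Fin m)) (x : 𝓧) :
    M.gNoisy ε θ y x = (M.ν.real (Metric.closedBall y ε))⁻¹ *
      ∫ y' in Metric.closedBall y ε, M.obsDensity ε .clean θ y' x ∂M.ν := by
  unfold gNoisy
  congr 1
  refine integral_congr_ae ?_
  filter_upwards [ae_restrict_of_ae M.ae_mem_𝒴] with y' hy'
  simp [obsDensity, hy']

lemma measurable_gNoisy (M : HMMFamily 𝓧 d m) (ε : ℝ) {θ : EuclideanSpace ℝ (Fin d)}
    (hθ : θ ∈ M.Θ) : Measurable (Function.uncurry (M.gNoisy ε θ)) := by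
  have h1 : Measurable fun p : (EuclideanSpace ℝ (Fin m) × 𝓧) × EuclideanSpace ℝ (Fin m) =>
      {p : EuclideanSpace ℝ (Fin m) × EuclideanSpace ℝ (Fin m) | dist p.2 p.1 ≤ ε}.indicator
        (fun _ => (1 : ℝ)) (p.1.1, p.2) * M.g θ p.2 p.1.2 :=
    ((measurable_const.indicator (measurableSet_dist_le ε)).comp
      (measurable_fst.fst.prodMk measurable_snd)).mul
      ((M.measurable_g θ hθ).comp (measurable_snd.prodMk measurable_fst.snd))
  have h2 := (h1.stronglyMeasurable.integral_prod_right' (ν := M.ν)).measurable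
  have h3 : Measurable fun p : EuclideanSpace ℝ (Fin m) × 𝓧 =>
      (M.ν.real (Metric.closedBall p.1 ε))⁻¹ :=
    ((M.measurable_measure_closedBall ε).comp measurable_fst).ennreal_toReal.inv
  convert h3.mul h2 using 1
  ext p
  simp only [Function.uncurry, gNoisy, Pi.mul_apply]
  rw [← integral_indicator Metric.isClosed_closedBall.measurableSet]
  congr 1
  refine integral_congr_ae (Eventually.of_forall fun y' => ?_)
  simp only [indicator, Metric.mem_closedBall, mem_ofPred_eq]
  split_ifs <;> simp

lemma measurable_obsDensity (M : HMMFamily 𝓧 d m) (ε : ℝ) (κ : ObsKind)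
    {θ : EuclideanSpace ℝ (Fin d)} (hθ : θ ∈ M.Θ) :
    Measurable (Function.uncurry (M.obsDensity ε κ θ)) := by
  cases κ
  · exact M.measurable_obsDensity_clean ε hθ
  · exact Measurable.ite (((M.measurable_measure_closedBall ε).comp measurable_fst)
      (measurableSet_singleton 0)) measurable_const (M.measurable_gNoisy ε hθ)
  · exact measurable_const

namespace Regular

variable {M : HMMFamily 𝓧 d m} {G : Set (EuclideanSpace ℝ (Fin d))} {c C S : ℝ} {ε : ℝ}

lemma C_pos (H : M.Regular G c C S) : 0 < C := zero_lt_one.trans_le H.one_le_C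

lemma obsDensity_clean_mem (H : M.Regular G c C S) (ε : ℝ) {θ : EuclideanSpace ℝ (Fin d)}
    (hθ : θ ∈ M.Θ) (v : EuclideanSpace ℝ (Fin m)) (x : 𝓧) :
    c ≤ M.obsDensity ε .clean θ v x ∧ M.obsDensity ε .clean θ v x ≤ C := by
  simp only [obsDensity]
  split_ifs with h
  · exact H.g_mem θ hθ v h x
  · exact ⟨H.c_le_one, H.one_le_C⟩

lemma obsDensity_mem (H : M.Regular G c C S) (ε : ℝ) (κ : ObsKind)
    {θ : EuclideanSpace ℝ (Fin d)} (hθ : θ ∈ M.Θ) (v : EuclideanSpace ℝ (Fin m)) (x : 𝓧) :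
    c ≤ M.obsDensity ε κ θ v x ∧ M.obsDensity ε κ θ v x ≤ C := by
  cases κ
  · exact H.obsDensity_clean_mem ε hθ v x
  · simp only [obsDensity]
    split_ifs with h
    · exact ⟨H.c_le_one, H.one_le_C⟩
    · have hB : 0 < M.ν.real (Metric.closedBall v ε) :=
        ENNReal.toReal_pos h (measure_ne_top _ _)
      have hm : Measurable fun y => M.obsDensity ε .clean θ y x :=
        (M.measurable_obsDensity_clean ε hθ).comp measurable_prodMk_right
      have hi : Integrable (fun y => M.obsDensity ε .clean θ y x)
          (M.ν.restrict (Metric.closedBall v ε)) :=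
        Integrable.of_bound hm.aestronglyMeasurable C (Eventually.of_forall fun y => by
          have := H.obsDensity_clean_mem ε hθ y x
          rw [Real.norm_of_nonneg (H.c_pos.le.trans this.1)]; exact this.2)
      rw [gNoisy_eq]
      constructor
      · rw [le_inv_mul_iff₀ hB]
        have := integral_mono (integrable_const c) hi
          fun y => (H.obsDensity_clean_mem ε hθ y x).1
        simpa [measureReal_restrict_apply_univ] using this
      · rw [inv_mul_le_iff₀ hB]
        have := integral_mono hi (integrable_const C)
          fun y => (H.obsDensity_clean_mem ε hθ y x).2
        simpa [measureReal_restrict_apply_univ] using this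
  · exact ⟨H.c_le_one, H.one_le_C⟩

lemma logDiffOn_const_mul {K : ℝ} (hK : 0 ≤ K) {F : EuclideanSpace ℝ (Fin d) → ℝ}
    (hF : LogDiffOn S G F) : LogDiffOn S G fun θ => K * F θ := by
  intro θ hθ
  obtain ⟨h1, h2⟩ := hF θ hθ
  refine ⟨h1.const_mul K, ?_⟩
  rw [fderiv_const_mul h1, norm_smul, Real.norm_of_nonneg hK]
  nlinarith

lemma obsDensity_diff (H : M.Regular G c C S) (ε : ℝ) (κ : ObsKind)
    (v : EuclideanSpace ℝ (Fin m)) (x : 𝓧) :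
    LogDiffOn S G fun θ => M.obsDensity ε κ θ v x := by
  have hclean : ∀ v, LogDiffOn S G fun θ => M.obsDensity ε .clean θ v x := by
    intro v
    simp only [obsDensity]
    split_ifs with h
    · exact H.g_diff v h x
    · exact LogDiffOn.one H.S_nonneg G
  cases κ
  · exact hclean v
  · simp only [obsDensity]
    split_ifs with h
    · exact LogDiffOn.one H.S_nonneg G
    · simp_rw [gNoisy_eq]
      refine logDiffOn_const_mul (by positivity) (LogDiffOn.integral (b := C) H.isOpen hclean
        (fun θ hθ => ?_) fun θ hθ y => ?_)
      · exact (M.measurable_obsDensity_clean ε (H.subset hθ)).comp measurable_prodMk_right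
      · have := H.obsDensity_clean_mem ε (H.subset hθ) y x
        rw [abs_of_nonneg (H.c_pos.le.trans this.1)]; exact this.2
  · exact LogDiffOn.one H.S_nonneg G

end Regular

/-- The law of an observation given the hidden state. -/
lemma lintegral_obs (M : HMMFamily 𝓧 d m) {ε : ℝ} (hε : 0 < ε) (κ : ObsKind)
    {θ : EuclideanSpace ℝ (Fin d)} (hθ : θ ∈ M.Θ) (x : 𝓧) {ψ : EuclideanSpace ℝ (Fin m) → ℝ≥0∞}
    (hψ : Measurable ψ) :
    ∫⁻ y, ENNReal.ofReal (M.g θ y x) * ∫⁻ ζ, ψ (obs ε κ y ζ) ∂unifBall m ∂M.ν =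
      ∫⁻ v, ENNReal.ofReal (M.obsDensity ε κ θ v x) * ψ v ∂M.obsMeasure ε κ := by
  have hgm : Measurable fun y => M.g θ y x := (M.measurable_g θ hθ).comp measurable_prodMk_right
  have hgi : Integrable (fun y => M.g θ y x) M.ν :=
    .of_integral_ne_zero (by rw [M.integral_g θ hθ]; exact one_ne_zero)
  have hg0 : ∀ᵐ y ∂M.ν, 0 ≤ M.g θ y x := by
    filter_upwards [M.ae_mem_𝒴] with y hy using M.g_nonneg θ hθ y hy x
  cases κ
  · simp only [obs, lintegral_const, measure_univ, mul_one, obsMeasure]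
    refine lintegral_congr_ae ?_
    filter_upwards [M.ae_mem_𝒴] with y hy
    simp [obsDensity, hy]
  · simp only [obs, obsMeasure]
    obtain ⟨κ, hκ⟩ := exists_lintegral_noisy M.ν hε
    have hod : Measurable fun v => ENNReal.ofReal (M.obsDensity ε .noisy θ v x) :=
      ((M.measurable_obsDensity ε .noisy hθ).comp measurable_prodMk_right).ennreal_ofReal
    have hom : Measurable fun v => ENNReal.ofReal (M.obsDensity ε .noisy θ v x) * ψ v :=
      hod.mul hψ
    rw [hκ ψ _ hψ hgm.ennreal_ofReal, M.lintegral_νNoisy ε hom]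
    -- The same constant expresses `M.νNoisy ε` through Lebesgue measure, with density proportional
    -- to the measure of the ball, so it is a common factor of both sides. Where the ball is null
    -- both integrands vanish.
    have h1 := hκ _ (fun _ => 1) hom measurable_const
    simp only [one_mul] at h1
    rw [h1]
    congr 1
    refine lintegral_congr fun v => ?_
    rw [setLIntegral_one]
    by_cases h : M.ν (Metric.closedBall v ε) = 0
    · simp [h, Measure.restrict_eq_zero.2 h]
    · rw [← ofReal_integral_eq_lintegral_ofReal hgi.restrict (ae_restrict_of_ae hg0)]
      have hB : 0 < M.ν.real (Metric.closedBall v ε) :=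
        ENNReal.toReal_pos h (measure_ne_top _ _)
      have e1 : M.ν (Metric.closedBall v ε) =
          ENNReal.ofReal (M.ν.real (Metric.closedBall v ε)) :=
        (ENNReal.ofReal_toReal (measure_ne_top _ _)).symm
      simp only [obsDensity, h, if_false, gNoisy]
      rw [mul_comm (ENNReal.ofReal _) (ψ v), mul_assoc, e1, mul_comm (ENNReal.ofReal _),
        ← ENNReal.ofReal_mul hB.le, mul_inv_cancel_left₀ hB.ne']
  · simp only [obs, lintegral_const, measure_univ, mul_one, obsMeasure, lintegral_dirac,
      obsDensity, ENNReal.ofReal_one, one_mul]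
    rw [lintegral_mul_const _ hgm.ennreal_ofReal, ← ofReal_integral_eq_lintegral_ofReal hgi hg0,
      M.integral_g θ hθ, ENNReal.ofReal_one, one_mul]

namespace Regular

variable {M : HMMFamily 𝓧 d m} {G : Set (EuclideanSpace ℝ (Fin d))} {c C S : ℝ} {ε : ℝ}

lemma integral_obsDensity (H : M.Regular G c C S) (hε : 0 < ε) (κ : ObsKind)
    {θ : EuclideanSpace ℝ (Fin d)} (hθ : θ ∈ M.Θ) (x : 𝓧) :
    ∫ v, M.obsDensity ε κ θ v x ∂M.obsMeasure ε κ = 1 := by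
  have hgi : Integrable (fun y => M.g θ y x) M.ν :=
    .of_integral_ne_zero (by rw [M.integral_g θ hθ]; exact one_ne_zero)
  have hg0 : ∀ᵐ y ∂M.ν, 0 ≤ M.g θ y x := by
    filter_upwards [M.ae_mem_𝒴] with y hy using M.g_nonneg θ hθ y hy x
  have h1 := M.lintegral_obs hε κ hθ x (ψ := fun _ => 1) measurable_const
  simp only [lintegral_const, measure_univ, mul_one] at h1
  rw [← ofReal_integral_eq_lintegral_ofReal hgi hg0, M.integral_g θ hθ, ENNReal.ofReal_one] at h1
  have hm : Measurable fun v => M.obsDensity ε κ θ v x :=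
    (M.measurable_obsDensity ε κ hθ).comp measurable_prodMk_right
  rw [integral_eq_lintegral_of_nonneg_ae (Eventually.of_forall fun v =>
    H.c_pos.le.trans (H.obsDensity_mem ε κ hθ v x).1) hm.aestronglyMeasurable, ← h1]
  simp

lemma regularModel (H : M.Regular G c C S) (hε : 0 < ε) (κ : ℤ → ObsKind) :
    RegularModel M.μ M.q (fun θ k => M.obsDensity ε (κ k) θ) (fun k => M.obsMeasure ε (κ k))
      c C S M.Θ G := by
  have hreg : ∀ θ ∈ M.Θ, ∀ u : ℤ → EuclideanSpace ℝ (Fin m),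
      RegularHMM M.μ (M.q θ) (fun k => M.obsDensity ε (κ k) θ (u k)) c C := fun θ hθ u =>
    { c_pos := H.c_pos
      c_le_one := H.c_le_one
      one_le_C := H.one_le_C
      measurable_q := M.measurable_q θ hθ
      q_mem := H.q_mem θ hθ
      integral_q := M.integral_q θ hθ
      measurable_h := fun k => (M.measurable_obsDensity ε (κ k) hθ).comp measurable_prodMk_left
      h_mem := fun k x => H.obsDensity_mem ε (κ k) hθ (u k) x }
  exact
    { emission := fun θ hθ =>
        { measurable_e := fun k => M.measurable_obsDensity ε (κ k) hθ
          regular := hreg θ hθ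
          integral_e := fun k x => H.integral_obsDensity hε (κ k) hθ x }
      family := fun u =>
        { isOpen := H.isOpen
          S_nonneg := H.S_nonneg
          regular := fun θ hθ => hreg θ (H.subset hθ) u
          q_diff := H.q_diff
          h_diff := fun k x => H.obsDensity_diff ε (κ k) (u k) x }
      subset := H.subset }

end Regular

end HMMFamily

end

/-! ### The extended process is an observed Markov chain -/

section

open scoped ENNReal

section

variable {𝓧 𝓞 : Type*} [MeasurableSpace 𝓧] [MeasurableSpace 𝓞] {μ : Measure 𝓧} [IsFiniteMeasure μ]
  {ρ : ℤ → Measure 𝓞} [∀ k, IsFiniteMeasure (ρ k)] {q : 𝓧 → 𝓧 → ℝ} {e : ℤ → 𝓞 → 𝓧 → ℝ}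
  {Ω : Type*} [MeasurableSpace Ω] {P : Measure Ω} {X : Ω → ℤ → 𝓧} {U : Ω → ℤ → 𝓞}

/-- The observation at time `k` is absolutely continuous with respect to `ρ k`. -/
lemma IsObservedChain.ae_of_ae (hX : IsObservedChain μ q e ρ P X U) (k : ℤ) {A : Set 𝓞}
    (hA : MeasurableSet A) (h : ∀ᵐ v ∂ρ k, v ∈ A) : ∀ᵐ ω ∂P, U ω k ∈ A := by
  obtain ⟨j, rfl⟩ : ∃ j, k = j + 1 := ⟨k - 1, by ring⟩
  have hm : Measurable ((Aᶜ).indicator fun _ => (1 : ℝ≥0∞)) :=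
    measurable_const.indicator hA.compl
  have h1 := hX.lintegral_succ j j le_rfl
    (fun _ u _ => (Aᶜ).indicator (fun _ => (1 : ℝ≥0∞)) (u (j + 1)))
    (hm.comp ((measurable_pi_apply _).comp measurable_snd.fst))
    (fun x u u' x' huu => by rw [huu (j + 1) (by lia) le_rfl])
  have h0 : ∀ᵐ v ∂ρ (j + 1), (Aᶜ).indicator (fun _ => (1 : ℝ≥0∞)) v = 0 := by
    filter_upwards [h] with v hv
    simp [hv]
  have h2 : ∀ y x', ∫⁻ v, ENNReal.ofReal (q y x' * e (j + 1) v x') *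
      (Aᶜ).indicator (fun _ => (1 : ℝ≥0∞)) v ∂ρ (j + 1) = 0 := by
    intro y x'
    refine lintegral_eq_zero_of_ae_eq_zero ?_
    filter_upwards [h0] with v hv
    rw [hv, mul_zero]; rfl
  simp only [Function.update_self, h2, lintegral_zero] at h1
  rw [lintegral_eq_zero_iff (by
    exact hm.comp ((measurable_pi_apply _).comp hX.measurable_U))] at h1
  filter_upwards [h1] with ω hω
  by_contra hn
  simp [hn] at hω

end

namespace HMMFamily

variable {𝓧 : Type*} [MeasurableSpace 𝓧] {d m : ℕ}

/-- The sequence of observations of the kinds `κ`. -/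
def observe (ε : ℝ) (κ : ℤ → ObsKind) (ω : Sample 𝓧 m) (k : ℤ) : EuclideanSpace ℝ (Fin m) :=
  obs ε (κ k) (ω.1 k).2 (ω.2 k)

/-- The hidden states. -/
def hidden (ω : Sample 𝓧 m) (k : ℤ) : 𝓧 := (ω.1 k).1

lemma measurable_hidden (k : ℤ) : Measurable fun ω : Sample 𝓧 m => hidden ω k :=
  ((measurable_pi_apply k).comp measurable_fst).fst

lemma measurable_observe (ε : ℝ) (κ : ℤ → ObsKind) :
    Measurable (observe (𝓧 := 𝓧) (m := m) ε κ) :=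
  measurable_pi_lambda _ fun k => (measurable_obs ε (κ k)).comp
    (((measurable_pi_apply k).comp measurable_fst).snd.prodMk
      ((measurable_pi_apply k).comp measurable_snd))

lemma isProbabilityMeasure_P (M : HMMFamily 𝓧 d m) {θ : EuclideanSpace ℝ (Fin d)}
    (hθ : θ ∈ M.Θ) : IsProbabilityMeasure (M.P θ) := by
  have := (M.law_stationary θ hθ).isProbabilityMeasure
  unfold P
  infer_instance

/-- Time shift of the extended process. -/
def shift (ω : Sample 𝓧 m) : Sample 𝓧 m := (fun k => ω.1 (k + 1), fun k => ω.2 (k + 1))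

lemma measurable_shift : Measurable (shift (𝓧 := 𝓧) (m := m)) :=
  (measurable_pi_lambda _ fun k => (measurable_pi_apply (k + 1)).comp measurable_fst).prodMk
    (measurable_pi_lambda _ fun k => (measurable_pi_apply (k + 1)).comp measurable_snd)

lemma map_shift (M : HMMFamily 𝓧 d m) {θ : EuclideanSpace ℝ (Fin d)} (hθ : θ ∈ M.Θ) :
    (M.P θ).map shift = M.P θ := by
  have hs := M.law_stationary θ hθ
  have := hs.isProbabilityMeasure
  have h1 : Measurable fun (ω : ℤ → 𝓧 × EuclideanSpace ℝ (Fin m)) (k : ℤ) => ω (k + 1) :=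
    measurable_pi_lambda _ fun k => measurable_pi_apply (k + 1)
  have h2 : Measurable fun (ω : ℤ → EuclideanSpace ℝ (Fin m)) (k : ℤ) => ω (k + 1) :=
    measurable_pi_lambda _ fun k => measurable_pi_apply (k + 1)
  have h3 := Measure.map_infinitePi_infinitePi_of_inj (P := fun _ : ℤ => unifBall m)
    (f := fun k : ℤ => k + 1) (add_left_injective 1)
  have h4 := Measure.map_prod_map (M.law θ) (Measure.infinitePi fun _ : ℤ => unifBall m) h1 h2
  rw [hs.stationary, h3] at h4
  exact h4.symm

lemma integral_shift (M : HMMFamily 𝓧 d m) {θ : EuclideanSpace ℝ (Fin d)} (hθ : θ ∈ M.Θ)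
    {f : Sample 𝓧 m → ℝ} (hf : Measurable f) :
    ∫ ω, f (shift ω) ∂M.P θ = ∫ ω, f ω ∂M.P θ := by
  conv_rhs => rw [← M.map_shift hθ]
  rw [integral_map measurable_shift.aemeasurable hf.aestronglyMeasurable]

lemma measurable_jointDensity (M : HMMFamily 𝓧 d m) {θ : EuclideanSpace ℝ (Fin d)}
    (hθ : θ ∈ M.Θ) : Measurable (Function.uncurry
      fun (s z : 𝓧 × EuclideanSpace ℝ (Fin m)) =>
        ENNReal.ofReal (M.q θ s.1 z.1 * M.g θ z.2 z.1)) :=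
  (((M.measurable_q θ hθ).comp (measurable_fst.fst.prodMk measurable_snd.fst)).mul
    ((M.measurable_g θ hθ).comp (measurable_snd.snd.prodMk measurable_snd.fst))).ennreal_ofReal

/-- With the noise frozen, the Markov property redraws the state and the clean observation at `k +
1`. Then the noise at `k + 1`, independent of everything else, is redrawn, and `lintegral_obs`
converts the joint law of clean observation and noise into the density of the observation of kind `κ
(k + 1)`. -/
lemma isObservedChain (M : HMMFamily 𝓧 d m) {ε : ℝ} (hε : 0 < ε) (κ : ℤ → ObsKind)
    {θ : EuclideanSpace ℝ (Fin d)} (hθ : θ ∈ M.Θ) :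
    IsObservedChain M.μ (M.q θ) (fun k => M.obsDensity ε (κ k) θ)
      (fun k => M.obsMeasure ε (κ k)) (M.P θ) hidden (observe ε κ) where
  measurable_X := measurable_hidden
  measurable_U := measurable_observe ε κ
  lintegral_succ := by
    intro a k hak F hF hdep
    have hs := M.law_stationary θ hθ
    have := hs.isProbabilityMeasure
    have hjk : IsSFiniteKernel (jointKernel M.μ M.ν (M.q θ) (M.g θ)) := by
      unfold jointKernel
      exact Kernel.IsSFiniteKernel.withDensity _ fun _ _ => ENNReal.ofReal_ne_top
    set N : Measure (ℤ → EuclideanSpace ℝ (Fin m)) :=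
      Measure.infinitePi fun _ : ℤ => unifBall m with hN
    have hq := M.measurable_q θ hθ
    have hobs := measurable_observe (𝓧 := 𝓧) (m := m) ε κ
    have hupd : ∀ (w : ℤ → 𝓧 × EuclideanSpace ℝ (Fin m)) z s,
        observe ε κ (Function.update w (k + 1) s, z) =
          Function.update (observe ε κ (w, z)) (k + 1) (obs ε (κ (k + 1)) s.2 (z (k + 1))) := by
      intro w z s
      ext j : 1
      rcases eq_or_ne j (k + 1) with rfl | hj
      · simp [observe]
      · simp [observe, Function.update_of_ne hj]
    have hupd' : ∀ (w : ℤ → 𝓧 × EuclideanSpace ℝ (Fin m)) z ζ v,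
        Function.update (observe ε κ (w, Function.update z (k + 1) ζ)) (k + 1) v =
          Function.update (observe ε κ (w, z)) (k + 1) v := by
      intro w z ζ v
      ext j : 1
      rcases eq_or_ne j (k + 1) with rfl | hj
      · simp
      · simp [observe, Function.update_of_ne hj]
    have hstep : ∀ z, ∫⁻ w, F (hidden (w, z) a) (observe ε κ (w, z)) (hidden (w, z) (k + 1))
        ∂M.law θ = ∫⁻ w, ∫⁻ x', ∫⁻ y, ENNReal.ofReal (M.q θ (w k).1 x' * M.g θ y x') *
          F (w a).1 (Function.update (observe ε κ (w, z)) (k + 1)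
            (obs ε (κ (k + 1)) y (z (k + 1)))) x' ∂M.ν ∂M.μ ∂M.law θ := by
      intro z
      have hΦ : Measurable fun w : ℤ → 𝓧 × EuclideanSpace ℝ (Fin m) =>
          F (hidden (w, z) a) (observe ε κ (w, z)) (hidden (w, z) (k + 1)) := by
        have h : Measurable fun w : ℤ → 𝓧 × EuclideanSpace ℝ (Fin m) => (w, z) :=
          measurable_prodMk_right
        exact hF.comp (((measurable_hidden a).comp h).prodMk ((hobs.comp h).prodMk
          ((measurable_hidden (k + 1)).comp h)))
      rw [hs.lintegral_update k hΦ]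
      · refine lintegral_congr fun w => ?_
        have hΦ' : Measurable fun s => F (hidden (Function.update w (k + 1) s, z) a)
            (observe ε κ (Function.update w (k + 1) s, z))
            (hidden (Function.update w (k + 1) s, z) (k + 1)) :=
          hΦ.comp (measurable_update w)
        unfold jointKernel
        rw [Kernel.lintegral_withDensity _ (M.measurable_jointDensity hθ) _ hΦ',
          Kernel.const_apply, lintegral_prod _ (by
            exact (((M.measurable_jointDensity hθ).comp measurable_prodMk_left).mul
              hΦ').aemeasurable)]
        refine lintegral_congr fun x' => lintegral_congr fun y => ?_
        rw [hupd]
        simp [hidden, Function.update_of_ne (show a ≠ k + 1 by lia)]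
      · intro w w' hww
        have h1 : hidden (w, z) a = hidden (w', z) a := by
          simp only [hidden]; rw [hww a (by lia)]
        have h2 : hidden (w, z) (k + 1) = hidden (w', z) (k + 1) := by
          simp only [hidden]; rw [hww (k + 1) le_rfl]
        rw [h1, h2]
        refine hdep _ _ _ _ fun j _ hj => ?_
        simp only [observe]; rw [hww j hj]
    have hFm : Measurable fun p : (𝓧 × (ℤ → EuclideanSpace ℝ (Fin m)) × 𝓧) ×
        EuclideanSpace ℝ (Fin m) => F p.1.1 (Function.update p.1.2.1 (k + 1) p.2) p.1.2.2 :=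
      hF.comp (measurable_fst.fst.prodMk ((measurable_update'.comp
        (measurable_fst.snd.fst.prodMk measurable_snd)).prodMk measurable_fst.snd.snd))
    have hLm : Measurable fun ω : Sample 𝓧 m =>
        F (hidden ω a) (observe ε κ ω) (hidden ω (k + 1)) :=
      hF.comp ((measurable_hidden a).prodMk (hobs.prodMk (measurable_hidden (k + 1))))
    have hRm : Measurable fun p : (Sample 𝓧 m × 𝓧) × EuclideanSpace ℝ (Fin m) =>
        ENNReal.ofReal (M.q θ (p.1.1.1 k).1 p.1.2 * M.g θ p.2 p.1.2) *
          F (p.1.1.1 a).1 (Function.update (observe ε κ p.1.1) (k + 1)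
            (obs ε (κ (k + 1)) p.2 (p.1.1.2 (k + 1)))) p.1.2 := by
      have hst : ∀ j, Measurable fun p : (Sample 𝓧 m × 𝓧) × EuclideanSpace ℝ (Fin m) =>
          (p.1.1.1 j).1 := fun j => (measurable_hidden j).comp measurable_fst.fst
      have hz : Measurable fun p : (Sample 𝓧 m × 𝓧) × EuclideanSpace ℝ (Fin m) =>
          p.1.1.2 (k + 1) := (measurable_pi_apply (k + 1)).comp measurable_fst.fst.snd
      refine Measurable.mul (Measurable.ennreal_ofReal (Measurable.mul ?_ ?_)) ?_
      · exact hq.comp ((hst k).prodMk measurable_fst.snd)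
      · exact (M.measurable_g θ hθ).comp (measurable_snd.prodMk measurable_fst.snd)
      · exact hFm.comp (((hst a).prodMk ((hobs.comp measurable_fst.fst).prodMk
          measurable_fst.snd)).prodMk ((measurable_obs ε (κ (k + 1))).comp
          (measurable_snd.prodMk hz)))
    have hRm1 : Measurable fun p : Sample 𝓧 m × 𝓧 => ∫⁻ y,
        ENNReal.ofReal (M.q θ (p.1.1 k).1 p.2 * M.g θ y p.2) *
          F (p.1.1 a).1 (Function.update (observe ε κ p.1) (k + 1)
            (obs ε (κ (k + 1)) y (p.1.2 (k + 1)))) p.2 ∂M.ν := hRm.lintegral_prod_right'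
    have hRm2 : Measurable fun ω : Sample 𝓧 m => ∫⁻ x', ∫⁻ y,
        ENNReal.ofReal (M.q θ (ω.1 k).1 x' * M.g θ y x') *
          F (ω.1 a).1 (Function.update (observe ε κ ω) (k + 1)
            (obs ε (κ (k + 1)) y (ω.2 (k + 1)))) x' ∂M.ν ∂M.μ := hRm1.lintegral_prod_right'
    have hTm : Measurable fun p : (Sample 𝓧 m × 𝓧) × EuclideanSpace ℝ (Fin m) =>
        ENNReal.ofReal (M.q θ (p.1.1.1 k).1 p.1.2 * M.obsDensity ε (κ (k + 1)) θ p.2 p.1.2) *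
          F (p.1.1.1 a).1 (Function.update (observe ε κ p.1.1) (k + 1) p.2) p.1.2 := by
      have hst : ∀ j, Measurable fun p : (Sample 𝓧 m × 𝓧) × EuclideanSpace ℝ (Fin m) =>
          (p.1.1.1 j).1 := fun j => (measurable_hidden j).comp measurable_fst.fst
      refine Measurable.mul (Measurable.ennreal_ofReal (Measurable.mul ?_ ?_)) ?_
      · exact hq.comp ((hst k).prodMk measurable_fst.snd)
      · exact (M.measurable_obsDensity ε (κ (k + 1)) hθ).comp
          (measurable_snd.prodMk measurable_fst.snd)
      · exact hFm.comp (((hst a).prodMk ((hobs.comp measurable_fst.fst).prodMk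
          measurable_fst.snd)).prodMk measurable_snd)
    have hTm1 : Measurable fun p : Sample 𝓧 m × 𝓧 => ∫⁻ v,
        ENNReal.ofReal (M.q θ (p.1.1 k).1 p.2 * M.obsDensity ε (κ (k + 1)) θ v p.2) *
          F (p.1.1 a).1 (Function.update (observe ε κ p.1) (k + 1) v) p.2
            ∂M.obsMeasure ε (κ (k + 1)) := hTm.lintegral_prod_right'
    have hTm2 : Measurable fun ω : Sample 𝓧 m => ∫⁻ x', ∫⁻ v,
        ENNReal.ofReal (M.q θ (ω.1 k).1 x' * M.obsDensity ε (κ (k + 1)) θ v x') *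
          F (ω.1 a).1 (Function.update (observe ε κ ω) (k + 1) v) x'
            ∂M.obsMeasure ε (κ (k + 1)) ∂M.μ := hTm1.lintegral_prod_right'
    have hnoise : ∀ w z, ∫⁻ ζ, ∫⁻ x', ∫⁻ y, ENNReal.ofReal (M.q θ (w k).1 x' * M.g θ y x') *
          F (w a).1 (Function.update (observe ε κ (w, z)) (k + 1)
            (obs ε (κ (k + 1)) y ζ)) x' ∂M.ν ∂M.μ ∂unifBall m =
        ∫⁻ x', ∫⁻ v, ENNReal.ofReal (M.q θ (w k).1 x' * M.obsDensity ε (κ (k + 1)) θ v x') *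
          F (w a).1 (Function.update (observe ε κ (w, z)) (k + 1) v) x'
            ∂M.obsMeasure ε (κ (k + 1)) ∂M.μ := by
      intro w z
      have hψ : ∀ x', Measurable fun v => F (w a).1
          (Function.update (observe ε κ (w, z)) (k + 1) v) x' := fun x' =>
        hFm.comp (measurable_prodMk_left (x := ((w a).1, observe ε κ (w, z), x')))
      have hm3 : Measurable fun p : (EuclideanSpace ℝ (Fin m) × 𝓧) × EuclideanSpace ℝ (Fin m) =>
          ENNReal.ofReal (M.q θ (w k).1 p.1.2 * M.g θ p.2 p.1.2) *
          F (w a).1 (Function.update (observe ε κ (w, z)) (k + 1)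
            (obs ε (κ (k + 1)) p.2 p.1.1)) p.1.2 := by
        refine Measurable.mul (Measurable.ennreal_ofReal (Measurable.mul ?_ ?_)) ?_
        · exact hq.comp (measurable_const.prodMk measurable_fst.snd)
        · exact (M.measurable_g θ hθ).comp (measurable_snd.prodMk measurable_fst.snd)
        · exact hFm.comp ((measurable_const.prodMk (measurable_const.prodMk
            measurable_fst.snd)).prodMk ((measurable_obs ε (κ (k + 1))).comp
            (measurable_snd.prodMk measurable_fst.fst)))
      rw [lintegral_lintegral_swap (by exact hm3.lintegral_prod_right'.aemeasurable)]
      refine lintegral_congr fun x' => ?_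
      have hm4 : Measurable fun p : EuclideanSpace ℝ (Fin m) × EuclideanSpace ℝ (Fin m) =>
          ENNReal.ofReal (M.q θ (w k).1 x' * M.g θ p.2 x') *
          F (w a).1 (Function.update (observe ε κ (w, z)) (k + 1)
            (obs ε (κ (k + 1)) p.2 p.1)) x' :=
        hm3.comp ((measurable_fst.prodMk measurable_const).prodMk measurable_snd)
      rw [lintegral_lintegral_swap (by exact hm4.aemeasurable)]
      have hq0 := M.q_nonneg θ hθ (w k).1 x'
      have h1 := M.lintegral_obs hε (κ (k + 1)) hθ x' (hψ x')
      simp_rw [ENNReal.ofReal_mul hq0, mul_assoc]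
      have hgm : Measurable fun y => ENNReal.ofReal (M.g θ y x') :=
        ((M.measurable_g θ hθ).comp measurable_prodMk_right).ennreal_ofReal
      have hom : Measurable fun v => ENNReal.ofReal (M.obsDensity ε (κ (k + 1)) θ v x') :=
        ((M.measurable_obsDensity ε (κ (k + 1)) hθ).comp measurable_prodMk_right).ennreal_ofReal
      have hoψ : Measurable fun v => ENNReal.ofReal (M.obsDensity ε (κ (k + 1)) θ v x') *
          F (w a).1 (Function.update (observe ε κ (w, z)) (k + 1) v) x' := hom.mul (hψ x')
      rw [lintegral_const_mul _ hoψ, ← h1]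
      have hψo : Measurable fun p : EuclideanSpace ℝ (Fin m) × EuclideanSpace ℝ (Fin m) =>
          F (w a).1 (Function.update (observe ε κ (w, z)) (k + 1) (obs ε (κ (k + 1)) p.1 p.2)) x' :=
        (hψ x').comp (measurable_obs ε (κ (k + 1)))
      rw [← lintegral_const_mul _ (by exact hgm.mul hψo.lintegral_prod_right')]
      refine lintegral_congr fun y => ?_
      have hψy : Measurable fun ζ => F (w a).1
          (Function.update (observe ε κ (w, z)) (k + 1) (obs ε (κ (k + 1)) y ζ)) x' :=
        hψo.comp measurable_prodMk_left
      rw [lintegral_const_mul _ (hψy.const_mul _), lintegral_const_mul _ hψy]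
    change ∫⁻ ω, F (hidden ω a) (observe ε κ ω) (hidden ω (k + 1)) ∂(M.law θ).prod N =
      ∫⁻ ω, ∫⁻ x', ∫⁻ v,
        ENNReal.ofReal (M.q θ (ω.1 k).1 x' * M.obsDensity ε (κ (k + 1)) θ v x') *
          F (ω.1 a).1 (Function.update (observe ε κ ω) (k + 1) v) x'
            ∂M.obsMeasure ε (κ (k + 1)) ∂M.μ ∂(M.law θ).prod N
    rw [lintegral_prod_symm _ hLm.aemeasurable, lintegral_congr hstep,
      lintegral_lintegral_swap (by exact (hRm2.comp measurable_swap).aemeasurable),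
      lintegral_prod _ hTm2.aemeasurable]
    refine lintegral_congr fun w => ?_
    -- The old noise at `k + 1` disappears, because the observation at that time is overwritten
    -- anyway.
    rw [hN, lintegral_infinitePi_update _ (k + 1) (by exact hRm2.comp measurable_prodMk_left)]
    refine lintegral_congr fun z => ?_
    simp only [hupd', Function.update_self]
    exact hnoise w z

end HMMFamily

end

/-! ### Admissible sequences and the conditional densities of the model -/

section

open scoped ENNReal

namespace HMMFamily

open RegularModel

variable {𝓧 : Type*} [MeasurableSpace 𝓧] {d m : ℕ}

lemma nonempty_hidden (M : HMMFamily 𝓧 d m) {θ : EuclideanSpace ℝ (Fin d)} (hθ : θ ∈ M.Θ) :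
    Nonempty 𝓧 := by
  have := (M.law_stationary θ hθ).isProbabilityMeasure
  obtain ⟨ω⟩ := nonempty_of_isProbabilityMeasure (M.law θ)
  exact ⟨(ω 0).1⟩

lemma neZero_μ (M : HMMFamily 𝓧 d m) {θ : EuclideanSpace ℝ (Fin d)} (hθ : θ ∈ M.Θ) :
    NeZero M.μ := by
  obtain ⟨x⟩ := M.nonempty_hidden hθ
  refine ⟨fun h => ?_⟩
  have := M.integral_q θ hθ x
  rw [h, integral_zero_measure] at this
  exact zero_ne_one this

/-- The points at which the density of an observation is specified. -/
def obsSupport (M : HMMFamily 𝓧 d m) (ε : ℝ) : ObsKind → Set (EuclideanSpace ℝ (Fin m))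
  | .clean => M.𝒴
  | .noisy => {v | M.ν (Metric.closedBall v ε) ≠ 0}
  | .missing => univ

lemma measurableSet_obsSupport (M : HMMFamily 𝓧 d m) (ε : ℝ) (κ : ObsKind) :
    MeasurableSet (M.obsSupport ε κ) := by
  cases κ
  · exact M.measurableSet_𝒴
  · exact (M.measurable_measure_closedBall ε (measurableSet_singleton 0)).compl
  · exact .univ

lemma ae_mem_obsSupport (M : HMMFamily 𝓧 d m) {ε : ℝ} (hε : 0 < ε) (κ : ObsKind) :
    ∀ᵐ v ∂M.obsMeasure ε κ, v ∈ M.obsSupport ε κ := by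
  cases κ
  · exact M.ae_mem_𝒴
  · exact M.ae_νNoisy hε
  · exact Eventually.of_forall fun _ => mem_univ _

/-- Observation sequences along which all the densities are specified. -/
def admissible (M : HMMFamily 𝓧 d m) (ε : ℝ) (κ : ℤ → ObsKind) :
    Set (ℤ → EuclideanSpace ℝ (Fin m)) :=
  {u | ∀ k, u k ∈ M.obsSupport ε (κ k)}

lemma ae_observe_mem (M : HMMFamily 𝓧 d m) {ε : ℝ} (hε : 0 < ε) (κ : ℤ → ObsKind)
    {θ : EuclideanSpace ℝ (Fin d)} (hθ : θ ∈ M.Θ) :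
    ∀ᵐ ω ∂M.P θ, observe ε κ ω ∈ M.admissible ε κ := by
  have h : ∀ᵐ ω ∂M.P θ, ∀ k, observe ε κ ω k ∈ M.obsSupport ε (κ k) := by
    rw [ae_all_iff]
    exact fun k => (M.isObservedChain hε κ hθ).ae_of_ae k (M.measurableSet_obsSupport ε (κ k))
      (M.ae_mem_obsSupport hε (κ k))
  exact h

/-- The likelihood functions of a sequence of observations of the kinds `κ`. -/
def patLik (M : HMMFamily 𝓧 d m) (ε : ℝ) (κ : ℤ → ObsKind) (θ : EuclideanSpace ℝ (Fin d))
    (u : ℤ → EuclideanSpace ℝ (Fin m)) (k : ℤ) : 𝓧 → ℝ :=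
  M.obsDensity ε (κ k) θ (u k)

lemma patLik_congr (M : HMMFamily 𝓧 d m) (ε : ℝ) {κ : ℤ → ObsKind}
    (θ : EuclideanSpace ℝ (Fin d)) {u u' : ℤ → EuclideanSpace ℝ (Fin m)}
    (h : ∀ k, κ k ≠ .missing → u k = u' k) : M.patLik ε κ θ u = M.patLik ε κ θ u' := by
  ext k x
  unfold patLik
  by_cases hk : κ k = .missing
  · rw [hk]; rfl
  · rw [h k hk]

lemma observe_congr (ε : ℝ) {κ κ' : ℤ → ObsKind} (hκ : ∀ k, κ k ≠ .missing → κ' k = κ k)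
    (ω : Sample 𝓧 m) : ∀ k, κ k ≠ .missing → observe ε κ' ω k = observe ε κ ω k := by
  intro k hk
  unfold observe
  rw [hκ k hk]

lemma gradient_apply (f : EuclideanSpace ℝ (Fin d) → ℝ) (θ : EuclideanSpace ℝ (Fin d))
    (i : Fin d) : gradient f θ i = fderiv ℝ f θ (EuclideanSpace.single i 1) := by
  have h : inner ℝ (gradient f θ) (EuclideanSpace.single i (1 : ℝ)) =
      fderiv ℝ f θ (EuclideanSpace.single i 1) := by
    rw [gradient, InnerProductSpace.toDual_symm_apply]
  rw [← h, EuclideanSpace.inner_single_right]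
  simp

namespace Regular

variable {M : HMMFamily 𝓧 d m} {G : Set (EuclideanSpace ℝ (Fin d))} {c C S : ℝ} {ε : ℝ}
  [Nonempty 𝓧] [NeZero M.μ]

lemma log_eventuallyEq (H : M.Regular G c C S) {θ₀ : EuclideanSpace ℝ (Fin d)} (hθ₀ : θ₀ ∈ G)
    {κ κ' : ℤ → ObsKind} {t : ℤ}
    {p : EuclideanSpace ℝ (Fin d) → (ℤ → EuclideanSpace ℝ (Fin m)) → ℝ}
    (hp : ∀ θ ∈ M.Θ, ∀ u ∈ M.admissible ε κ',
      p θ u = condDensity (M.q θ) M.μ (M.patLik ε κ θ u) t)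
    {u : ℤ → EuclideanSpace ℝ (Fin m)} (hu : u ∈ M.admissible ε κ') :
    (fun θ => Real.log (p θ u)) =ᶠ[𝓝 θ₀]
      fun θ => Real.log (condDensity (M.q θ) M.μ (M.patLik ε κ θ u) t) := by
  filter_upwards [H.isOpen.mem_nhds hθ₀] with θ hθ
  rw [hp θ (H.subset hθ) u hu]

/-- The conditional density of one observation given the others of the kinds `κ`. -/
lemma isCondDensity (H : M.Regular G c C S) (hε : 0 < ε) {θ₀ : EuclideanSpace ℝ (Fin d)}
    (hθ₀ : θ₀ ∈ G) {κ κ' : ℤ → ObsKind} (hκ : ∀ k, κ k ≠ .missing → κ' k = κ k) {t : ℤ}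
    (ht : κ t ≠ .missing) {ι : Type*} {l : Filter ι}
    {p : EuclideanSpace ℝ (Fin d) → (ℤ → EuclideanSpace ℝ (Fin m)) → ℝ}
    {w : EuclideanSpace ℝ (Fin d) → (ℤ → EuclideanSpace ℝ (Fin m)) → ι → ℝ}
    (hp : ∀ θ ∈ M.Θ, ∀ u ∈ M.admissible ε κ',
      p θ u = condDensity (M.q θ) M.μ (M.patLik ε κ θ u) t)
    (hw : ∀ θ ∈ M.Θ, ∀ u ∈ M.admissible ε κ', Tendsto (w θ u) l
      (𝓝 (condDensity (M.q θ) M.μ (M.patLik ε κ θ u) t)))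
    {𝒢 : MeasurableSpace (Sample 𝓧 m)}
    (h𝒢 : 𝒢 = MeasurableSpace.comap (fun ω => Function.update (observe ε κ ω) t 0)
      MeasurableSpace.pi) :
    M.IsCondDensity θ₀ p l w (M.admissible ε κ') (observe ε κ') t 𝒢 (M.obsMeasure ε (κ t)) := by
  -- `κ` is the pattern conditioned on, possibly with missing observations, and `κ'` that of the
  -- process in the statement. They agree wherever `κ` is not missing, and the likelihoods for `κ`
  -- ignore all other times, so the two sequences are interchangeable inside the densities.
  subst h𝒢
  have HM := H.regularModel hε κ
  obtain ⟨B, hB0, hB⟩ := HM.exists_windowScore_bound hθ₀ t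
  refine ⟨fun θ hθ u hu => ?_, fun θ hθ u hu => ?_, fun θ hθ => M.ae_observe_mem hε κ' hθ,
    fun θ hθ A hA => ?_, fun u hu => ?_, ?_⟩
  · rw [hp θ hθ u hu]; exact hw θ hθ u hu
  · rw [hp θ hθ u hu]
    exact ((HM.emission θ hθ).regular u).condDensity_pos t
  · have := M.isProbabilityMeasure_P hθ
    have h1 := (M.isObservedChain hε κ hθ).condLaw (HM.emission θ hθ) t 0 hA
    have e1 : ∀ ω : Sample 𝓧 m, observe ε κ' ω t = observe ε κ ω t := fun ω =>
      observe_congr ε hκ ω t ht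
    simp_rw [e1]
    refine h1.trans ?_
    filter_upwards [M.ae_observe_mem hε κ' hθ] with ω hω
    refine integral_congr_ae ?_
    -- The formula for `p` is available along admissible sequences only, so the value inserted at
    -- time `t` must lie in the support, as it does almost everywhere.
    filter_upwards [ae_restrict_of_ae (M.ae_mem_obsSupport hε (κ t))] with v hv
    have hadm : Function.update (observe ε κ' ω) t v ∈ M.admissible ε κ' := by
      intro k
      rcases eq_or_ne k t with rfl | hk
      · rw [Function.update_self, hκ k ht]; exact hv
      · rw [Function.update_of_ne hk]; exact hω k
    rw [hp θ hθ _ hadm]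
    have h2 := M.patLik_congr ε (κ := κ) θ (u := Function.update (observe ε κ' ω) t v)
      (u' := Function.update (observe ε κ ω) t v) fun k hk => by
        rcases eq_or_ne k t with rfl | hkt
        · simp
        · rw [Function.update_of_ne hkt, Function.update_of_ne hkt, observe_congr ε hκ ω k hk]
    rw [h2]
    rfl
  · exact (hB u).1.congr_of_eventuallyEq (H.log_eventuallyEq hθ₀ hp hu)
  · have hΘ := H.subset hθ₀
    have := M.isProbabilityMeasure_P hΘ
    have hm : StronglyMeasurable fun u => limScore M.μ M.q
        (fun θ k => M.obsDensity ε (κ k) θ) θ₀ t u :=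
      stronglyMeasurable_of_apply fun e => HM.measurable_limScore hθ₀ t e
    have hm' : StronglyMeasurable fun ω : Sample 𝓧 m =>
        (InnerProductSpace.toDual ℝ (EuclideanSpace ℝ (Fin d))).symm (limScore M.μ M.q
          (fun θ k => M.obsDensity ε (κ k) θ) θ₀ t (observe ε κ' ω)) :=
      (LinearIsometryEquiv.continuous _).comp_stronglyMeasurable
        (hm.comp_measurable (measurable_observe ε κ'))
    -- The score coincides almost surely with the limit score, which is bounded.
    refine MemLp.ae_eq ?_ (MemLp.of_bound (p := 2) hm'.aestronglyMeasurable B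
      (Eventually.of_forall fun ω => ?_))
    · filter_upwards [M.ae_observe_mem hε κ' hΘ] with ω hω
      unfold score gradient
      rw [(H.log_eventuallyEq hθ₀ hp hω).fderiv_eq]
      rfl
    · rw [LinearIsometryEquiv.norm_map]; exact (hB _).2.1

/-- The information matrix of one observation given the others of the kinds `κ`. -/
lemma integral_score_mul_score (H : M.Regular G c C S) (hε : 0 < ε)
    {θ₀ : EuclideanSpace ℝ (Fin d)} (hθ₀ : θ₀ ∈ G) {κ κ' : ℤ → ObsKind}
    (hκ : ∀ k, κ k ≠ .missing → κ' k = κ k) {t : ℤ}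
    {p : EuclideanSpace ℝ (Fin d) → (ℤ → EuclideanSpace ℝ (Fin m)) → ℝ}
    (hp : ∀ θ ∈ M.Θ, ∀ u ∈ M.admissible ε κ',
      p θ u = condDensity (M.q θ) M.μ (M.patLik ε κ θ u) t) (i j : Fin d) :
    ∫ ω, score p θ₀ (observe ε κ' ω) i * score p θ₀ (observe ε κ' ω) j ∂M.P θ₀ =
      ∫ ω, limScore M.μ M.q (fun θ k => M.obsDensity ε (κ k) θ) θ₀ t (observe ε κ ω)
          (EuclideanSpace.single i 1) *
        limScore M.μ M.q (fun θ k => M.obsDensity ε (κ k) θ) θ₀ t (observe ε κ ω)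
          (EuclideanSpace.single j 1) ∂M.P θ₀ := by
  refine integral_congr_ae ?_
  filter_upwards [M.ae_observe_mem hε κ' (H.subset hθ₀)] with ω hω
  have h1 : fderiv ℝ (fun θ => Real.log (p θ (observe ε κ' ω))) θ₀ =
      limScore M.μ M.q (fun θ k => M.obsDensity ε (κ k) θ) θ₀ t (observe ε κ ω) := by
    rw [(H.log_eventuallyEq hθ₀ hp hω).fderiv_eq]
    unfold limScore
    congr 1
    ext θ
    rw [M.patLik_congr ε θ (observe_congr ε hκ ω)]
    rfl
  unfold score
  rw [gradient_apply, gradient_apply, h1]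

end Regular

end HMMFamily

end

/-! ### The telescoping argument -/

/-- Two ways of exchanging one kind of observation for another, one at a time, lead to the same
rates. -/
lemma eq_add_of_telescoping {F : ℕ → ℕ → ℝ} {I I' D r B : ℝ} (hr0 : 0 ≤ r) (hr1 : r < 1)
    (hB : 0 ≤ B) (h1 : ∀ j, |F (j + 1) 0 - F j 0 - I| ≤ B * r ^ (j + 1))
    (h2 : ∀ j, |F 0 (j + 1) - F 0 j - I'| ≤ B * r ^ (j + 1))
    (h3 : ∀ n k, |F (n + 1) k - F n (k + 1) - D| ≤ B * (r ^ (n + 1) + r ^ k)) : I = I' + D := by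
  have hgeo : ∀ n : ℕ, ∑ j ∈ Finset.range n, r ^ j ≤ (1 - r)⁻¹ := fun n => by
    rw [← tsum_geometric_of_lt_one hr0 hr1]
    exact (summable_geometric_of_lt_one hr0 hr1).sum_le_tsum _ fun j _ => pow_nonneg hr0 j
  have hpow : ∀ j : ℕ, r ^ (j + 1) ≤ r ^ j := fun j => pow_le_pow_of_le_one hr0 hr1.le (by lia)
  -- Increments summably close to `a` make `f T` equal to `f 0 + T * a` up to a bounded error.
  have key : ∀ (f : ℕ → ℝ) (a : ℝ), (∀ j, |f (j + 1) - f j - a| ≤ B * r ^ (j + 1)) →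
      ∀ T : ℕ, |f T - f 0 - T * a| ≤ B * (1 - r)⁻¹ := by
    intro f a hf T
    have h : |f T - f 0 - T * a| ≤ B * ∑ j ∈ Finset.range T, r ^ j := by
      induction T with
      | zero => simp
      | succ T ih =>
        rw [Finset.sum_range_succ, mul_add]
        have e : f (T + 1) - f 0 - ((T + 1 : ℕ) : ℝ) * a =
            (f T - f 0 - T * a) + (f (T + 1) - f T - a) := by push_cast; ring
        rw [e]
        exact (abs_add_le _ _).trans (add_le_add ih ((hf T).trans
          (mul_le_mul_of_nonneg_left (hpow T) hB)))
    exact h.trans (mul_le_mul_of_nonneg_left (hgeo T) hB)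
  -- Each exchange moves along the antidiagonal. One part of its error decays in the first index and
  -- the other in the second; both sum to at most a geometric series.
  have hdiag : ∀ i k : ℕ, |F i k - F 0 (i + k) - i * D| ≤
      B * (∑ j ∈ Finset.range i, r ^ j + ∑ j ∈ Finset.range i, r ^ (k + j)) := by
    intro i
    induction i with
    | zero => intro k; simp
    | succ i ih =>
      intro k
      have h4 := ih (k + 1)
      have e1 : i + (k + 1) = i + 1 + k := by ring
      rw [e1] at h4
      have e : F (i + 1) k - F 0 (i + 1 + k) - ((i + 1 : ℕ) : ℝ) * D =
          (F i (k + 1) - F 0 (i + 1 + k) - i * D) + (F (i + 1) k - F i (k + 1) - D) := by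
        push_cast; ring
      rw [e, Finset.sum_range_succ, Finset.sum_range_succ' (fun j => r ^ (k + j))]
      refine (abs_add_le _ _).trans ((add_le_add h4 ((h3 i k).trans (mul_le_mul_of_nonneg_left
        (add_le_add_left (hpow i) _) hB))).trans_eq ?_)
      have e2 : ∑ j ∈ Finset.range i, r ^ (k + (j + 1)) = ∑ j ∈ Finset.range i, r ^ (k + 1 + j) :=
        Finset.sum_congr rfl fun j _ => by rw [add_assoc, add_comm 1 j]
      rw [e2, add_zero]
      ring
  -- Both routes from `F T 0` to `F 0 T` are exact up to a constant independent of `T`, which `T`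
  -- times a nonzero discrepancy would eventually exceed.
  have hfin : ∀ T : ℕ, (T : ℝ) * |I - I' - D| ≤ 4 * (B * (1 - r)⁻¹) := by
    intro T
    have a1 := key (fun j => F j 0) I h1 T
    have a2 := key (fun j => F 0 j) I' h2 T
    have a3 : |F T 0 - F 0 T - T * D| ≤ 2 * (B * (1 - r)⁻¹) := by
      refine (hdiag T 0).trans ?_
      simp only [zero_add]
      nlinarith [mul_le_mul_of_nonneg_left (hgeo T) hB]
    have e : (T : ℝ) * |I - I' - D| = |(T : ℝ) * (I - I' - D)| := by
      rw [abs_mul, Nat.abs_cast]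
    rw [e, abs_le]
    rw [abs_le] at a1 a2 a3
    constructor <;> nlinarith [a1.1, a1.2, a2.1, a2.2, a3.1, a3.2]
  by_contra hne
  have hpos : 0 < |I - I' - D| := abs_pos.2 fun h => hne (by linarith)
  obtain ⟨T, hT⟩ := exists_nat_gt (4 * (B * (1 - r)⁻¹) / |I - I' - D|)
  rw [div_lt_iff₀ hpos] at hT
  exact absurd (hfin T) (not_le.2 hT)

/-! ### Information in windows and the principle for one matrix entry -/

namespace HMMFamily

open RegularModel

variable {𝓧 : Type*} [MeasurableSpace 𝓧] {d m : ℕ}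

/-- Clean observations before time `s`, noisy ones from time `s` on. -/
def mixKind (s k : ℤ) : ObsKind := if k < s then .clean else .noisy

/-- Observations of kind `κ` up to time `1`, no observations afterwards. -/
def predKind (κ : ObsKind) (k : ℤ) : ObsKind := if k ≤ 1 then κ else .missing

/-- The `(v, v')` entry of the information about `θ` in the observations at the times
`a + 1, …, a + n` given the hidden state at time `a`. -/
def windowInfo (M : HMMFamily 𝓧 d m) (ε : ℝ) (θ v v' : EuclideanSpace ℝ (Fin d))
    (κ : ℤ → ObsKind) (a : ℤ) (n : ℕ) : ℝ :=
  ∫ ω, fullScore M.μ M.q (fun θ k => M.obsDensity ε (κ k) θ) θ n a (hidden ω a) (observe ε κ ω) v *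
    fullScore M.μ M.q (fun θ k => M.obsDensity ε (κ k) θ) θ n a (hidden ω a) (observe ε κ ω) v'
      ∂M.P θ

/-- The `(v, v')` entry of the information about `θ` in the observation at time `t` given the
other observations at the times `a + 1, …, a + n` and the hidden state at time `a`. -/
def condInfo (M : HMMFamily 𝓧 d m) (ε : ℝ) (θ v v' : EuclideanSpace ℝ (Fin d))
    (κ : ℤ → ObsKind) (t a : ℤ) (n : ℕ) : ℝ :=
  ∫ ω, windowScore M.μ M.q (fun θ k => M.obsDensity ε (κ k) θ) θ t n a (hidden ω a)
      (observe ε κ ω) v *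
    windowScore M.μ M.q (fun θ k => M.obsDensity ε (κ k) θ) θ t n a (hidden ω a)
      (observe ε κ ω) v' ∂M.P θ

/-- The `(v, v')` entry of the information about `θ` in the observation at time `t` given all the
other observations. -/
def limInfo (M : HMMFamily 𝓧 d m) (ε : ℝ) [Nonempty 𝓧] (θ v v' : EuclideanSpace ℝ (Fin d))
    (κ : ℤ → ObsKind) (t : ℤ) : ℝ :=
  ∫ ω, limScore M.μ M.q (fun θ k => M.obsDensity ε (κ k) θ) θ t (observe ε κ ω) v *
    limScore M.μ M.q (fun θ k => M.obsDensity ε (κ k) θ) θ t (observe ε κ ω) v' ∂M.P θ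

lemma windowInfo_congr (M : HMMFamily 𝓧 d m) (ε : ℝ) (θ v v' : EuclideanSpace ℝ (Fin d))
    {κ κ' : ℤ → ObsKind} {a : ℤ} {n : ℕ} (h : ∀ k, a < k → k ≤ a + n → κ k = κ' k) :
    M.windowInfo ε θ v v' κ a n = M.windowInfo ε θ v v' κ' a n := by
  have e : ∀ ω : Sample 𝓧 m,
      fullScore M.μ M.q (fun θ k => M.obsDensity ε (κ k) θ) θ n a (hidden ω a) (observe ε κ ω) =
      fullScore M.μ M.q (fun θ k => M.obsDensity ε (κ' k) θ) θ n a (hidden ω a)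
        (observe ε κ' ω) := fun ω => by
    refine logLikDeriv_congr θ (fun ϑ k h1 h2 => ?_) _
    simp only [observe, h k h1 h2]
  simp only [windowInfo, e]

lemma fullScore_shift (M : HMMFamily 𝓧 d m) (ε : ℝ) (θ : EuclideanSpace ℝ (Fin d))
    (κ : ℤ → ObsKind) (a : ℤ) (n : ℕ) (ω : Sample 𝓧 m) :
    fullScore M.μ M.q (fun θ k => M.obsDensity ε (κ (k + 1)) θ) θ n a (hidden (shift ω) a)
      (observe ε (fun k => κ (k + 1)) (shift ω)) =
    fullScore M.μ M.q (fun θ k => M.obsDensity ε (κ k) θ) θ n (a + 1) (hidden ω (a + 1))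
      (observe ε κ ω) := by
  unfold fullScore RegularFamily.logLikDeriv
  congr 1
  ext ϑ
  rw [← lik_shift (h := fun k => M.obsDensity ε (κ k) ϑ (observe ε κ ω k)) n a 1]
  rfl

namespace Regular

variable {M : HMMFamily 𝓧 d m} {G : Set (EuclideanSpace ℝ (Fin d))} {c C S : ℝ} {ε : ℝ}
  {θ : EuclideanSpace ℝ (Fin d)}

lemma measurable_fullScore (H : M.Regular G c C S) (hε : 0 < ε) (hθ : θ ∈ G)
    (κ : ℤ → ObsKind) (a : ℤ) (n : ℕ) (v : EuclideanSpace ℝ (Fin d)) :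
    Measurable fun ω : Sample 𝓧 m => fullScore M.μ M.q (fun θ k => M.obsDensity ε (κ k) θ) θ n a
      (hidden ω a) (observe ε κ ω) v := by
  have HM := H.regularModel hε κ
  have h1 : Measurable fun ω : Sample 𝓧 m => (hidden ω a, observe ε κ ω) :=
    (measurable_hidden a).prodMk (measurable_observe ε κ)
  have h2 := ((HM.measurable_restScore hθ 0 n a v).comp h1).add
    ((HM.measurable_windowScore hθ 0 n a v).comp h1)
  convert h2 using 1
  ext ω
  rw [HM.fullScore_eq hθ 0]
  rfl

lemma windowInfo_shift (H : M.Regular G c C S) (hε : 0 < ε) (hθ : θ ∈ G)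
    (v v' : EuclideanSpace ℝ (Fin d)) (κ : ℤ → ObsKind) (a : ℤ) (n : ℕ) :
    M.windowInfo ε θ v v' (fun k => κ (k + 1)) a n = M.windowInfo ε θ v v' κ (a + 1) n := by
  refine (M.integral_shift (H.subset hθ) ((H.measurable_fullScore hε hθ (fun k => κ (k + 1)) a n
    v).mul (H.measurable_fullScore hε hθ (fun k => κ (k + 1)) a n v'))).symm.trans ?_
  refine integral_congr_ae (Eventually.of_forall fun ω => ?_)
  exact congrArg (fun A : EuclideanSpace ℝ (Fin d) →L[ℝ] ℝ => A v * A v')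
    (M.fullScore_shift ε θ κ a n ω)

lemma windowInfo_const (H : M.Regular G c C S) (hε : 0 < ε) (hθ : θ ∈ G)
    (v v' : EuclideanSpace ℝ (Fin d)) (κ : ObsKind) (j n : ℕ) :
    M.windowInfo ε θ v v' (fun _ => κ) (-(j : ℤ)) n = M.windowInfo ε θ v v' (fun _ => κ) 0 n := by
  induction j with
  | zero => simp
  | succ j ih =>
    rw [← ih, H.windowInfo_shift hε hθ v v' (fun _ => κ)]
    congr 1
    push_cast; ring

/-- Appending one observation. -/
lemma windowInfo_const_succ (H : M.Regular G c C S) (hε : 0 < ε) (hθ : θ ∈ G)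
    (v v' : EuclideanSpace ℝ (Fin d)) (κ : ObsKind) (j : ℕ) :
    M.windowInfo ε θ v v' (fun _ => κ) 0 (j + 1) - M.windowInfo ε θ v v' (fun _ => κ) 0 j =
      M.condInfo ε θ v v' (predKind κ) 1 (1 - ((j + 1 : ℕ) : ℤ)) (j + 1) := by
  have HM := H.regularModel hε (predKind κ)
  have hΘ := H.subset hθ
  have := M.isProbabilityMeasure_P hΘ
  have ea : (1 : ℤ) - ((j + 1 : ℕ) : ℤ) = -(j : ℤ) := by push_cast; ring
  rw [ea]
  have h1 := HM.integral_fullScore_mul_fullScore hθ (M.isObservedChain hε (predKind κ) hΘ)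
    (t := 1) (n := j + 1) (a := -(j : ℤ)) (by lia) (by push_cast; lia) v v'
  have h2 : M.windowInfo ε θ v v' (fun _ => κ) 0 (j + 1) =
      M.windowInfo ε θ v v' (predKind κ) (-(j : ℤ)) (j + 1) := by
    rw [← H.windowInfo_const hε hθ v v' κ j]
    refine M.windowInfo_congr ε θ v v' fun k _ hk => ?_
    simp only [predKind, if_pos (show k ≤ 1 by push_cast at hk; lia)]
  -- Erasing the last observation, at time `1`, shortens the window by one, so the rest score is the
  -- full score of the shorter window.
  have h3 : ∀ ω : Sample 𝓧 m, restScore M.μ M.q (fun θ k => M.obsDensity ε (predKind κ k) θ) θ 1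
      (j + 1) (-(j : ℤ)) (hidden ω (-(j : ℤ))) (observe ε (predKind κ) ω) =
      fullScore M.μ M.q (fun θ _ => M.obsDensity ε κ θ) θ j (-(j : ℤ)) (hidden ω (-(j : ℤ)))
        (observe ε (fun _ => κ) ω) := by
    intro ω
    refine Filter.EventuallyEq.fderiv_eq ?_
    filter_upwards [H.isOpen.mem_nhds hθ] with ϑ hϑ
    have R := (((HM.family (observe ε (predKind κ) ω)).regular ϑ hϑ).update_one 1)
    rw [R.lik_add_of_one (n := j) (l := 1) fun k hk hk' => ?_]
    · rw [lik_congr fun k _ hk => ?_]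
      rw [Function.update_of_ne (by lia)]
      simp only [observe, predKind, if_pos (show k ≤ 1 by lia)]
    · have : k = 1 := by push_cast at hk'; lia
      subst this
      simp
  simp_rw [h3] at h1
  rw [h2, ← H.windowInfo_const hε hθ v v' κ j]
  unfold windowInfo condInfo
  rw [h1]
  ring

/-- Replacing the last clean observation by a noisy one. -/
lemma windowInfo_mix_sub (H : M.Regular G c C S) (hε : 0 < ε) (hθ : θ ∈ G)
    (v v' : EuclideanSpace ℝ (Fin d)) (n k : ℕ) :
    M.windowInfo ε θ v v' (mixKind 1) (-((n + 1 : ℕ) : ℤ)) (n + 1 + k) -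
        M.windowInfo ε θ v v' (mixKind 1) (-(n : ℤ)) (n + (k + 1)) =
      M.condInfo ε θ v v' (mixKind 1) 0 (0 - ((n + 1 : ℕ) : ℤ)) (n + 1 + k) -
        M.condInfo ε θ v v' (mixKind 0) 0 (0 - ((n + 1 : ℕ) : ℤ)) (n + 1 + k) := by
  have hΘ := H.subset hθ
  have := M.isProbabilityMeasure_P hΘ
  have ea : (0 : ℤ) - ((n + 1 : ℕ) : ℤ) = -((n + 1 : ℕ) : ℤ) := by ring
  rw [ea]
  have h1 := fun s => (H.regularModel hε (mixKind s)).integral_fullScore_mul_fullScore hθ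
    (M.isObservedChain hε (mixKind s) hΘ) (t := 0) (n := n + 1 + k) (a := -((n + 1 : ℕ) : ℤ))
    (by push_cast; lia) (by push_cast; lia) v v'
  -- Shifted by one, the window with `n` clean observations covers the same times as the one with `n
  -- + 1`; the two patterns differ at time `0` only.
  have h2 : M.windowInfo ε θ v v' (mixKind 1) (-(n : ℤ)) (n + (k + 1)) =
      M.windowInfo ε θ v v' (mixKind 0) (-((n + 1 : ℕ) : ℤ)) (n + 1 + k) := by
    have e0 : mixKind 0 = fun k => mixKind 1 (k + 1) := by
      ext j
      have hj : j < 0 ↔ j + 1 < 1 := by lia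
      simp only [mixKind, hj]
    have e1 : -((n + 1 : ℕ) : ℤ) + 1 = -(n : ℤ) := by push_cast; ring
    have e2 : n + (k + 1) = n + 1 + k := by ring
    rw [e0, H.windowInfo_shift hε hθ v v' (mixKind 1), e1, e2]
  -- The scores of the observations at times other than `0` agree, so their information cancels
  -- between the two chain rules.
  have h3 : ∀ ω : Sample 𝓧 m, restScore M.μ M.q (fun θ k => M.obsDensity ε (mixKind 1 k) θ) θ 0
      (n + 1 + k) (-((n + 1 : ℕ) : ℤ)) (hidden ω (-((n + 1 : ℕ) : ℤ))) (observe ε (mixKind 1) ω) =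
      restScore M.μ M.q (fun θ k => M.obsDensity ε (mixKind 0 k) θ) θ 0
      (n + 1 + k) (-((n + 1 : ℕ) : ℤ)) (hidden ω (-((n + 1 : ℕ) : ℤ)))
        (observe ε (mixKind 0) ω) := by
    intro ω
    refine logLikDeriv_congr θ (fun ϑ j _ _ => ?_) _
    rcases eq_or_ne j 0 with rfl | hj
    · simp
    · have hj' : mixKind 1 j = mixKind 0 j := by
        have : j < 1 ↔ j < 0 := by lia
        simp only [mixKind, this]
      simp only [Function.update_of_ne hj, observe, hj']
  have h11 := h1 1
  simp_rw [h3] at h11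
  rw [h2]
  unfold windowInfo condInfo
  rw [h11, h1 0]
  ring

/-- The missing information principle, for one entry of the information matrices. -/
lemma limInfo_eq [Nonempty 𝓧] [NeZero M.μ] (H : M.Regular G c C S) (hε : 0 < ε) (hθ : θ ∈ G)
    (v v' : EuclideanSpace ℝ (Fin d)) :
    M.limInfo ε θ v v' (predKind .clean) 1 = M.limInfo ε θ v v' (predKind .noisy) 1 +
      (M.limInfo ε θ v v' (mixKind 1) 0 - M.limInfo ε θ v v' (mixKind 0) 0) := by
  have hΘ := H.subset hθ
  have := M.isProbabilityMeasure_P hΘ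
  have hr0 := rate_pos H.c_pos (H.c_le_one.trans H.one_le_C)
  have hr1 := rate_lt_one H.c_pos H.C_pos
  have hpred := fun κ => (H.regularModel hε (predKind κ)).exists_integral_windowScore_bound_of_one
    (P := M.P θ) hθ measurable_hidden (measurable_observe ε (predKind κ)) 1
    (fun ϑ k hk u => by
      simp only [predKind, if_neg (show ¬ k ≤ 1 by lia)]; rfl) v v'
  have hmix := fun s => (H.regularModel hε (mixKind s)).exists_integral_windowScore_bound
    (P := M.P θ) hθ measurable_hidden (measurable_observe ε (mixKind s)) 0 v v'
  obtain ⟨B₁, hB₁, h₁⟩ := hpred .clean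
  obtain ⟨B₂, hB₂, h₂⟩ := hpred .noisy
  obtain ⟨B₃, hB₃, h₃⟩ := hmix 1
  obtain ⟨B₄, hB₄, h₄⟩ := hmix 0
  have hclean : ∀ n : ℕ, M.windowInfo ε θ v v' (mixKind 1) (-(n : ℤ)) (n + 0) =
      M.windowInfo ε θ v v' (fun _ => .clean) 0 n := fun n => by
    rw [← H.windowInfo_const hε hθ v v' .clean n, add_zero]
    refine M.windowInfo_congr ε θ v v' fun k _ hk => ?_
    simp only [mixKind, if_pos (show k < 1 by lia)]
  have hnoisy : ∀ k : ℕ, M.windowInfo ε θ v v' (mixKind 1) (-((0 : ℕ) : ℤ)) (0 + k) =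
      M.windowInfo ε θ v v' (fun _ => .noisy) 0 k := fun k => by
    rw [zero_add]
    refine M.windowInfo_congr ε θ v v' fun k hk _ => ?_
    simp only [mixKind, if_neg (show ¬ k < 1 by simp at hk; lia)]
  -- `F n k` is the information in `n` clean observations followed by `k` noisy ones; when one index
  -- is `0` only one kind remains.
  refine eq_add_of_telescoping (F := fun n k => M.windowInfo ε θ v v' (mixKind 1) (-(n : ℤ)) (n + k))
    (B := B₁ + B₂ + B₃ + B₄) hr0.le hr1 (by positivity) (fun j => ?_) (fun j => ?_) fun n k => ?_
  · simp only [hclean]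
    rw [H.windowInfo_const_succ hε hθ]
    refine (h₁ (j + 1) (by lia)).trans (mul_le_mul_of_nonneg_right ?_ (by positivity))
    linarith
  · simp only [hnoisy]
    rw [H.windowInfo_const_succ hε hθ]
    refine (h₂ (j + 1) (by lia)).trans (mul_le_mul_of_nonneg_right ?_ (by positivity))
    linarith
  · rw [H.windowInfo_mix_sub hε hθ]
    have a₃ := h₃ (n + 1) k (by lia)
    have a₄ := h₄ (n + 1) k (by lia)
    have hp : 0 ≤ rate c C ^ (n + 1) + rate c C ^ k := by positivity
    have e : ∀ a b a' b' : ℝ, a - b - (a' - b') = (a - a') - (b - b') := fun _ _ _ _ => by ring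
    rw [e]
    refine (abs_sub _ _).trans ((add_le_add a₃ a₄).trans ?_)
    rw [← add_mul]
    exact mul_le_mul_of_nonneg_right (by linarith) hp

end Regular

end HMMFamily

/-! ### The σ-algebras and densities of the statement in terms of observation patterns -/

lemma comap_eq_comap_of_factors {α β γ : Type*} [mβ : MeasurableSpace β] [mγ : MeasurableSpace γ]
    {f : α → β} {g : α → γ} {φ : β → γ} {ψ : γ → β} (hφ : Measurable φ) (hψ : Measurable ψ)
    (h1 : ∀ a, g a = φ (f a)) (h2 : ∀ a, f a = ψ (g a)) :
    MeasurableSpace.comap f mβ = MeasurableSpace.comap g mγ := by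
  obtain rfl : g = φ ∘ f := funext h1
  refine le_antisymm ?_ ?_
  · have : f = ψ ∘ (φ ∘ f) := funext h2
    conv_lhs => rw [this]
    rw [← MeasurableSpace.comap_comp]
    exact MeasurableSpace.comap_mono hψ.comap_le
  · rw [← MeasurableSpace.comap_comp]
    exact MeasurableSpace.comap_mono hφ.comap_le

namespace HMMFamily

variable {𝓧 : Type*} [MeasurableSpace 𝓧] {d m : ℕ}

/-- Missing observations are the constant `0` and the value at time `1` is overwritten by `0`, so
the path carries the past and nothing else. -/
lemma comap_past_eq (ε : ℝ) (κ : ObsKind) :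
    MeasurableSpace.comap (fun (ω : Sample 𝓧 m) (k : Set.Iic (0 : ℤ)) => observe ε (fun _ => κ) ω k)
        inferInstance =
      MeasurableSpace.comap (fun ω => Function.update (observe ε (predKind κ) ω) 1 0)
        MeasurableSpace.pi := by
  refine comap_eq_comap_of_factors
    (φ := fun (w : Set.Iic (0 : ℤ) → EuclideanSpace ℝ (Fin m)) j =>
      if h : j ≤ 0 then w ⟨j, h⟩ else 0)
    (ψ := fun (u : ℤ → EuclideanSpace ℝ (Fin m)) (k : Set.Iic (0 : ℤ)) => u k) ?_ ?_ ?_ ?_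
  · refine measurable_pi_lambda _ fun j => ?_
    by_cases h : j ≤ 0
    · simp only [h, dite_true]; exact measurable_pi_apply _
    · simp only [h, dite_false]; exact measurable_const
  · exact measurable_pi_lambda _ fun k => measurable_pi_apply _
  · intro ω
    ext j : 1
    rcases eq_or_ne j 1 with rfl | hj
    · simp
    · rw [Function.update_of_ne hj]
      by_cases h : j ≤ 0
      · simp [h, observe, predKind, show j ≤ 1 by lia]
      · simp [h, observe, predKind, show ¬ j ≤ 1 by lia, obs]
  · intro ω
    ext k : 1
    have hk : (k : ℤ) ≤ 0 := k.2
    rw [Function.update_of_ne (by lia)]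
    simp [observe, predKind, show (k : ℤ) ≤ 1 by lia]

/-- For `s = 0` and `s = 1` the patterns differ at time `0` alone, which is overwritten. -/
lemma sigmaMix_eq (ε : ℝ) {s : ℤ} (hs0 : 0 ≤ s) (hs1 : s ≤ 1) :
    sigmaMix 𝓧 m ε =
      MeasurableSpace.comap (fun ω => Function.update (observe ε (mixKind s) ω) 0 0)
        MeasurableSpace.pi := by
  refine comap_eq_comap_of_factors
    (φ := fun (w : (Set.Iio (0 : ℤ) → EuclideanSpace ℝ (Fin m)) ×
      (Set.Ioi (0 : ℤ) → EuclideanSpace ℝ (Fin m))) j =>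
      if h : j < 0 then w.1 ⟨j, h⟩ else if h' : 0 < j then w.2 ⟨j, h'⟩ else 0)
    (ψ := fun (u : ℤ → EuclideanSpace ℝ (Fin m)) =>
      ((fun k : Set.Iio (0 : ℤ) => u k), (fun k : Set.Ioi (0 : ℤ) => u k))) ?_ ?_ ?_ ?_
  · refine measurable_pi_lambda _ fun j => ?_
    by_cases h : j < 0
    · simp only [h, dite_true]; exact (measurable_pi_apply _).comp measurable_fst
    · by_cases h' : 0 < j
      · simp only [h, h', dite_false, dite_true]; exact (measurable_pi_apply _).comp measurable_snd
      · simp only [h, h', dite_false]; exact measurable_const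
  · exact (measurable_pi_lambda _ fun k => measurable_pi_apply _).prodMk
      (measurable_pi_lambda _ fun k => measurable_pi_apply _)
  · intro ω
    ext j : 1
    rcases lt_trichotomy j 0 with hj | rfl | hj
    · rw [Function.update_of_ne hj.ne]
      simp [hj, observe, mixKind, show j < s by lia, obs, Y]
    · simp
    · rw [Function.update_of_ne hj.ne']
      simp [hj, hj.not_gt, observe, mixKind, show ¬ j < s by lia, obs, Yn]
  · intro ω
    refine Prod.ext ?_ ?_
    · ext k : 1
      have hk : (k : ℤ) < 0 := k.2
      change Y ω k = Function.update (observe ε (mixKind s) ω) 0 0 (k : ℤ)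
      rw [Function.update_of_ne hk.ne]
      simp [observe, mixKind, show (k : ℤ) < s by lia, obs, Y]
    · ext k : 1
      have hk : 0 < (k : ℤ) := k.2
      change Yn ε ω k = Function.update (observe ε (mixKind s) ω) 0 0 (k : ℤ)
      rw [Function.update_of_ne hk.ne']
      simp [observe, mixKind, show ¬ (k : ℤ) < s by lia, obs, Yn]

lemma observe_mixKind (ε : ℝ) (s : ℤ) :
    observe (𝓧 := 𝓧) (m := m) ε (mixKind s) = Ymix ε s := by
  ext ω k : 2
  unfold observe mixKind Ymix
  split_ifs <;> rfl

lemma admissible_mixKind (M : HMMFamily 𝓧 d m) (ε : ℝ) (s : ℤ) :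
    M.admissible ε (mixKind s) = M.admissibleMix ε s := by
  ext u
  constructor
  · intro h
    refine ⟨fun k hk => ?_, fun k hk => ?_⟩
    · have := h k
      rwa [mixKind, if_pos hk] at this
    · have := h k
      rwa [mixKind, if_neg (not_lt.2 hk)] at this
  · rintro ⟨h1, h2⟩ k
    unfold mixKind
    split_ifs with hk
    · exact h1 k hk
    · exact h2 k (not_lt.1 hk)

lemma obsDensity_clean_of_mem (M : HMMFamily 𝓧 d m) (ε : ℝ) (θ : EuclideanSpace ℝ (Fin d))
    {y : EuclideanSpace ℝ (Fin m)} (hy : y ∈ M.obsSupport ε .clean) :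
    M.obsDensity ε .clean θ y = M.g θ y := by
  ext x
  exact if_pos hy

lemma obsDensity_noisy_of_mem (M : HMMFamily 𝓧 d m) (ε : ℝ) (θ : EuclideanSpace ℝ (Fin d))
    {y : EuclideanSpace ℝ (Fin m)} (hy : y ∈ M.obsSupport ε .noisy) :
    M.obsDensity ε .noisy θ y = M.gNoisy ε θ y := by
  ext x
  exact if_neg hy

lemma emission_eq_patLik (M : HMMFamily 𝓧 d m) (ε : ℝ) (θ : EuclideanSpace ℝ (Fin d))
    {u : ℤ → EuclideanSpace ℝ (Fin m)} (hu : u ∈ M.admissible ε fun _ => .clean) :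
    M.emission θ u = M.patLik ε (fun _ => .clean) θ u := by
  ext k x
  exact (congrFun (M.obsDensity_clean_of_mem ε θ (hu k)) x).symm

lemma emissionNoisy_eq_patLik (M : HMMFamily 𝓧 d m) (ε : ℝ) (θ : EuclideanSpace ℝ (Fin d))
    {u : ℤ → EuclideanSpace ℝ (Fin m)} (hu : u ∈ M.admissible ε fun _ => .noisy) :
    M.emissionNoisy ε θ u = M.patLik ε (fun _ => .noisy) θ u := by
  ext k x
  exact (congrFun (M.obsDensity_noisy_of_mem ε θ (hu k)) x).symm

lemma emissionMix_eq_patLik (M : HMMFamily 𝓧 d m) (ε : ℝ) (s : ℤ) (θ : EuclideanSpace ℝ (Fin d))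
    {u : ℤ → EuclideanSpace ℝ (Fin m)} (hu : u ∈ M.admissible ε (mixKind s)) :
    M.emissionMix ε s θ u = M.patLik ε (mixKind s) θ u := by
  ext k x
  have h := hu k
  unfold emissionMix patLik
  unfold mixKind at h ⊢
  split_ifs with hk
  · rw [if_pos hk] at h
    rw [M.obsDensity_clean_of_mem ε θ h]
  · rw [if_neg hk] at h
    rw [M.obsDensity_noisy_of_mem ε θ h]

instance neBot_predFilter [Nonempty 𝓧] : (predFilter 𝓧).NeBot := by
  unfold predFilter; infer_instance

instance neBot_smoothFilter [Nonempty 𝓧] : (smoothFilter 𝓧).NeBot := by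
  unfold smoothFilter; infer_instance

lemma sigmaMix_le (ε : ℝ) : sigmaMix 𝓧 m ε ≤ (inferInstance : MeasurableSpace (Sample 𝓧 m)) := by
  rw [sigmaMix_eq ε le_rfl zero_le_one]
  have hup : Measurable fun u : ℤ → EuclideanSpace ℝ (Fin m) => Function.update u 0 0 :=
    measurable_update'.comp (measurable_id.prodMk measurable_const)
  exact (hup.comp (measurable_observe ε (mixKind 0))).comap_le

namespace Regular

variable {M : HMMFamily 𝓧 d m} {G : Set (EuclideanSpace ℝ (Fin d))} {c C S : ℝ} {ε : ℝ}
  {θ : EuclideanSpace ℝ (Fin d)} [Nonempty 𝓧] [NeZero M.μ]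

/-- The prediction window ends at time `1`, so it cannot distinguish the constant pattern from the
one with missing future, for which the one-sided limit is available. -/
lemma tendsto_predWindow (H : M.Regular G c C S) (hε : 0 < ε) (hθ : θ ∈ M.Θ) (κ : ObsKind)
    (u : ℤ → EuclideanSpace ℝ (Fin m)) :
    Tendsto (predWindow (M.q θ) M.μ (M.patLik ε (fun _ => κ) θ u)) (predFilter 𝓧)
      (𝓝 (condDensity (M.q θ) M.μ (M.patLik ε (predKind κ) θ u) 1)) := by
  have R := ((H.regularModel hε (predKind κ)).emission θ hθ).regular u
  refine (R.tendsto_condLik_of_one (t := 1) fun k hk => ?_).congr fun w => ?_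
  · simp only [predKind, if_neg (show ¬ k ≤ 1 by lia)]; rfl
  · unfold predWindow
    rw [sub_self, zero_sub]
    refine condLik_congr 1 (fun k _ hk => ?_) w.2
    unfold patLik
    simp only [predKind, if_pos (show k ≤ 1 by push_cast at hk; lia)]

lemma tendsto_smoothWindow (H : M.Regular G c C S) (hε : 0 < ε) (hθ : θ ∈ M.Θ) (κ : ℤ → ObsKind)
    (u : ℤ → EuclideanSpace ℝ (Fin m)) :
    Tendsto (smoothWindow (M.q θ) M.μ (M.patLik ε κ θ u)) (smoothFilter 𝓧)
      (𝓝 (condDensity (M.q θ) M.μ (M.patLik ε κ θ u) 0)) := by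
  have R := ((H.regularModel hε κ).emission θ hθ).regular u
  refine (R.tendsto_condLik 0).congr fun w => ?_
  unfold smoothWindow
  rw [zero_sub]
  rfl

end Regular

end HMMFamily

end ABCHMM

end

/-! ### Proof of the theorem -/

open ABCHMM HMMFamily in
theorem mainTheorem6 {𝓧 : Type*} [TopologicalSpace 𝓧] [PolishSpace 𝓧] [CompactSpace 𝓧]
    [MeasurableSpace 𝓧] [BorelSpace 𝓧] {d m : ℕ} (hm : 1 ≤ m)
    (M : ABCHMM.HMMFamily 𝓧 d m) (θ₀ : EuclideanSpace ℝ (Fin d))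
    (h1 : M.A1 θ₀) (h2 : M.A2) (h3 : M.A3)
    (r : ℝ) (hr : 0 < r) (hG : Metric.ball θ₀ r ⊆ M.Θ)
    (h4 : M.A4 (Metric.ball θ₀ r)) (h5 : M.A5 (Metric.ball θ₀ r))
    (ε : ℝ) (hε : 0 < ε) :
    -- the four conditional densities and their scores are well defined
    M.IsCondDensity θ₀ M.pPred (ABCHMM.predFilter 𝓧)
      (fun θ u => ABCHMM.predWindow (M.q θ) M.μ (M.emission θ u))
      {u | ∀ k, u k ∈ M.𝒴} ABCHMM.Y 1 (ABCHMM.sigmaPast 𝓧 m) M.ν ∧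
    M.IsCondDensity θ₀ (M.pPredNoisy ε) (ABCHMM.predFilter 𝓧)
      (fun θ u => ABCHMM.predWindow (M.q θ) M.μ (M.emissionNoisy ε θ u))
      {u | ∀ k, M.ν (Metric.closedBall (u k) ε) ≠ 0} (ABCHMM.Yn ε) 1
      (ABCHMM.sigmaPastNoisy 𝓧 m ε) (M.νNoisy ε) ∧
    M.IsCondDensity θ₀ (M.pMix ε 1) (ABCHMM.smoothFilter 𝓧)
      (fun θ u => ABCHMM.smoothWindow (M.q θ) M.μ (M.emissionMix ε 1 θ u))
      (M.admissibleMix ε 1) (ABCHMM.Ymix ε 1) 0 (ABCHMM.sigmaMix 𝓧 m ε) M.ν ∧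
    M.IsCondDensity θ₀ (M.pMix ε 0) (ABCHMM.smoothFilter 𝓧)
      (fun θ u => ABCHMM.smoothWindow (M.q θ) M.μ (M.emissionMix ε 0 θ u))
      (M.admissibleMix ε 0) (ABCHMM.Ymix ε 0) 0 (ABCHMM.sigmaMix 𝓧 m ε) (M.νNoisy ε) ∧
    -- the missing information principle
    M.fisher θ₀ = M.fisherNoisy ε θ₀ + M.meanMissingInfo ε θ₀ := by
  obtain ⟨c, C, S, H⟩ := M.exists_regular Metric.isOpen_ball hG h3 h4 h5
  have hθ₀ : θ₀ ∈ Metric.ball θ₀ r := Metric.mem_ball_self hr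
  have hΘ := H.subset hθ₀
  have := M.nonempty_hidden hΘ
  have := M.neZero_μ hΘ
  have := M.isProbabilityMeasure_P hΘ
  have hκ : ∀ κ : ObsKind, ∀ k, predKind κ k ≠ .missing → (fun _ => κ) k = predKind κ k := by
    intro κ k hk
    unfold predKind at hk ⊢
    split_ifs at hk ⊢
    · rfl
    · exact absurd rfl hk
  have wc : ∀ θ ∈ M.Θ, ∀ u ∈ M.admissible ε fun _ => .clean,
      Tendsto (predWindow (M.q θ) M.μ (M.emission θ u)) (predFilter 𝓧)
        (𝓝 (condDensity (M.q θ) M.μ (M.patLik ε (predKind .clean) θ u) 1)) := fun θ hθ u hu => by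
    rw [M.emission_eq_patLik ε θ hu]; exact H.tendsto_predWindow hε hθ _ u
  have wn : ∀ θ ∈ M.Θ, ∀ u ∈ M.admissible ε fun _ => .noisy,
      Tendsto (predWindow (M.q θ) M.μ (M.emissionNoisy ε θ u)) (predFilter 𝓧)
        (𝓝 (condDensity (M.q θ) M.μ (M.patLik ε (predKind .noisy) θ u) 1)) := fun θ hθ u hu => by
    rw [M.emissionNoisy_eq_patLik ε θ hu]; exact H.tendsto_predWindow hε hθ _ u
  have wm : ∀ s, ∀ θ ∈ M.Θ, ∀ u ∈ M.admissible ε (mixKind s),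
      Tendsto (smoothWindow (M.q θ) M.μ (M.emissionMix ε s θ u)) (smoothFilter 𝓧)
        (𝓝 (condDensity (M.q θ) M.μ (M.patLik ε (mixKind s) θ u) 0)) := fun s θ hθ u hu => by
    rw [M.emissionMix_eq_patLik ε s θ hu]; exact H.tendsto_smoothWindow hε hθ _ u
  -- The filters are proper, so `limUnder` in the definitions is the limit just found.
  have pc := fun θ hθ u hu => (wc θ hθ u hu).limUnder_eq
  have pn := fun θ hθ u hu => (wn θ hθ u hu).limUnder_eq
  have pm := fun s θ hθ u hu => (wm s θ hθ u hu).limUnder_eq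
  have Dm : ∀ s : ℤ, 0 ≤ s → s ≤ 1 → M.IsCondDensity θ₀ (M.pMix ε s) (smoothFilter 𝓧)
      (fun θ u => smoothWindow (M.q θ) M.μ (M.emissionMix ε s θ u))
      (M.admissibleMix ε s) (Ymix ε s) 0 (sigmaMix 𝓧 m ε) (M.obsMeasure ε (mixKind s 0)) := by
    intro s hs0 hs1
    rw [← admissible_mixKind, ← observe_mixKind]
    exact H.isCondDensity hε hθ₀ (fun _ _ => rfl) (by unfold mixKind; split_ifs <;> simp)
      (pm s) (wm s) (sigmaMix_eq ε hs0 hs1)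
  refine ⟨H.isCondDensity hε hθ₀ (hκ .clean) (by simp [predKind]) pc wc (comap_past_eq ε .clean),
    H.isCondDensity hε hθ₀ (hκ .noisy) (by simp [predKind]) pn wn (comap_past_eq ε .noisy),
    Dm 1 zero_le_one le_rfl, Dm 0 le_rfl zero_le_one, ?_⟩
  have em : ∀ (s : ℤ) i j,
      ∫ ω, score (M.pMix ε s) θ₀ (Ymix ε s ω) i * score (M.pMix ε s) θ₀ (Ymix ε s ω) j ∂M.P θ₀ =
      M.limInfo ε θ₀ (EuclideanSpace.single i 1) (EuclideanSpace.single j 1) (mixKind s) 0 := by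
    intro s i j
    rw [← observe_mixKind]
    exact H.integral_score_mul_score hε hθ₀ (fun _ _ => rfl) (pm s) i j
  ext i j
  have e1 : M.fisher θ₀ i j = M.limInfo ε θ₀ (EuclideanSpace.single i 1)
      (EuclideanSpace.single j 1) (predKind .clean) 1 :=
    H.integral_score_mul_score hε hθ₀ (hκ .clean) pc i j
  have e2 : M.fisherNoisy ε θ₀ i j = M.limInfo ε θ₀ (EuclideanSpace.single i 1)
      (EuclideanSpace.single j 1) (predKind .noisy) 1 :=
    H.integral_score_mul_score hε hθ₀ (hκ .noisy) pn i j
  have e3 : M.meanMissingInfo ε θ₀ i j =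
      M.limInfo ε θ₀ (EuclideanSpace.single i 1) (EuclideanSpace.single j 1) (mixKind 1) 0 -
      M.limInfo ε θ₀ (EuclideanSpace.single i 1) (EuclideanSpace.single j 1) (mixKind 0) 0 := by
    rw [← em 1, ← em 0]
    change ∫ ω, ((M.P θ₀)[fun ω' => score (M.pMix ε 1) θ₀ (Ymix ε 1 ω') i *
        score (M.pMix ε 1) θ₀ (Ymix ε 1 ω') j | sigmaMix 𝓧 m ε]) ω -
      ((M.P θ₀)[fun ω' => score (M.pMix ε 0) θ₀ (Ymix ε 0 ω') i *
        score (M.pMix ε 0) θ₀ (Ymix ε 0 ω') j | sigmaMix 𝓧 m ε]) ω ∂M.P θ₀ = _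
    -- The mean of a conditional expectation is the plain mean, so the conditioning disappears.
    rw [integral_sub integrable_condExp integrable_condExp, integral_condExp (sigmaMix_le ε),
      integral_condExp (sigmaMix_le ε)]
  rw [Matrix.add_apply, e1, e2, e3]
  exact H.limInfo_eq hε hθ₀ _ _
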